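/- Let $\alpha$ be an infinite ordinal that is exponentially closed (i.e. $\beta^\gamma<\alpha$ for all $\beta,\gamma<\alpha$) and ITRM-singular (defined below). An $\alpha$-ITRM-program is a nonempty finite register machine program whose instructions set a register to $0$, increase a register by $1$, copy one register into another, or jump to a given program line if a given Boolean combination of equalities $R_i=R_j$ between register contents holds. Registers contain ordinals $<\alpha$; the computation starts in the first program line, with the inputs in the first registers and $0$ in all others. At successor times the active instruction is carried out as usual. At limit times the active program line and each register content are the inferior limits of the earlier program lines and of the earlier contents of that register, except that a register whose inferior limit is $\alpha$ is reset to $0$. The machine halts when there is no instruction in the active line; steps are numbered by the times at which they are carried out, and $P$ halts in exactly $\gamma$ many steps if the step at time $\gamma$ is the one by which it halts (so that $\gamma+1$ is the first time without active instruction). The output of a halting computation is the content of the first register. A set $x\subseteq\alpha$ is $\alpha$-ITRM-computable if there are a program $P$ and a parameter $\gamma<\alpha$ such that for every $\iota<\alpha$, $P(\iota,\gamma)$ halts with output $1$ if $\iota\in x$ and with output $0$ if $\iota\notin x$. The ordinal $\alpha$ is ITRM-singular if there are $\beta<\alpha$, a cofinal function $f:\beta\to\alpha$, a program $P$ and $\xi<\alpha$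 such that $P(\iota,\xi)$ halts with output $f(\iota)$ for all $\iota<\beta$. Let $p$ be the ordinal pairing function, i.e. the order isomorphism onto the ordinals from the pairs of ordinals, ordered by the maximum and then lexicographically. An $\alpha$-code for an ordinal $\gamma>0$ is a set $\{p(\iota,\xi):\iota,\xi<\alpha,\ f(\iota)\in f(\xi)\}$ with $f:\alpha\to\gamma$ surjective; the $\alpha$-code for $0$ is $\emptyset$. An ordinal is $\alpha$-ITRM-computable if it has an $\alpha$-ITRM-computable $\alpha$-code, and $\gamma$ is $\alpha$-ITRM-clockable if there are a program $P$ and $\zeta<\alpha$ such that $P(\zeta)$ halts in exactly $\gamma$ many steps. Theorem. Every $\alpha$-ITRM-clockable ordinal is $\alpha$-ITRM-computable. Moreover, the suprema of the $\alpha$-ITRM-clockable ordinals and of the $\alpha$-ITRM-computable ordinals exist and coincide. -/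

import Mathlib

universe u

namespace ITRM

/-- Jump conditions: Boolean combinations of equalities between register contents. -/
inductive Cond : Type
  | eq (i j : ℕ)
  | not (φ : Cond)
  | and (φ ψ : Cond)
  | or (φ ψ : Cond)

/-- Truth of a jump condition for given register contents. -/
def Cond.Holds (r : ℕ → Ordinal.{u}) : Cond → Prop
  | .eq i j => r i = r j
  | .not φ => ¬ φ.Holds r
  | .and φ ψ => φ.Holds r ∧ ψ.Holds r
  | .or φ ψ => φ.Holds r ∨ ψ.Holds r

/-- Register machine instructions: set register `i` to zero, increase register `i` by one,
copy register `i` into register `j`, jump to line `l` if the condition `φ` holds. -/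
inductive Instr : Type
  | zero (i : ℕ)
  | inc (i : ℕ)
  | copy (i j : ℕ)
  | jump (φ : Cond) (l : ℕ)

/-- A program is a nonempty finite list of instructions; its lines are numbered from `0`. -/
structure Program where
  code : List Instr
  ne_nil : code ≠ []

/-- A configuration: the active program line and the contents of the registers
`0, 1, 2, …`. A program mentions only finitely many registers; all the others keep their
initial content forever. -/
@[ext]
structure Config : Type (u + 1) where
  line : ℕ
  reg : ℕ → Ordinal.{u}

/-- A configuration is a halting configuration if the active line is not a line of the
program. -/
def Program.Halted (P : Program) (C : Config.{u}) : Prop :=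
  P.code.length ≤ C.line

open Classical in
/-- Execution of a single instruction. -/
noncomputable def Instr.exec (C : Config.{u}) : Instr → Config.{u}
  | .zero i => ⟨C.line + 1, Function.update C.reg i 0⟩
  | .inc i => ⟨C.line + 1, Function.update C.reg i (Order.succ (C.reg i))⟩
  | .copy i j => ⟨C.line + 1, Function.update C.reg j (C.reg i)⟩
  | .jump φ l => ⟨if φ.Holds C.reg then l else C.line + 1, C.reg⟩

/-- One step of the computation: execute the active line; a halting configuration is
repeated without change. -/
noncomputable def Program.step (P : Program) (C : Config.{u}) : Config.{u} :=
  match P.code[C.line]? with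
  | some I => I.exec C
  | none => C

/-- The content of a register of an `α`-ITRM at a limit time, obtained from the inferior limit
`l` of its earlier contents: it is `l`, except that the register is reset to `0` when `l`
reaches `α`. -/
noncomputable def reset (α l : Ordinal.{u}) : Ordinal.{u} :=
  if l < α then l else 0

/-- The initial configuration with input `v` in the first registers: the first line is active
and all further registers contain `0`. -/
def initial (v : List Ordinal.{u}) : Config.{u} :=
  ⟨0, fun i => v.getD i 0⟩

/-- The configuration at time `τ` in the computation of the `α`-ITRM-program `P` on the
input `v`. At limit times, the active line and the register contents are the inferior limits
of the earlier ones, with overflowing registers reset to `0`. -/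
noncomputable def Program.config (P : Program) (α : Ordinal.{u}) (v : List Ordinal.{u})
    (τ : Ordinal.{u}) : Config.{u} :=
  Ordinal.limitRecOn τ
    (initial v)
    (fun _ C => P.step C)
    (fun lam _ C =>
      { line := Filter.liminf (fun σ : Set.Iio lam => (C σ.1 σ.2).line) Filter.atTop
        reg := fun i =>
          reset α (Filter.liminf (fun σ : Set.Iio lam => (C σ.1 σ.2).reg i) Filter.atTop) })

/-- On input `v`, the `α`-ITRM-program `P` halts in exactly `τ` many steps: the steps are
numbered by the times `0, 1, …, ω, …` at which they are carried out, and the step at time `τ` is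
the act of halting, so that `τ + 1` is the first time with a halting configuration. (A
halting configuration can never appear for the first time at a limit time, since the inferior
limit of lines of the program is again a line of the program; with this usual way of counting
limit ordinals can be halting times.) -/
def Program.HaltsIn (P : Program) (α : Ordinal.{u}) (v : List Ordinal.{u})
    (τ : Ordinal.{u}) : Prop :=
  P.Halted (P.config α v (τ + 1)) ∧ ∀ σ ≤ τ, ¬ P.Halted (P.config α v σ)

/-- On input `v`, the `α`-ITRM-program `P` halts with output `ρ` in the first register. -/
def Program.Outputs (P : Program) (α : Ordinal.{u}) (v : List Ordinal.{u})
    (ρ : Ordinal.{u}) : Prop :=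
  ∃ τ, P.HaltsIn α v τ ∧ (P.config α v (τ + 1)).reg 0 = ρ

/-- `x ⊆ α` is `α`-ITRM-computable: some program with some parameter `γ < α` computes the
characteristic function of `x` on `α`. -/
def ComputableSet (α : Ordinal.{u}) (x : Set Ordinal.{u}) : Prop :=
  x ⊆ Set.Iio α ∧ ∃ P : Program, ∃ γ < α, ∀ ι < α,
    (ι ∈ x → P.Outputs α [ι, γ] 1) ∧ (ι ∉ x → P.Outputs α [ι, γ] 0)

/-- The canonical well-ordering of pairs of ordinals: first by the maximum, then
lexicographically. -/
def PairLT (y x : Ordinal.{u} × Ordinal.{u}) : Prop :=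
  max y.1 y.2 < max x.1 x.2 ∨
    (max y.1 y.2 = max x.1 x.2 ∧ (y.1 < x.1 ∨ (y.1 = x.1 ∧ y.2 < x.2)))

/-- The ordinal pairing function: the order isomorphism from pairs of ordinals, ordered by
`PairLT`, to the ordinals. It sends a pair to the least ordinal larger than the codes of all
smaller pairs. -/
noncomputable def pair (x : Ordinal.{u} × Ordinal.{u}) : Ordinal.{u} :=
  sInf {o | ∀ y, ∀ _h : PairLT y x, pair y < o}
termination_by (max x.1 x.2, x.1, x.2)
decreasing_by
  simpa [PairLT, Prod.lex_def] using _h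

/-- `c` is an `α`-code for the ordinal `γ`, i.e. for the structure `(γ, ∈)`: for some surjection
`f : α → γ`, `c` is the set of all `pair (ι, ξ)` with `f ι ∈ f ξ`. For the empty structure, onto
which `α` has no map, the code is the empty set. -/
def IsCode (α γ : Ordinal.{u}) (c : Set Ordinal.{u}) : Prop :=
  (γ = 0 ∧ c = ∅) ∨
    ∃ f : Set.Iio α → Set.Iio γ, Function.Surjective f ∧
      c = {o | ∃ ι ξ : Set.Iio α, f ι < f ξ ∧ o = pair (ι.1, ξ.1)}

/-- `γ` is `α`-ITRM-computable: it has an `α`-ITRM-computable `α`-code. -/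
def ComputableOrdinal (α γ : Ordinal.{u}) : Prop :=
  ∃ c, IsCode α γ c ∧ ComputableSet α c

/-- `γ` is `α`-ITRM-clockable: `P(ζ)` halts in exactly `γ` many steps for some program `P` and
some `ζ < α`. -/
def Clockable (α γ : Ordinal.{u}) : Prop :=
  ∃ P : Program, ∃ ζ < α, P.HaltsIn α [ζ] γ

/-- `α` is exponentially closed: it is an infinite ordinal closed under ordinal
exponentiation. -/
def ExponentiallyClosed (α : Ordinal.{u}) : Prop :=
  Ordinal.omega0 ≤ α ∧ Ordinal.IsPrincipal (fun a b => a ^ b) α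

/-- `α` is ITRM-singular: some function that is cofinal from some `β < α` to `α` is computed by
an `α`-ITRM-program with a parameter `ξ < α`. -/
def Singular (α : Ordinal.{u}) : Prop :=
  ∃ β < α, ∃ f : Ordinal.{u} → Ordinal.{u},
    (∀ ι < β, f ι < α) ∧ (∀ γ < α, ∃ ι < β, γ ≤ f ι) ∧
    ∃ P : Program, ∃ ξ < α, ∀ ι < β, P.Outputs α [ι, ξ] (f ι)

end ITRM

/-! Clockable ordinals are computable. Let `P(ζ)` halt in exactly `γ` steps. Only finitely many
registers matter, so a configuration is a finite tuple of ordinals below `α`, coded by iterated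
pairing. A time `τ < γ` is named by its configuration together with the number of earlier times with
that configuration. These numbers stay below `ω ^ ω` (`count_config_lt`): if a configuration `C`
recurs, then `ω` repetitions of its shortest cycle lead to a configuration that is pointwise at most
`C`, and different from `C`, since otherwise the cycle would repeat forever. So `C` occurs at most
about `ω` times as often as some smaller configuration, and the pointwise order of finite tuples is
well-founded. Singularity excludes `α = ω`, hence `ω ^ ω < α` by exponential closure, and every time
below `γ` has a name below `α`. Two names are compared by a program that simulates `P(ζ)`, counts
the occurrences of both configurations without overflow, and keeps track of which named time came
last (`exec_clockCmd`, `answer_eq_timeOf`).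

Clockable ordinals are cofinal in the computable ones. A code for `γ` is a decidable relation on `α`
with a rank function `F` onto `γ`. A depth-first search of the descending sequences from `x` lasts
longer than `F x`, because it contains searches from elements of every smaller rank
(`SearchData.seg_visit`). There are two obstacles. The stack has to survive limit times: a node is
the pair of its context (parent and position in the parent's scan) and its label. Pairing dominates
both components, so during the search of a subtree the stack registers never fall below the values
of the suspended scan, and inferior limits restore that scan. For this the position is stored as `a
+ y`, with `a` the code of the node and `y` the number of the child. Moreover, a scan through all
`α` candidates would overflow; by singularity it is cut into `β < α` blocks of lengths `f w < α`,
one intermediate node for each block.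

Consequently both sets have the same upper bounds, and a cardinality bound on the computable
ordinals makes the supremum exist.

Programs are verified with `Exec`, which carries a lower bound on the running time and a condition
`T` on all intermediate contents. Limit times enter through `Seg.concat`: a loop head is the least
line of its loop, and if during each iteration the registers stay above the smaller of their values
at its two ends, then the contents at limits depend only on the values at the loop heads. -/

namespace ITRM

open Order Set

/-! ### Inferior limits along an ordinal -/

/-- `l` is the inferior limit of `f` at the limit ordinal `lam`. -/
def IsLimInf {X : Type*} [LinearOrder X] (f : Ordinal.{u} → X) (lam : Ordinal.{u}) (l : X) : Prop :=
  (∀ b < l, ∃ η < lam, ∀ σ, η ≤ σ → σ < lam → b < f σ) ∧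
    ∀ η < lam, ∃ σ, η ≤ σ ∧ σ < lam ∧ f σ ≤ l

section LimInf

variable {X : Type*} [LinearOrder X] {f : Ordinal.{u} → X} {lam : Ordinal.{u}} {l l' : X}

theorem exists_isLimInf [WellFoundedLT X] {b : X}
    (h : ∀ η < lam, ∃ σ, η ≤ σ ∧ σ < lam ∧ f σ ≤ b) : ∃ l ≤ b, IsLimInf f lam l := by
  let S : Set X := {b | ∀ η < lam, ∃ σ, η ≤ σ ∧ σ < lam ∧ f σ ≤ b}
  have hS : S.Nonempty := ⟨b, h⟩
  refine ⟨wellFounded_lt.min S hS, not_lt.1 (wellFounded_lt.not_lt_min S h), ?_,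
    wellFounded_lt.min_mem S hS⟩
  intro c hc
  have : c ∉ S := fun hcS => wellFounded_lt.not_lt_min S hcS hc
  simpa [S] using this

theorem exists_isLimInf_ordinal (f : Ordinal.{u} → Ordinal.{u})
    (lam : Ordinal.{u}) : ∃ l, IsLimInf f lam l := by
  obtain ⟨b, hb⟩ := Ordinal.bddAbove_of_small (s := f '' Iio lam)
  obtain ⟨l, -, hl⟩ := exists_isLimInf (f := f) (lam := lam) (b := b)
    fun η hη => ⟨η, le_rfl, hη, hb ⟨η, hη, rfl⟩⟩
  exact ⟨l, hl⟩

theorem eventually_Iio_iff (hlam : IsSuccLimit lam) {p : Ordinal.{u} → Prop} :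
    (∀ᶠ σ : Iio lam in Filter.atTop, p σ.1) ↔ ∃ η < lam, ∀ σ, η ≤ σ → σ < lam → p σ := by
  have : Nonempty (Iio lam) := ⟨⟨0, hlam.bot_lt⟩⟩
  rw [Filter.eventually_atTop]
  constructor
  · rintro ⟨⟨η, hη⟩, H⟩
    exact ⟨η, hη, fun σ h1 h2 => H ⟨σ, h2⟩ h1⟩
  · rintro ⟨η, hη, H⟩
    exact ⟨⟨η, hη⟩, fun σ h => H σ.1 h σ.2⟩

/-- The filter version is the supremum of the eventual lower bounds. A strict bound `b` yields the
eventual lower bound `succ b`, which works for lines in `ℕ` and for ordinal contents alike. -/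
theorem IsLimInf.liminf_eq {X : Type*} [ConditionallyCompleteLinearOrderBot X] [SuccOrder X]
    [NoMaxOrder X] {f : Ordinal.{u} → X} {lam : Ordinal.{u}} {l : X} (hlam : IsSuccLimit lam)
    (h : IsLimInf f lam l) : Filter.liminf (fun σ : Iio lam => f σ.1) Filter.atTop = l := by
  have hup : ∀ a ∈ {a | ∀ᶠ σ : Iio lam in Filter.atTop, a ≤ f σ.1}, a ≤ l := by
    intro a ha
    obtain ⟨η, hη, H⟩ := (eventually_Iio_iff (p := fun σ => a ≤ f σ) hlam).1 ha
    obtain ⟨σ, h1, h2, h3⟩ := h.2 η hη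
    exact (H σ h1 h2).trans h3
  rw [Filter.liminf_eq]
  refine le_antisymm (csSup_le' hup) (le_of_forall_lt fun b hb => ?_)
  obtain ⟨η, hη, H⟩ := h.1 b hb
  refine (lt_succ b).trans_le (le_csSup ⟨l, hup⟩ ?_)
  exact (eventually_Iio_iff (p := fun σ => succ b ≤ f σ) hlam).2
    ⟨η, hη, fun σ h1 h2 => succ_le_of_lt (H σ h1 h2)⟩

/-- Inferior limits depend only on a tail, and `σ ↦ τ + σ` maps the times below `lam` onto the tail
of `τ + lam` that begins with `τ`. -/
theorem liminf_shift {X : Type*} [ConditionallyCompleteLinearOrderBot X]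
    (f : Ordinal.{u} → X) (τ : Ordinal.{u}) {lam : Ordinal.{u}} (hlam : IsSuccLimit lam) :
    Filter.liminf (fun σ : Iio (τ + lam) => f σ.1) Filter.atTop =
      Filter.liminf (fun σ : Iio lam => f (τ + σ.1)) Filter.atTop := by
  rw [Filter.liminf_eq, Filter.liminf_eq]
  congr 1
  ext a
  have h1 := eventually_Iio_iff (p := fun σ => a ≤ f σ) (Ordinal.isSuccLimit_add τ hlam)
  have h2 := eventually_Iio_iff (p := fun σ => a ≤ f (τ + σ)) hlam
  simp only [mem_ofPred_eq]
  rw [h1, h2]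
  constructor
  · rintro ⟨η, hη, H⟩
    refine ⟨η - τ, ?_, fun σ h1 h2 => H _ ?_ ?_⟩
    · rcases le_total τ η with h | h
      · exact (Ordinal.sub_lt_of_le h).2 hη
      · have : η - τ = 0 := by simpa [Ordinal.sub_eq_zero_iff_le] using h
        rw [this]; exact hlam.bot_lt
    · exact (Ordinal.le_add_sub _ _).trans (by gcongr)
    · gcongr
  · rintro ⟨η, hη, H⟩
    refine ⟨τ + η, by gcongr, fun σ h1 h2 => ?_⟩
    have h3 : τ ≤ σ := le_self_add.trans h1
    have := H (σ - τ) ((Ordinal.le_sub_of_le h3).2 h1) ((Ordinal.sub_lt_of_le h3).2 h2)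
    rwa [Ordinal.add_sub_cancel_of_le h3] at this

theorem IsLimInf.congr_of_eventually {g : Ordinal.{u} → X} (h : IsLimInf f lam l)
    {η₀ : Ordinal.{u}} (h₀ : η₀ < lam) (H : ∀ σ, η₀ ≤ σ → σ < lam → f σ = g σ) :
    IsLimInf g lam l := by
  refine ⟨fun b hb => ?_, fun η hη => ?_⟩
  · obtain ⟨η, hη, H'⟩ := h.1 b hb
    refine ⟨max η η₀, max_lt hη h₀, fun σ h1 h2 => ?_⟩
    rw [← H σ ((le_max_right _ _).trans h1) h2]
    exact H' σ ((le_max_left _ _).trans h1) h2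
  · obtain ⟨σ, h1, h2, h3⟩ := h.2 (max η η₀) (max_lt hη h₀)
    exact ⟨σ, (le_max_left _ _).trans h1, h2, by rwa [← H σ ((le_max_right _ _).trans h1) h2]⟩

theorem isLimInf_const (hlam : IsSuccLimit lam) (c : X) : IsLimInf (fun _ => c) lam c :=
  ⟨fun _ hb => ⟨0, hlam.bot_lt, fun _ _ _ => hb⟩, fun η hη => ⟨η, le_rfl, hη, le_rfl⟩⟩

theorem isLimInf_of_eventually_eq {c : X} {η₀ : Ordinal.{u}} (h₀ : η₀ < lam)
    (H : ∀ σ, η₀ ≤ σ → σ < lam → f σ = c) : IsLimInf f lam c :=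
  ⟨fun _ hb => ⟨η₀, h₀, fun σ h1 h2 => (H σ h1 h2).symm ▸ hb⟩, fun η hη =>
    ⟨max η η₀, le_max_left _ _, max_lt hη h₀, (H _ (le_max_right _ _) (max_lt hη h₀)).le⟩⟩

theorem isLimInf_of_monotone (hmono : ∀ η σ, η ≤ σ → σ < lam → f η ≤ f σ)
    (hle : ∀ σ < lam, f σ ≤ l) (hlt : ∀ b < l, ∃ η < lam, b < f η) : IsLimInf f lam l := by
  refine ⟨fun b hb => ?_, fun η hη => ⟨η, le_rfl, hη, hle η hη⟩⟩
  obtain ⟨η, hη, h⟩ := hlt b hb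
  exact ⟨η, hη, fun σ h1 h2 => h.trans_le (hmono η σ h1 h2)⟩

/-- Needed because a simulating machine keeps the line of the simulated one in a register. -/
theorem IsLimInf.natCast {f : Ordinal.{u} → ℕ} {n : ℕ} (h : IsLimInf f lam n) :
    IsLimInf (fun σ => (f σ : Ordinal.{u})) lam (n : Ordinal.{u}) := by
  refine ⟨fun b hb => ?_, fun η hη => ?_⟩
  · obtain ⟨k, rfl⟩ := Ordinal.lt_omega0.1 (hb.trans (Ordinal.natCast_lt_omega0 n))
    obtain ⟨η, hη, H⟩ := h.1 k (by exact_mod_cast hb)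
    exact ⟨η, hη, fun σ h1 h2 => Nat.cast_lt.2 (H σ h1 h2)⟩
  · obtain ⟨σ, h1, h2, h3⟩ := h.2 η hη
    exact ⟨σ, h1, h2, Nat.cast_le.2 h3⟩

end LimInf

theorem reset_of_lt {α l : Ordinal.{u}} (h : l < α) : reset α l = l := if_pos h

theorem reset_lt {α l : Ordinal.{u}} (h : 0 < α) : reset α l < α := by
  unfold reset; split_ifs with h' <;> assumption

/-! ### Computations from arbitrary configurations -/

/-- The configuration reached after `τ` steps from the configuration `C`. -/
noncomputable def Program.run (P : Program) (α : Ordinal.{u}) (C : Config.{u})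
    (τ : Ordinal.{u}) : Config.{u} :=
  Ordinal.limitRecOn τ C (fun _ C => P.step C)
    (fun lam _ C =>
      { line := Filter.liminf (fun σ : Set.Iio lam => (C σ.1 σ.2).line) Filter.atTop
        reg := fun i =>
          reset α (Filter.liminf (fun σ : Set.Iio lam => (C σ.1 σ.2).reg i) Filter.atTop) })

section Run

variable (P : Program) (α : Ordinal.{u}) (C : Config.{u})

theorem config_eq_run (v : List Ordinal.{u}) (τ : Ordinal.{u}) :
    P.config α v τ = P.run α (initial v) τ := rfl

@[simp] theorem run_zero : P.run α C 0 = C := Ordinal.limitRecOn_zero ..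

@[simp] theorem run_add_one (τ : Ordinal.{u}) :
    P.run α C (τ + 1) = P.step (P.run α C τ) := Ordinal.limitRecOn_add_one ..

theorem run_limit {lam : Ordinal.{u}} (hlam : IsSuccLimit lam) :
    P.run α C lam =
      ⟨Filter.liminf (fun σ : Set.Iio lam => (P.run α C σ.1).line) Filter.atTop,
        fun i => reset α (Filter.liminf (fun σ : Set.Iio lam => (P.run α C σ.1).reg i)
          Filter.atTop)⟩ :=
  Ordinal.limitRecOn_limit _ _ _ _ hlam

theorem run_limit_line {lam : Ordinal.{u}} (hlam : IsSuccLimit lam) {l : ℕ}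
    (h : IsLimInf (fun σ => (P.run α C σ).line) lam l) : (P.run α C lam).line = l := by
  rw [run_limit _ _ _ hlam]; exact h.liminf_eq hlam

theorem run_limit_reg {lam : Ordinal.{u}} (hlam : IsSuccLimit lam) {i : ℕ} {l : Ordinal.{u}}
    (h : IsLimInf (fun σ => (P.run α C σ).reg i) lam l) :
    (P.run α C lam).reg i = reset α l := by
  rw [run_limit _ _ _ hlam]; exact congrArg (reset α) (h.liminf_eq hlam)

theorem exists_run_limit_reg {lam : Ordinal.{u}} (hlam : IsSuccLimit lam) (i : ℕ) :
    ∃ l, IsLimInf (fun σ => (P.run α C σ).reg i) lam l ∧ (P.run α C lam).reg i = reset α l := by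
  obtain ⟨l, hl⟩ := exists_isLimInf_ordinal (fun σ => (P.run α C σ).reg i) lam
  exact ⟨l, hl, run_limit_reg _ _ _ hlam hl⟩

theorem run_add (τ δ : Ordinal.{u}) : P.run α C (τ + δ) = P.run α (P.run α C τ) δ := by
  induction δ using Ordinal.limitRecOn with
  | zero => simp
  | add_one δ ih => rw [← add_assoc, run_add_one, ih, run_add_one]
  | limit lam hlam ih =>
    rw [run_limit _ _ _ hlam, run_limit _ _ _ (Ordinal.isSuccLimit_add τ hlam)]
    congr 1
    · rw [liminf_shift (fun σ => (P.run α C σ).line) τ hlam]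
      exact congrArg (fun f => Filter.liminf f Filter.atTop)
        (funext fun σ => congrArg Config.line (ih σ.1 σ.2))
    · funext i
      rw [liminf_shift (fun σ => (P.run α C σ).reg i) τ hlam]
      exact congrArg (fun f => reset α (Filter.liminf f Filter.atTop))
        (funext fun σ => congrArg (Config.reg · i) (ih σ.1 σ.2))

variable {P α C}

theorem Program.step_reg_lt (hα : IsSuccLimit α) (hC : ∀ i, C.reg i < α) (i : ℕ) :
    (P.step C).reg i < α := by
  unfold Program.step
  split
  · rename_i I _
    cases I with
    | zero j =>
      by_cases h : i = j
      · simpa [Instr.exec, h] using hα.bot_lt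
      · simp [Instr.exec, h, hC]
    | inc j =>
      by_cases h : i = j
      · subst h; simpa [Instr.exec] using hα.succ_lt (hC i)
      · simp [Instr.exec, h, hC]
    | copy j k => by_cases h : i = k <;> simp [Instr.exec, h, hC]
    | jump φ l => exact hC i
  · exact hC i

theorem run_lt (hα : IsSuccLimit α) (hC : ∀ i, C.reg i < α) (τ : Ordinal.{u}) (i : ℕ) :
    (P.run α C τ).reg i < α := by
  induction τ using Ordinal.limitRecOn generalizing i with
  | zero => simpa using hC i
  | add_one τ ih => rw [run_add_one]; exact Program.step_reg_lt hα ih i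
  | limit lam hlam ih => rw [run_limit _ _ _ hlam]; exact reset_lt hα.bot_lt

/-- The instruction changes the content of register `i`. -/
def Instr.Writes : Instr → ℕ → Prop
  | .zero j, i => i = j
  | .inc j, i => i = j
  | .copy _ j, i => i = j
  | .jump _ _, _ => False

theorem Instr.exec_reg_of_not_writes {I : Instr} {i : ℕ} (h : ¬ I.Writes i) :
    (I.exec C).reg i = C.reg i := by
  cases I <;> simp_all [Instr.exec, Instr.Writes]

/-- No instruction with a line number in `[lo, hi)` changes register `i`. -/
def Program.NoWrite (P : Program) (lo hi i : ℕ) : Prop :=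
  ∀ l, lo ≤ l → l < hi → ∀ I, P.code[l]? = some I → ¬ I.Writes i

theorem Program.step_reg_of_noWrite {lo hi i : ℕ} (h : P.NoWrite lo hi i)
    (h1 : lo ≤ C.line) (h2 : C.line < hi) : (P.step C).reg i = C.reg i := by
  unfold Program.step
  split
  · rename_i I hI
    exact Instr.exec_reg_of_not_writes (h _ h1 h2 I hI)
  · rfl

theorem run_reg_of_noWrite {lo hi i : ℕ} (h : P.NoWrite lo hi i) (hC : C.reg i < α)
    {δ : Ordinal.{u}}
    (hl : ∀ σ < δ, lo ≤ (P.run α C σ).line ∧ (P.run α C σ).line < hi) {τ : Ordinal.{u}}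
    (hτ : τ ≤ δ) : (P.run α C τ).reg i = C.reg i := by
  induction τ using Ordinal.limitRecOn with
  | zero => simp
  | add_one τ ih =>
    have h3 := hl τ (lt_of_lt_of_le (lt_add_one τ) hτ)
    rw [run_add_one, Program.step_reg_of_noWrite h h3.1 h3.2, ih ((lt_add_one τ).le.trans hτ)]
  | limit lam hlam ih =>
    have : IsLimInf (fun σ => (P.run α C σ).reg i) lam (C.reg i) :=
      isLimInf_of_eventually_eq hlam.bot_lt fun σ _ h2 => ih σ h2 (h2.le.trans hτ)
    rw [run_limit_reg _ _ _ hlam this, reset_of_lt hC]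

end Run

/-! ### Segments of computations -/

/-- From line `a` with register contents `r`, the program reaches line `b` with contents
satisfying `Q` in at least `d` steps; before that, the active lines lie in `[lo, hi)` and the
contents satisfy `T`. -/
def Seg (P : Program) (α : Ordinal.{u}) (lo hi a : ℕ) (r : ℕ → Ordinal.{u}) (d : Ordinal.{u})
    (T : (ℕ → Ordinal.{u}) → Prop) (b : ℕ) (Q : (ℕ → Ordinal.{u}) → Prop) : Prop :=
  ∃ δ, d ≤ δ ∧ (P.run α ⟨a, r⟩ δ).line = b ∧ Q (P.run α ⟨a, r⟩ δ).reg ∧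
    ∀ σ < δ, lo ≤ (P.run α ⟨a, r⟩ σ).line ∧ (P.run α ⟨a, r⟩ σ).line < hi ∧
      T (P.run α ⟨a, r⟩ σ).reg

section Seg

variable {P : Program} {α : Ordinal.{u}} {lo hi a b c : ℕ} {r : ℕ → Ordinal.{u}}
  {d d' : Ordinal.{u}} {T T' Q Q' : (ℕ → Ordinal.{u}) → Prop}

theorem Seg.mono (h : Seg P α lo hi a r d T b Q) {lo' hi' : ℕ} (hlo : lo' ≤ lo) (hhi : hi ≤ hi')
    (hd : d' ≤ d) (hT : ∀ s, T s → T' s) (hQ : ∀ s, Q s → Q' s) :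
    Seg P α lo' hi' a r d' T' b Q' := by
  obtain ⟨δ, h1, h2, h3, h4⟩ := h
  exact ⟨δ, hd.trans h1, h2, hQ _ h3, fun σ hσ =>
    ⟨hlo.trans (h4 σ hσ).1, (h4 σ hσ).2.1.trans_le hhi, hT _ (h4 σ hσ).2.2⟩⟩

theorem Seg.refl (hQ : Q r) : Seg P α lo hi a r 0 T a Q :=
  ⟨0, le_rfl, by simp, by simpa using hQ, fun σ hσ => (not_lt_zero hσ).elim⟩

theorem Seg.trans (h : Seg P α lo hi a r d T b Q)
    (h' : ∀ s, Q s → Seg P α lo hi b s d' T c Q') : Seg P α lo hi a r (d + d') T c Q' := by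
  obtain ⟨δ, h1, h2, h3, h4⟩ := h
  obtain ⟨δ', k1, k2, k3, k4⟩ := h' _ h3
  have key : P.run α ⟨a, r⟩ δ = ⟨b, (P.run α ⟨a, r⟩ δ).reg⟩ := by ext1 <;> simp [h2]
  rw [← key] at k2 k3 k4
  refine ⟨δ + δ', add_le_add h1 k1, ?_, ?_, fun σ hσ => ?_⟩
  · rw [run_add, k2]
  · rw [run_add]; exact k3
  · by_cases hlt : σ < δ
    · exact h4 σ hlt
    · have hle := not_lt.1 hlt
      have := k4 (σ - δ) ((Ordinal.sub_lt_of_le hle).2 hσ)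
      rwa [← run_add, Ordinal.add_sub_cancel_of_le hle] at this

theorem Seg.step {C : Config.{u}} (h : P.step ⟨a, r⟩ = C) (hlo : lo ≤ a) (hhi : a < hi) (hT : T r)
    (hb : C.line = b) (hQ : Q C.reg) : Seg P α lo hi a r 1 T b Q := by
  have h1 : P.run α ⟨a, r⟩ 1 = C := by rw [← zero_add (1 : Ordinal), run_add_one, run_zero, h]
  refine ⟨1, le_rfl, by rw [h1, hb], by rwa [h1], fun σ hσ => ?_⟩
  obtain rfl : σ = 0 := by simpa using hσ
  simpa using ⟨hlo, hhi, hT⟩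

/-- Contents of registers that are not written do not change. -/
theorem Seg.frame (h : Seg P α lo hi a r d T b Q) (hα : IsSuccLimit α) (hr : ∀ i, r i < α) :
    Seg P α lo hi a r d (fun s => T s ∧ (∀ i, s i < α) ∧ ∀ i, P.NoWrite lo hi i → s i = r i) b
      (fun s => Q s ∧ (∀ i, s i < α) ∧ ∀ i, P.NoWrite lo hi i → s i = r i) := by
  obtain ⟨δ, h1, h2, h3, h4⟩ := h
  have h5 : ∀ τ ≤ δ, ∀ i, P.NoWrite lo hi i → (P.run α ⟨a, r⟩ τ).reg i = r i :=
    fun τ hτ i hi => run_reg_of_noWrite (C := ⟨a, r⟩) hi (hr i)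
      (fun σ hσ => ⟨(h4 σ hσ).1, (h4 σ hσ).2.1⟩) hτ
  exact ⟨δ, h1, h2, ⟨h3, run_lt hα (C := ⟨a, r⟩) hr δ, h5 δ le_rfl⟩, fun σ hσ =>
    ⟨(h4 σ hσ).1, (h4 σ hσ).2.1, (h4 σ hσ).2.2, run_lt hα (C := ⟨a, r⟩) hr σ, h5 σ hσ.le⟩⟩

/-- Transfinite concatenation of segments that start and end in the least line `a`: the contents of
the registers `reg j` at the start of segment number `θ` are `g θ j`. -/
theorem Seg.concat (hα : IsSuccLimit α) {ι : Type*} (reg : ι → ℕ) (g : Ordinal.{u} → ι → Ordinal.{u})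
    (Θ : Ordinal.{u}) (e : Ordinal.{u} → Ordinal.{u}) (he : ∀ θ < Θ, 0 < e θ)
    (lim : ∀ lam ≤ Θ, IsSuccLimit lam → ∀ j, ∃ l, IsLimInf (g · j) lam l ∧ g lam j = reset α l)
    (hr : ∀ i, r i < α) (h0 : ∀ j, r (reg j) = g 0 j)
    (step : ∀ θ < Θ, ∀ s, (∀ i, s i < α) → (∀ i, P.NoWrite a hi i → s i = r i) →
      (∀ j, s (reg j) = g θ j) →
      Seg P α a hi a s (e θ) (fun s' => (∀ j, min (g θ j) (g (θ + 1) j) ≤ s' (reg j)) ∧ T s') a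
        (fun s' => ∀ j, s' (reg j) = g (θ + 1) j))
    (hd : ∀ x, (∀ θ < Θ, e θ ≤ x) → d ≤ x) :
    Seg P α a hi a r d T a (fun s => ∀ j, s (reg j) = g Θ j) := by
  let Good : Ordinal.{u} → Config.{u} → Prop := fun θ C => C.line = a ∧ (∀ i, C.reg i < α) ∧
    (∀ i, P.NoWrite a hi i → C.reg i = r i) ∧ ∀ j, C.reg (reg j) = g θ j
  -- Lengths are chosen for all configurations, with the dummy value 1 for bad ones. Thus the
  -- starting times `t θ` form a normal function before the run is known to behave well.
  have hex : ∀ (θ : Ordinal.{u}) (C : Config.{u}), ∃ δ, 0 < δ ∧ (θ < Θ → Good θ C →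
      e θ ≤ δ ∧ (P.run α C δ).line = a ∧ (∀ j, (P.run α C δ).reg (reg j) = g (θ + 1) j) ∧
      ∀ σ < δ, a ≤ (P.run α C σ).line ∧ (P.run α C σ).line < hi ∧
        (∀ j, min (g θ j) (g (θ + 1) j) ≤ (P.run α C σ).reg (reg j)) ∧ T (P.run α C σ).reg) := by
    intro θ C
    by_cases h : θ < Θ ∧ Good θ C
    · obtain ⟨h1, rfl, h3, h4, h5⟩ := h
      obtain ⟨δ, k1, k2, k3, k4⟩ := step θ h1 C.reg h3 h4 h5
      exact ⟨δ, (he θ h1).trans_le k1, fun _ _ => ⟨k1, k2, k3, k4⟩⟩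
    · exact ⟨1, one_pos, fun h1 h2 => (h ⟨h1, h2⟩).elim⟩
  choose len len_pos hlen using hex
  let C₀ : Config.{u} := ⟨a, r⟩
  let t : Ordinal.{u} → Ordinal.{u} := fun θ => Ordinal.limitRecOn θ 0
    (fun θ x => x + len θ (P.run α C₀ x)) (fun lam _ f => ⨆ η : Iio lam, f η.1 η.2)
  have t0 : t 0 = 0 := Ordinal.limitRecOn_zero ..
  have ts : ∀ θ, t (θ + 1) = t θ + len θ (P.run α C₀ (t θ)) := fun θ =>
    Ordinal.limitRecOn_add_one ..
  have tl : ∀ lam, IsSuccLimit lam → t lam = ⨆ η : Iio lam, t η.1 := fun lam h =>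
    Ordinal.limitRecOn_limit _ _ _ _ h
  have tn : IsNormal t := by
    refine IsNormal.of_succ_lt (fun θ => ?_) fun {lam} hlam => ?_
    · rw [succ_eq_add_one, ts]; exact lt_add_of_pos_right _ (len_pos _ _)
    · rw [tl lam hlam]
      have hne : (t '' Iio lam).Nonempty := ⟨_, 0, hlam.bot_lt, rfl⟩
      have := isLUB_csSup hne Ordinal.bddAbove_of_small
      rwa [sSup_image'] at this
  have main : ∀ θ ≤ Θ, ((P.run α C₀ (t θ)).line = a ∧
      ∀ j, (P.run α C₀ (t θ)).reg (reg j) = g θ j) ∧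
      ∀ σ < t θ, a ≤ (P.run α C₀ σ).line ∧ (P.run α C₀ σ).line < hi ∧ T (P.run α C₀ σ).reg ∧
        ∃ η < θ, t η ≤ σ ∧ σ < t (η + 1) ∧
          ∀ j, min (g η j) (g (η + 1) j) ≤ (P.run α C₀ σ).reg (reg j) := by
    intro θ
    induction θ using Ordinal.limitRecOn with
    | zero => intro _; rw [t0]; simpa [C₀] using h0
    | add_one θ ih =>
      intro hθ
      have hlt : θ < Θ := (lt_add_one θ).trans_le hθ
      obtain ⟨⟨h1, h2⟩, h3⟩ := ih hlt.le
      have hgood : Good θ (P.run α C₀ (t θ)) := ⟨h1, run_lt hα (C := C₀) hr _, fun i hi =>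
        run_reg_of_noWrite (C := C₀) hi (hr i) (fun σ hσ => ⟨(h3 σ hσ).1, (h3 σ hσ).2.1⟩) le_rfl,
        h2⟩
      obtain ⟨k1, k2, k3, k4⟩ := hlen θ _ hlt hgood
      rw [ts, run_add]
      refine ⟨⟨k2, k3⟩, fun σ hσ => ?_⟩
      by_cases hσt : σ < t θ
      · obtain ⟨m1, m2, m3, η, m4, m5⟩ := h3 σ hσt
        exact ⟨m1, m2, m3, η, m4.trans (lt_add_one θ), m5⟩
      · have hle := not_lt.1 hσt
        have := k4 (σ - t θ) ((Ordinal.sub_lt_of_le hle).2 hσ)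
        rw [← run_add, Ordinal.add_sub_cancel_of_le hle] at this
        exact ⟨this.1, this.2.1, this.2.2.2, θ, lt_add_one θ, hle, by rwa [ts], this.2.2.1⟩
    | limit lam hlam ih =>
      intro hle
      have htl : IsSuccLimit (t lam) := tn.map_isSuccLimit hlam
      have hσ : ∀ σ < t lam, ∃ η < lam, σ < t η := fun σ hσ => (tn.lt_iff_exists_lt hlam).1 hσ
      have hpast : ∀ σ < t lam, a ≤ (P.run α C₀ σ).line ∧ (P.run α C₀ σ).line < hi ∧
          T (P.run α C₀ σ).reg ∧ ∃ η < lam, t η ≤ σ ∧ σ < t (η + 1) ∧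
          ∀ j, min (g η j) (g (η + 1) j) ≤ (P.run α C₀ σ).reg (reg j) := by
        intro σ h
        obtain ⟨η, h1, h2⟩ := hσ σ h
        obtain ⟨m1, m2, m3, ζ, m4, m5⟩ := (ih η h1 (h1.le.trans hle)).2 σ h2
        exact ⟨m1, m2, m3, ζ, m4.trans h1, m5⟩
      refine ⟨⟨?_, fun j => ?_⟩, hpast⟩
      -- The line `a` is the least one ever active, and it is active at the cofinally many times `t
      -- η`.
      · refine run_limit_line P α C₀ htl ⟨fun b hb => ⟨0, htl.bot_lt, fun σ _ h =>
          hb.trans_le (hpast σ h).1⟩, fun ρ hρ => ?_⟩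
        obtain ⟨η, h1, h2⟩ := hσ ρ hρ
        exact ⟨t η, h2.le, tn.strictMono h1, ((ih η h1 (h1.le.trans hle)).1.1).le⟩
      · obtain ⟨l, hl, hgl⟩ := lim lam hle hlam j
        rw [hgl]
        refine run_limit_reg P α C₀ htl ⟨fun b hb => ?_, fun ρ hρ => ?_⟩
        -- A time after `t η` lies in a segment `ζ ≥ η`; there the register is at least the smaller
        -- of its two end values, and both exceed `b`.
        · obtain ⟨η, h1, h2⟩ := hl.1 b hb
          refine ⟨t η, tn.strictMono h1, fun σ h3 h4 => ?_⟩
          obtain ⟨-, -, -, ζ, m1, m2, m3, m4⟩ := hpast σ h4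
          have hηζ : η ≤ ζ := by
            have := tn.strictMono.lt_iff_lt.1 (h3.trans_lt m3)
            exact Order.lt_add_one_iff.1 this
          refine (lt_min (h2 ζ hηζ m1) (h2 (ζ + 1) (hηζ.trans (lt_add_one ζ).le) ?_)).trans_le
            (m4 j)
          exact hlam.succ_lt m1
        · obtain ⟨η, h1, h2⟩ := hσ ρ hρ
          obtain ⟨ζ, h3, h4, h5⟩ := hl.2 η h1
          refine ⟨t ζ, h2.le.trans (tn.monotone h3), tn.strictMono h4, ?_⟩
          simpa only [(ih ζ h4 (h4.le.trans hle)).1.2 j] using h5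
  obtain ⟨⟨h1, h2⟩, h3⟩ := main Θ le_rfl
  refine ⟨t Θ, hd _ fun θ hθ => ?_, h1, h2, fun σ hσ => ?_⟩
  · obtain ⟨⟨k1, k2⟩, k3⟩ := main θ hθ.le
    have hgood : Good θ (P.run α C₀ (t θ)) := ⟨k1, run_lt hα (C := C₀) hr _, fun i hi =>
        run_reg_of_noWrite (C := C₀) hi (hr i) (fun σ hσ => ⟨(k3 σ hσ).1, (k3 σ hσ).2.1⟩) le_rfl,
        k2⟩
    refine (hlen θ _ hθ hgood).1.trans ((le_add_self (b := t θ)).trans ?_)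
    rw [← ts]
    exact tn.monotone (succ_le_of_lt hθ)
  · exact ⟨(h3 σ hσ).1, (h3 σ hσ).2.1, (h3 σ hσ).2.2.1⟩

end Seg

/-! ### Structured programs -/

/-- Structured register machine programs. -/
inductive Cmd : Type
  | skip
  | zero (i : ℕ)
  | inc (i : ℕ)
  | copy (i j : ℕ)
  | seq (c d : Cmd)
  | ite (φ : Cond) (c d : Cmd)
  | loop (φ : Cond) (c : Cmd)

namespace Cmd

/-- The number of instructions of the compiled program. -/
def size : Cmd → ℕ
  | skip => 0
  | zero _ => 1
  | inc _ => 1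
  | copy _ _ => 1
  | seq c d => c.size + d.size
  | ite _ c d => 1 + (d.size + (1 + c.size))
  | loop _ c => 1 + (c.size + 1)

/-- The instructions of a structured program placed at line `ℓ`. -/
def compile : Cmd → ℕ → List Instr
  | skip, _ => []
  | zero i, _ => [.zero i]
  | inc i, _ => [.inc i]
  | copy i j, _ => [.copy i j]
  | seq c d, ℓ => c.compile ℓ ++ d.compile (ℓ + c.size)
  | ite φ c d, ℓ =>
    .jump φ (ℓ + 1 + d.size + 1) :: (d.compile (ℓ + 1) ++
      .jump (.eq 0 0) (ℓ + (1 + (d.size + (1 + c.size)))) :: c.compile (ℓ + 1 + d.size + 1))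
  | loop φ c, ℓ =>
    .jump (.not φ) (ℓ + (1 + (c.size + 1))) :: (c.compile (ℓ + 1) ++ [.jump (.eq 0 0) ℓ])

theorem length_compile (c : Cmd) (ℓ : ℕ) : (c.compile ℓ).length = c.size := by
  induction c generalizing ℓ <;> simp_all [compile, size] <;> omega

/-- The registers that a structured program may change. -/
def Writes : Cmd → ℕ → Prop
  | skip, _ => False
  | zero i, k => k = i
  | inc i, k => k = i
  | copy _ j, k => k = j
  | seq c d, k => c.Writes k ∨ d.Writes k
  | ite _ c d, k => c.Writes k ∨ d.Writes k
  | loop _ c, k => c.Writes k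

theorem writes_of_mem_compile {c : Cmd} {ℓ : ℕ} {I : Instr} {k : ℕ} (hI : I ∈ c.compile ℓ)
    (hk : I.Writes k) : c.Writes k := by
  induction c generalizing ℓ with
  | skip => simp [compile] at hI
  | zero i => simp only [compile, List.mem_singleton] at hI; subst hI; exact hk
  | inc i => simp only [compile, List.mem_singleton] at hI; subst hI; exact hk
  | copy i j => simp only [compile, List.mem_singleton] at hI; subst hI; exact hk
  | seq c d hc hd =>
    simp only [compile, List.mem_append] at hI
    exact hI.imp hc hd
  | ite φ c d hc hd =>
    simp only [compile, List.mem_append, List.mem_cons] at hI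
    rcases hI with rfl | h | rfl | h
    · exact hk.elim
    · exact .inr (hd h)
    · exact hk.elim
    · exact .inl (hc h)
  | loop φ c hc =>
    simp only [compile, List.mem_append, List.mem_cons, List.not_mem_nil, or_false] at hI
    rcases hI with rfl | h | rfl
    · exact hk.elim
    · exact hc h
    · exact hk.elim

end Cmd

/-- The instructions `L` occur in `P` from line `ℓ` on. -/
def Located (P : Program) (ℓ : ℕ) (L : List Instr) : Prop :=
  ∀ k I, L[k]? = some I → P.code[ℓ + k]? = some I

theorem Located.append {P : Program} {ℓ : ℕ} {L M : List Instr} (h : Located P ℓ (L ++ M)) :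
    Located P ℓ L ∧ Located P (ℓ + L.length) M := by
  refine ⟨fun k I hI => h k I ?_, fun k I hI => ?_⟩
  · rw [List.getElem?_append_left (List.getElem?_eq_some_iff.1 hI).1, hI]
  · rw [add_assoc]
    refine h _ I ?_
    rw [List.getElem?_append_right (by omega), Nat.add_sub_cancel_left, hI]

theorem Located.cons {P : Program} {ℓ : ℕ} {I : Instr} {M : List Instr}
    (h : Located P ℓ (I :: M)) : P.code[ℓ]? = some I ∧ Located P (ℓ + 1) M :=
  ⟨h 0 I rfl, (Located.append (L := [I]) h).2⟩

theorem Located.noWrite {P : Program} {ℓ : ℕ} {c : Cmd} (h : Located P ℓ (c.compile ℓ)) {i : ℕ}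
    (hi : ¬ c.Writes i) : P.NoWrite ℓ (ℓ + c.size) i := by
  intro l h1 h2 I hI hw
  obtain ⟨k, rfl⟩ := Nat.exists_eq_add_of_le h1
  have hk : k < (c.compile ℓ).length := by rw [c.length_compile]; omega
  have := h k _ (List.getElem?_eq_getElem hk)
  rw [this] at hI
  obtain rfl := Option.some.inj hI
  exact hi (Cmd.writes_of_mem_compile (List.getElem_mem hk) hw)

/-- Started with contents `r`, the structured program terminates after at least `d` steps with
contents satisfying `Q`, and the contents satisfy `T` before. -/
def Exec (α : Ordinal.{u}) (c : Cmd) (d : Ordinal.{u}) (r : ℕ → Ordinal.{u})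
    (T Q : (ℕ → Ordinal.{u}) → Prop) : Prop :=
  ∀ P ℓ, Located P ℓ (c.compile ℓ) → Seg P α ℓ (ℓ + c.size) ℓ r d T (ℓ + c.size) Q

section Exec

variable {α : Ordinal.{u}} {c c' : Cmd} {φ : Cond} {d d' : Ordinal.{u}} {r : ℕ → Ordinal.{u}}
  {T T' Q Q' : (ℕ → Ordinal.{u}) → Prop}

theorem Exec.mono (h : Exec α c d r T Q) (hd : d' ≤ d) (hT : ∀ s, T s → T' s)
    (hQ : ∀ s, Q s → Q' s) : Exec α c d' r T' Q' :=
  fun P ℓ hP => (h P ℓ hP).mono le_rfl le_rfl hd hT hQ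

theorem Exec.imp (h : Exec α c d r T Q) (hQ : ∀ s, Q s → Q' s) : Exec α c d r T Q' :=
  h.mono le_rfl (fun _ => id) hQ

theorem Exec.frame (h : Exec α c d r T Q) (hα : IsSuccLimit α) (hr : ∀ i, r i < α) :
    Exec α c d r (fun s => T s ∧ (∀ i, s i < α) ∧ ∀ i, ¬ c.Writes i → s i = r i)
      (fun s => Q s ∧ (∀ i, s i < α) ∧ ∀ i, ¬ c.Writes i → s i = r i) :=
  fun P ℓ hP => ((h P ℓ hP).frame hα hr).mono le_rfl le_rfl le_rfl
    (fun _ hs => ⟨hs.1, hs.2.1, fun _ hi => hs.2.2 _ (hP.noWrite hi)⟩)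
    (fun _ hs => ⟨hs.1, hs.2.1, fun _ hi => hs.2.2 _ (hP.noWrite hi)⟩)

theorem exec_skip (hQ : Q r) : Exec α .skip 0 r T Q := fun _ _ _ => Seg.refl hQ

/-- Running times matter only for the depth-first search, so the basic instructions claim just the
trivial lower bound 0. -/
theorem exec_zero {i : ℕ} (hT : T r) (hQ : Q (Function.update r i 0)) :
    Exec α (.zero i) 0 r T Q := fun P ℓ hP =>
  (Seg.step (C := ⟨ℓ + 1, Function.update r i 0⟩)
    (by simp [Program.step, (Located.cons hP).1, Instr.exec]) le_rfl
    (by simp [Cmd.size]) hT rfl hQ).mono le_rfl le_rfl zero_le_one (fun _ => id) fun _ => id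

theorem exec_inc {i : ℕ} (hT : T r) (hQ : Q (Function.update r i (r i + 1))) :
    Exec α (.inc i) 0 r T Q := fun P ℓ hP =>
  (Seg.step (C := ⟨ℓ + 1, Function.update r i (r i + 1)⟩)
    (by simp [Program.step, (Located.cons hP).1, Instr.exec, succ_eq_add_one]) le_rfl
    (by simp [Cmd.size]) hT rfl hQ).mono le_rfl le_rfl zero_le_one (fun _ => id) fun _ => id

theorem exec_copy {i j : ℕ} (hT : T r) (hQ : Q (Function.update r j (r i))) :
    Exec α (.copy i j) 0 r T Q := fun P ℓ hP =>
  (Seg.step (C := ⟨ℓ + 1, Function.update r j (r i)⟩)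
    (by simp [Program.step, (Located.cons hP).1, Instr.exec]) le_rfl
    (by simp [Cmd.size]) hT rfl hQ).mono le_rfl le_rfl zero_le_one (fun _ => id) fun _ => id

theorem exec_seq (hα : IsSuccLimit α) (hr : ∀ i, r i < α) (h : Exec α c 0 r T Q)
    (h' : ∀ s, Q s → (∀ i, s i < α) → (∀ i, ¬ c.Writes i → s i = r i) → Exec α c' d s T Q') :
    Exec α (.seq c c') d r T Q' := fun P ℓ hP => by
  obtain ⟨h1, h2⟩ := Located.append hP
  rw [Cmd.length_compile] at h2
  have key := Seg.trans (hi := ℓ + (Cmd.seq c c').size) (lo := ℓ) (d := 0)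
    ((h.frame hα hr P ℓ h1).mono le_rfl (by simp [Cmd.size]) le_rfl (fun s hs => hs.1)
      fun _ => id) fun s hs => (h' s hs.1 hs.2.1 hs.2.2 P _ h2).mono (by omega)
        (by simp only [Cmd.size]; omega) le_rfl (fun _ => id) fun _ => id
  simpa only [zero_add, Cmd.size, add_assoc] using key

/-- Sequencing after a program about which only its result and its frame is known. -/
theorem exec_seq_frame (hα : IsSuccLimit α) (hr : ∀ i, r i < α)
    (h : Exec α c 0 r (fun _ => True) Q) (hT : ∀ s, (∀ i, ¬ c.Writes i → s i = r i) → T s)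
    (h' : ∀ s, Q s → (∀ i, s i < α) → (∀ i, ¬ c.Writes i → s i = r i) → Exec α c' d s T Q') :
    Exec α (.seq c c') d r T Q' :=
  exec_seq hα hr ((h.frame hα hr).mono le_rfl (fun s hs => hT s hs.2.2) fun _ hs => hs.1) h'

theorem step_jump {P : Program} {ℓ l : ℕ} (h : P.code[ℓ]? = some (.jump φ l))
    (hφ : φ.Holds r) : P.step ⟨ℓ, r⟩ = ⟨l, r⟩ := by
  simp [Program.step, h, Instr.exec, hφ]

theorem step_jump_neg {P : Program} {ℓ l : ℕ} (h : P.code[ℓ]? = some (.jump φ l))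
    (hφ : ¬ φ.Holds r) : P.step ⟨ℓ, r⟩ = ⟨ℓ + 1, r⟩ := by
  simp [Program.step, h, Instr.exec, hφ]

/-- The compiled second branch ends with a jump over the first one. This jump is carried out with
the final contents, hence `hQT`. -/
theorem exec_ite (hT : T r) (h : φ.Holds r → Exec α c d r T Q)
    (h' : ¬ φ.Holds r → Exec α c' d r T Q) (hQT : ∀ s, Q s → T s) :
    Exec α (.ite φ c c') d r T Q := fun P ℓ hP => by
  obtain ⟨h1, h2⟩ := Located.cons hP
  obtain ⟨h2, h3⟩ := Located.append h2
  obtain ⟨h3, h4⟩ := Located.cons h3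
  rw [Cmd.length_compile] at h3 h4
  by_cases hφ : φ.Holds r
  · refine ((Seg.step (step_jump h1 hφ) le_rfl (hi := ℓ + (Cmd.ite φ c c').size) ?_ hT rfl
      (Q := fun s => s = r) rfl).trans (d' := d) (Q' := Q) (c := ℓ + (Cmd.ite φ c c').size) ?_).mono
      le_rfl le_rfl le_add_self (fun _ => id) (fun _ => id)
    · simp only [Cmd.size]; omega
    · rintro s rfl
      have := h hφ P _ h4
      have e : ℓ + 1 + c'.size + 1 + c.size = ℓ + (Cmd.ite φ c c').size := by
        simp only [Cmd.size]; omega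
      rw [e] at this
      exact this.mono (by omega) le_rfl le_rfl (fun _ => id) (fun _ => id)
  · refine ((Seg.step (step_jump_neg h1 hφ) le_rfl (hi := ℓ + (Cmd.ite φ c c').size) ?_ hT rfl
      (Q := fun s => s = r) rfl).trans (d' := d + 1) (Q' := Q)
      (c := ℓ + (Cmd.ite φ c c').size) ?_).mono
      le_rfl le_rfl ?_ (fun _ => id) (fun _ => id)
    · simp only [Cmd.size]; omega
    · rintro s rfl
      refine ((h' hφ P _ h2).mono (by omega) ?_ le_rfl (fun _ => id) (fun _ => id)).trans ?_
      · simp only [Cmd.size]; omega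
      · intro s' hs'
        refine Seg.step (step_jump h3 (by simp [Cond.Holds])) (by omega) ?_ (hQT _ hs') rfl hs'
        simp only [Cmd.size]; omega
    · exact le_self_add.trans le_add_self

/-- One iteration of a loop, as a segment from the loop head to itself. -/
theorem seg_loop_step {P : Program} {ℓ : ℕ} (hP : Located P ℓ ((Cmd.loop φ c).compile ℓ))
    (hT : T r) (hφ : φ.Holds r) (h : Exec α c d r T Q) (hQT : ∀ s, Q s → T s) :
    Seg P α ℓ (ℓ + (Cmd.loop φ c).size) ℓ r (1 + d + 1) T ℓ Q := by
  obtain ⟨h1, h2⟩ := Located.cons hP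
  obtain ⟨h2, h3⟩ := Located.append h2
  obtain ⟨h3, -⟩ := Located.cons h3
  rw [Cmd.length_compile] at h3
  refine ((Seg.step (step_jump_neg h1 (by simpa [Cond.Holds] using hφ)) le_rfl ?_ hT rfl
    (Q := fun s => s = r) rfl).trans (d' := d) (Q' := Q) (c := ℓ + 1 + c.size) ?_).trans ?_
  · simp only [Cmd.size]; omega
  · rintro s rfl
    exact (h P _ h2).mono (by omega) (by simp only [Cmd.size]; omega) le_rfl (fun _ => id)
      (fun _ => id)
  · intro s' hs'
    refine Seg.step (step_jump h3 (by simp [Cond.Holds])) (by omega) ?_ (hQT _ hs') rfl hs'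
    simp only [Cmd.size]; omega

theorem seg_loop_exit {P : Program} {ℓ : ℕ} (hP : Located P ℓ ((Cmd.loop φ c).compile ℓ))
    (hT : T r) (hφ : ¬ φ.Holds r) (hQ : Q r) :
    Seg P α ℓ (ℓ + (Cmd.loop φ c).size) ℓ r 1 T (ℓ + (Cmd.loop φ c).size) Q := by
  refine Seg.step (step_jump (Located.cons hP).1 (by simpa [Cond.Holds] using hφ)) le_rfl ?_ hT
    rfl hQ
  simp only [Cmd.size]; omega

/-- The head is the least line of the loop, so at limits of iterations control returns to it, and
`Seg.concat` determines the contents there from the values `g` at earlier heads. -/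
theorem exec_loop (hα : IsSuccLimit α) (hr : ∀ i, r i < α) {ι : Type*} (reg : ι → ℕ)
    (g : Ordinal.{u} → ι → Ordinal.{u}) (Θ : Ordinal.{u})
    (lim : ∀ lam ≤ Θ, IsSuccLimit lam → ∀ j, ∃ l, IsLimInf (g · j) lam l ∧ g lam j = reset α l)
    (h0 : ∀ j, r (reg j) = g 0 j)
    (step : ∀ θ < Θ, ∀ s, (∀ i, s i < α) → (∀ i, ¬ c.Writes i → s i = r i) →
      (∀ j, s (reg j) = g θ j) → φ.Holds s ∧
      Exec α c 0 s (fun s' => ∀ j, min (g θ j) (g (θ + 1) j) ≤ s' (reg j))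
        (fun s' => ∀ j, s' (reg j) = g (θ + 1) j))
    (exit : ∀ s, (∀ i, ¬ c.Writes i → s i = r i) → (∀ j, s (reg j) = g Θ j) → ¬ φ.Holds s) :
    Exec α (.loop φ c) 0 r (fun _ => True) (fun s => ∀ j, s (reg j) = g Θ j) := fun P ℓ hP => by
  have key := Seg.concat (P := P) (a := ℓ) (hi := ℓ + (Cmd.loop φ c).size) (d := 0) hα reg g Θ
    (fun _ => 1) (fun _ _ => one_pos) lim hr h0 (T := fun _ => True) (fun θ hθ s h1 h2 h3 => ?_)
    (fun _ _ => by simp)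
  · refine ((key.frame hα hr).mono le_rfl le_rfl le_rfl (fun _ _ => trivial)
      (fun _ => id)).trans (d' := 1) ?_ |>.mono le_rfl le_rfl (by simp) (fun _ => id) (fun _ => id)
    rintro s ⟨h1, -, h2⟩
    exact seg_loop_exit hP trivial (exit s (fun i hi => h2 i (hP.noWrite hi)) h1) h1
  · obtain ⟨k1, k2⟩ := step θ hθ s h1 (fun i hi => h2 i (hP.noWrite hi)) h3
    refine (seg_loop_step hP ?_ k1 k2 ?_).mono le_rfl le_rfl (by simp) (fun s h => ⟨h, trivial⟩)
      (fun _ => id)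
    · intro j; rw [h3]; exact min_le_left _ _
    · intro s hs j; rw [hs]; exact min_le_right _ _

/-- The program compiled from a nonempty structured program. -/
def Cmd.toProgram (c : Cmd) (hc : 0 < c.size) : Program :=
  ⟨c.compile 0, by rw [← List.length_pos_iff, c.length_compile]; exact hc⟩

theorem initial_reg_lt (hα : 0 < α) {v : List Ordinal.{u}} (hv : ∀ x ∈ v, x < α) (i : ℕ) :
    (initial v).reg i < α := by
  simp only [initial, List.getD_eq_getElem?_getD]
  cases h : v[i]? with
  | none => simpa using hα
  | some x => exact hv x (List.mem_of_getElem? h)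

/-- The end of the program is not reached at a limit time, as an inferior limit of lines of the
program is again one of them. So it is reached at a successor `τ + 1`, and `τ` is the halting time.
-/
theorem Exec.haltsIn {v : List Ordinal.{u}} (hc : 0 < c.size)
    (h : Exec α c d (initial v).reg T Q) :
    ∃ τ, (c.toProgram hc).HaltsIn α v τ ∧ d ≤ τ + 1 ∧
      Q ((c.toProgram hc).config α v (τ + 1)).reg := by
  set P := c.toProgram hc
  have hlen : P.code.length = c.size := c.length_compile 0
  obtain ⟨δ, h1, h2, h3, h4⟩ := h P 0 (fun k I hI => by simpa [P, Cmd.toProgram] using hI)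
  change (P.config α v δ).line = _ at h2
  change Q (P.config α v δ).reg at h3
  change ∀ σ < δ, _ ≤ (P.config α v σ).line ∧ (P.config α v σ).line < _ ∧ _ at h4
  rcases Ordinal.zero_or_succ_or_isSuccLimit δ with rfl | ⟨τ, rfl⟩ | hlim
  · simp only [config_eq_run, run_zero, initial] at h2; omega
  · rw [succ_eq_add_one] at h1 h2 h3 h4
    refine ⟨τ, ⟨?_, fun σ hσ hh => ?_⟩, h1, h3⟩
    · change P.code.length ≤ (P.config α v (τ + 1)).line
      rw [h2]; omega
    · have := (h4 σ (Order.lt_add_one_iff.2 hσ)).2.1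
      unfold Program.Halted at hh
      omega
  · obtain ⟨l, hl, hl'⟩ := exists_isLimInf (f := fun σ => (P.config α v σ).line) (lam := δ)
      (b := c.size - 1) fun η hη => ⟨η, le_rfl, hη, by have := (h4 η hη).2.1; omega⟩
    have := run_limit_line P α (initial v) hlim hl'
    rw [← config_eq_run] at this
    omega

end Exec

/-! ### The pairing function -/

section Pair

variable {p q : Ordinal.{u} × Ordinal.{u}} {o : Ordinal.{u}}

theorem pairLT_iff : PairLT q p ↔
    toLex (max q.1 q.2, toLex (q.1, q.2)) < toLex (max p.1 p.2, toLex (p.1, p.2)) := by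
  simp [PairLT, Prod.Lex.toLex_lt_toLex]

theorem PairLT.trans {x : Ordinal.{u} × Ordinal.{u}} (h : PairLT q p) (h' : PairLT p x) :
    PairLT q x := by
  rw [pairLT_iff] at *; exact h.trans h'

theorem pairLT_trichotomy (q p : Ordinal.{u} × Ordinal.{u}) :
    PairLT q p ∨ q = p ∨ PairLT p q := by
  rw [pairLT_iff, pairLT_iff]
  rcases lt_trichotomy (toLex (max q.1 q.2, toLex (q.1, q.2)))
    (toLex (max p.1 p.2, toLex (p.1, p.2))) with h | h | h
  · exact .inl h
  · right; left
    simp only [EmbeddingLike.apply_eq_iff_eq, Prod.mk.injEq] at h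
    exact Prod.ext h.2.1 h.2.2
  · exact .inr (.inr h)

theorem wellFounded_pairLT : WellFounded (PairLT.{u}) := by
  have h : WellFounded (fun x y : Ordinal.{u} ×ₗ (Ordinal.{u} ×ₗ Ordinal.{u}) => x < y) :=
    wellFounded_lt
  refine Subrelation.wf (fun {x y} hxy => ?_)
    (InvImage.wf (fun p : Ordinal.{u} × Ordinal.{u} => toLex (max p.1 p.2, toLex (p.1, p.2))) h)
  exact pairLT_iff.1 hxy

theorem PairLT.max_le (h : PairLT q p) : max q.1 q.2 ≤ max p.1 p.2 := by
  rcases h with h | h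
  exacts [h.le, h.1.le]

/-- All smaller pairs lie in a square with side `max p.1 p.2 + 1`, which is small. So the infimum
defining `pair` is attained. -/
theorem exists_pair_bound (p : Ordinal.{u} × Ordinal.{u}) :
    {o | ∀ y, PairLT y p → pair y < o}.Nonempty := by
  have : Small.{u} (pair '' (Iic (max p.1 p.2) ×ˢ Iic (max p.1 p.2))) := inferInstance
  obtain ⟨b, hb⟩ := Ordinal.bddAbove_of_small
    (s := pair '' (Iic (max p.1 p.2) ×ˢ Iic (max p.1 p.2)))
  refine ⟨b + 1, fun y hy => Order.lt_add_one_iff.2 (hb ⟨y, ?_, rfl⟩)⟩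
  exact ⟨(le_max_left _ _).trans hy.max_le, (le_max_right _ _).trans hy.max_le⟩

theorem pair_strictMono (h : PairLT q p) : pair q < pair p := by
  have := csInf_mem (exists_pair_bound p)
  rw [← pair] at this
  exact this q h

theorem pair_le (h : ∀ q, PairLT q p → pair q < o) : pair p ≤ o := by
  rw [pair]; exact csInf_le' h

theorem pair_lt_iff : pair q < pair p ↔ PairLT q p := by
  refine ⟨fun h => ?_, pair_strictMono⟩
  rcases pairLT_trichotomy q p with h' | rfl | h'
  · exact h'
  · exact (lt_irrefl _ h).elim
  · exact (h.asymm (pair_strictMono h')).elim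

theorem pair_injective : Function.Injective (pair.{u}) := by
  intro q p h
  rcases pairLT_trichotomy q p with h' | h' | h'
  · exact ((pair_strictMono h').ne h).elim
  · exact h'
  · exact ((pair_strictMono h').ne h.symm).elim

/-- A value skipped by `pair` would contradict the minimality in its definition, so the range is an
initial segment. -/
theorem exists_pair_eq_of_lt (h : o < pair p) : ∃ q, pair q = o := by
  induction p using wellFounded_pairLT.induction with
  | _ p ih =>
    by_contra hne
    refine h.not_ge (pair_le fun q hq => ?_)
    by_contra hle
    rcases (not_lt.1 hle).lt_or_eq with h' | h'
    · exact hne (ih q hq h')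
    · exact hne ⟨q, h'.symm⟩

/-- Along the pairs `(0, b)` the code is strictly increasing in `b`, hence at least `b`; and `(0,
max a b)` is the first pair with maximum `max a b`. -/
theorem snd_le_pair (a b : Ordinal.{u}) : max a b ≤ pair (a, b) := by
  have : ∀ b : Ordinal.{u}, b ≤ pair (0, b) := by
    intro b
    induction b using WellFoundedLT.induction with
    | _ b ih =>
      refine le_of_forall_lt fun c hc => (ih c hc).trans_lt (pair_strictMono ?_)
      simpa [PairLT] using Or.inl hc
  refine (this _).trans ?_
  rcases pairLT_trichotomy (0, max a b) (a, b) with h | h | h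
  · exact (pair_strictMono h).le
  · rw [h]
  · exfalso
    simp [PairLT] at h
    aesop

theorem fst_le (a b : Ordinal.{u}) : a ≤ pair (a, b) := (le_max_left _ _).trans (snd_le_pair a b)
theorem snd_le (a b : Ordinal.{u}) : b ≤ pair (a, b) := (le_max_right _ _).trans (snd_le_pair a b)

theorem pair_surjective : Function.Surjective (pair.{u}) := fun o =>
  exists_pair_eq_of_lt (p := (o + 1, 0)) ((lt_add_one o).trans_le (fst_le _ _))

/-- The inverse of the pairing function. -/
noncomputable def unpair : Ordinal.{u} → Ordinal.{u} × Ordinal.{u} :=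
  Function.surjInv pair_surjective

@[simp] theorem pair_unpair (o : Ordinal.{u}) : pair (unpair o) = o :=
  Function.surjInv_eq pair_surjective o

@[simp] theorem unpair_pair (p : Ordinal.{u} × Ordinal.{u}) : unpair (pair p) = p :=
  pair_injective (pair_unpair _)

theorem unpair_fst_le (o : Ordinal.{u}) : (unpair o).1 ≤ o := by
  conv_rhs => rw [← pair_unpair o]
  exact fst_le _ _

theorem unpair_snd_le (o : Ordinal.{u}) : (unpair o).2 ≤ o := by
  conv_rhs => rw [← pair_unpair o]
  exact snd_le _ _

@[simp] theorem unpair_zero : unpair (0 : Ordinal.{u}) = (0, 0) :=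
  Prod.ext (le_bot_iff.1 (unpair_fst_le 0)) (le_bot_iff.1 (unpair_snd_le 0))

theorem pairLT_unpair {o' : Ordinal.{u}} : PairLT (unpair o') (unpair o) ↔ o' < o := by
  rw [← pair_lt_iff, pair_unpair, pair_unpair]

theorem unpair_eq_iff {x : Ordinal.{u} × Ordinal.{u}} : unpair o = x ↔ o = pair x :=
  ⟨fun h => by rw [← h, pair_unpair], fun h => by rw [h, unpair_pair]⟩

open Classical in
/-- The successor of a pair in the canonical well-ordering. -/
noncomputable def nextPair (p : Ordinal.{u} × Ordinal.{u}) : Ordinal.{u} × Ordinal.{u} :=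
  if p.1 < p.2 then (if p.1 + 1 < p.2 then (p.1 + 1, p.2) else (p.2, 0))
  else if p.2 < p.1 then (p.1, p.2 + 1) else (0, p.1 + 1)

theorem pairLT_nextPair (p : Ordinal.{u} × Ordinal.{u}) : PairLT p (nextPair p) := by
  obtain ⟨x, y⟩ := p
  unfold nextPair PairLT
  dsimp only
  split_ifs with h1 h2 h3
  · right; simp [h1.le, h2.le]
  · right; simp [h1.le, h1]
  · right
    simp [h3.le, Order.add_one_le_iff, h3]
  · left
    obtain rfl : x = y := le_antisymm (not_lt.1 h3) (not_lt.1 h1)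
    simp

theorem pairLT_nextPair_iff : PairLT q (nextPair p) ↔ PairLT q p ∨ q = p := by
  refine ⟨fun h => ?_, ?_⟩
  · obtain ⟨x, y⟩ := p
    obtain ⟨a, b⟩ := q
    unfold nextPair PairLT at h
    simp only [PairLT, Prod.mk.injEq]
    dsimp only at h
    have e1 : 0 ≤ y := zero_le
    have e2 : ¬ b < 0 := not_lt_zero
    have e3 : ¬ a < 0 := not_lt_zero
    have e4 : ∀ u v : Ordinal.{u}, u < v + 1 ↔ u ≤ v := fun _ _ => Order.lt_add_one_iff
    have e5 : y < x → y + 1 ≤ x := Order.add_one_le_of_lt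
    have e6 := e4 b y
    have e7 := e4 a x
    have e8 := e4 b x
    have e9 : x < y → x + 1 ≤ y := Order.add_one_le_of_lt
    have e10 := e4 a x
    have e11 : 0 ≤ x + 1 := zero_le
    clear e4
    split_ifs at h with h1 h2 h3 <;> dsimp only at h <;> grind
  · rintro (h | rfl)
    · exact h.trans (pairLT_nextPair p)
    · exact pairLT_nextPair q

theorem pair_nextPair (p : Ordinal.{u} × Ordinal.{u}) : pair (nextPair p) = pair p + 1 := by
  refine le_antisymm (pair_le fun q hq => Order.lt_add_one_iff.2 ?_)
    (Order.add_one_le_iff.2 (pair_strictMono (pairLT_nextPair p)))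
  rcases pairLT_nextPair_iff.1 hq with h | rfl
  · exact (pair_strictMono h).le
  · rfl

theorem unpair_add_one (o : Ordinal.{u}) : unpair (o + 1) = nextPair (unpair o) := by
  rw [unpair_eq_iff, pair_nextPair, pair_unpair]

end Pair

/-! ### Computing pairs -/

section PairCmd

/-- One step in the enumeration of pairs. The current pair is given by the registers `3`, `4`, `5`
as `(r 3, r 5)` if `r 3 ≠ r 5` and as `(r 5, r 4)` otherwise; register `6` counts the pairs. -/
def enumBody : Cmd :=
  .seq (.ite (.not (.eq 3 5)) (.inc 3)
    (.ite (.not (.eq 4 5)) (.inc 4) (.seq (.inc 5) (.seq (.zero 3) (.zero 4))))) (.inc 6)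

/-- Enumerate pairs until the condition `φ` holds. -/
def enumCmd (φ : Cond) : Cmd :=
  .seq (.zero 3) (.seq (.zero 4) (.seq (.zero 5) (.seq (.zero 6) (.loop (.not φ) enumBody))))

open Classical in
/-- The registers of the enumeration at stage `θ`. -/
noncomputable def enumState (θ : Ordinal.{u}) : Fin 4 → Ordinal.{u} :=
  ![(unpair θ).1, if (unpair θ).1 < (unpair θ).2 then 0 else (unpair θ).2,
    max (unpair θ).1 (unpair θ).2, θ]

theorem isLimInf_of_unpair {f : Ordinal.{u} → Ordinal.{u}} {lam : Ordinal.{u}}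
    {q₀ : Ordinal.{u} × Ordinal.{u}} (hq₀ : PairLT q₀ (unpair lam))
    {l : Ordinal.{u}} (hle : ∀ q, ¬ PairLT q q₀ → PairLT q (unpair lam) → f (pair q) ≤ l)
    (hlt : ∀ b < l, ∃ q₁, PairLT q₁ (unpair lam) ∧
      ∀ q, ¬ PairLT q q₁ → PairLT q (unpair lam) → b < f (pair q)) : IsLimInf f lam l := by
  have key : ∀ q, PairLT q (unpair lam) → pair q < lam := fun q hq => by
    rw [← pairLT_unpair, unpair_pair]; exact hq
  have key2 : ∀ q σ, pair q ≤ σ → ¬ PairLT (unpair σ) q := fun q σ h h' => by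
    have := pair_strictMono h'
    rw [pair_unpair] at this
    exact this.not_ge h
  refine ⟨fun b hb => ?_, fun η hη => ?_⟩
  · obtain ⟨q₁, h1, h2⟩ := hlt b hb
    refine ⟨pair q₁, key _ h1, fun σ h3 h4 => ?_⟩
    simpa using h2 (unpair σ) (key2 _ _ h3) (pairLT_unpair.2 h4)
  · have h1 : max η (pair q₀) < lam := max_lt hη (key _ hq₀)
    refine ⟨_, le_max_left _ (pair q₀), h1, ?_⟩
    simpa using hle (unpair (max η (pair q₀))) (key2 _ _ (le_max_right _ _)) (pairLT_unpair.2 h1)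

/-- The representation of pairs is designed for this. Pairs with maximum `m` come in the order `(0,
m), (1, m), …`, then `(m, 0), …, (m, m)`. At `(0, y)` with `y` a limit the second components have
inferior limit 0, not `y`; the maximum, kept in its own register, is monotone. The other two
component registers restart from 0 for each `m`. Passing from the pairs `(x, m)` to `(m, 0)` only
means that the first register has grown to `m`. -/
theorem enumState_limit {lam : Ordinal.{u}} (hlam : IsSuccLimit lam) (j : Fin 4) :
    IsLimInf (enumState · j) lam (enumState lam j) := by
  have hp : ∀ q, nextPair q ≠ unpair lam := fun q hq => by
    have h1 := pair_nextPair q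
    rw [hq, pair_unpair] at h1
    exact hlam.isSuccPrelimit.succ_ne _ h1.symm
  by_cases hj : j = 3
  · subst hj
    exact isLimInf_of_monotone (fun _ _ h _ => h) (fun σ h => h.le)
      fun b hb => ⟨b + 1, hlam.succ_lt hb, lt_add_one b⟩
  have hj' : j = 0 ∨ j = 1 ∨ j = 2 := by omega
  have hst : ∀ q : Ordinal.{u} × Ordinal.{u}, enumState (pair q) =
      ![q.1, if q.1 < q.2 then 0 else q.2, max q.1 q.2, pair q] := fun q => by
    simp [enumState]
  obtain ⟨p, rfl⟩ : ∃ p, pair p = lam := pair_surjective lam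
  simp only [unpair_pair] at hp
  obtain ⟨x, y⟩ := p
  have lt1 : ∀ b : Ordinal.{u}, b < b + 1 := lt_add_one
  have zl : ∀ b : Ordinal.{u}, 0 ≤ b := fun _ => zero_le
  have z1 := zl x
  have z2 := zl y
  have sl : ∀ b c : Ordinal.{u}, IsSuccLimit c → b < c → b + 1 < c := fun b c h hb => h.succ_lt hb
  have l3 : x < y → x + 1 ≤ y := Order.add_one_le_of_lt
  rcases lt_or_ge x y with hxy | hxy
  · rcases Ordinal.zero_or_succ_or_isSuccLimit x with rfl | ⟨x, rfl⟩ | hx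
    · have hy : IsSuccLimit y := by
        rcases Ordinal.zero_or_succ_or_isSuccLimit y with rfl | ⟨y, rfl⟩ | hy
        · exact (lt_irrefl _ hxy).elim
        · exact (hp (y, y) (by simp [nextPair, succ_eq_add_one])).elim
        · exact hy
      -- The pairs `(0, m)` occur cofinally before `(0, y)` and bring the first two registers down
      -- to 0.
      have hcof : ∀ η < pair (0, y), ∃ m, η ≤ pair (0, m) ∧ pair (0, m) < pair (0, y) ∧ 0 < m := by
        intro η hη
        obtain ⟨⟨a, b⟩, rfl⟩ := pair_surjective η
        have ha := sl a y hy
        have hb := sl b y hy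
        rw [pair_lt_iff] at hη
        refine ⟨max a b + 1, (pair_strictMono ?_).le, pair_strictMono ?_, ?_⟩
        · left; simp [lt1]
        · have := zl a
          have := zl b
          unfold PairLT at *
          grind
        · simp
      rcases hj' with rfl | rfl | rfl
      · refine ⟨fun b hb => ?_, fun η hη => ?_⟩
        · simp [hst] at hb
        · obtain ⟨m, h1, h2, h3⟩ := hcof η hη
          exact ⟨_, h1, h2, by simp [hst]⟩
      · refine ⟨fun b hb => ?_, fun η hη => ?_⟩
        · simp [hst, hxy] at hb
        · obtain ⟨m, h1, h2, h3⟩ := hcof η hη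
          exact ⟨_, h1, h2, by simp [hst, h3]⟩
      · refine isLimInf_of_unpair (q₀ := (0, 0)) ?_ (fun q _ h => ?_) fun b hb => ?_
        · simpa [PairLT] using Or.inl hxy
        · rw [unpair_pair] at h
          have := h.max_le
          simp only [max_eq_right hxy.le] at this
          simpa [hst] using this
        · have hb' : b < y := by simpa [hst] using hb
          refine ⟨(0, b + 1), ?_, fun q h1 h2 => ?_⟩
          · simpa [PairLT] using Or.inl (sl _ _ hy hb')
          · simp only [hst, Matrix.cons_val]
            have := lt1 b
            have := zl b
            unfold PairLT at h1
            grind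
    · refine (hp (x, y) ?_).elim
      have := lt1 x
      simp only [nextPair, succ_eq_add_one] at *
      grind
    · have hq : ∀ x' < x, PairLT (x', y) (x, y) := fun x' h => by
        simp [PairLT, hxy.le, (h.trans hxy).le, h]
      have hq' : ∀ x' < x, ∀ q, ¬ PairLT q (x', y) → PairLT q (x, y) →
          q.2 = y ∧ x' ≤ q.1 ∧ q.1 < x := by
        intro x' h q h1 h2
        unfold PairLT at *
        grind
      have hx0 := hx.bot_lt
      rcases hj' with rfl | rfl | rfl
      · refine isLimInf_of_unpair (q₀ := (0, y)) ?_ (fun q h1 h2 => ?_) fun b hb => ?_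
        · simpa using hq 0 hx0
        · rw [unpair_pair] at h2
          simpa [hst] using (hq' 0 hx0 q h1 h2).2.2.le
        · have hb' : b < x := by simpa [hst] using hb
          rw [unpair_pair]
          refine ⟨(b + 1, y), hq _ (sl _ _ hx hb'), fun q h1 h2 => ?_⟩
          simpa [hst] using hq' _ (sl _ _ hx hb') q h1 h2 |>.2.1
      · refine isLimInf_of_eventually_eq (η₀ := pair (0, y)) (pair_strictMono (hq 0 hx0)) ?_
        intro σ h1 h2
        obtain ⟨q, rfl⟩ := pair_surjective σ
        obtain ⟨k1, k2, k3⟩ := hq' 0 hx0 q (fun h => h1.not_gt (pair_strictMono h))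
          (pair_lt_iff.1 h2)
        simp [hst, hxy, k1, k3.trans hxy]
      · refine isLimInf_of_eventually_eq (η₀ := pair (0, y)) (pair_strictMono (hq 0 hx0)) ?_
        intro σ h1 h2
        obtain ⟨q, rfl⟩ := pair_surjective σ
        obtain ⟨k1, k2, k3⟩ := hq' 0 hx0 q (fun h => h1.not_gt (pair_strictMono h))
          (pair_lt_iff.1 h2)
        simp [hst, hxy.le, k1, (k3.trans hxy).le]
  · rcases Ordinal.zero_or_succ_or_isSuccLimit y with rfl | ⟨y, rfl⟩ | hy
    · rcases Ordinal.zero_or_succ_or_isSuccLimit x with rfl | ⟨x, rfl⟩ | hx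
      · rw [← unpair_zero, pair_unpair] at hlam
        exact (lt_irrefl _ hlam.bot_lt).elim
      · exact (hp (x, x + 1) (by simp [nextPair, succ_eq_add_one])).elim
      -- The pair `(x, 0)` with `x` a limit is approached through the pairs `(x', x)`.
      · have hq : ∀ x' < x, PairLT (x', x) (x, 0) := fun x' h => by
          simp [PairLT, h.le, h]
        have hq' : ∀ x' < x, ∀ q, ¬ PairLT q (x', x) → PairLT q (x, 0) →
            q.2 = x ∧ x' ≤ q.1 ∧ q.1 < x := by
          intro x' h q h1 h2
          have := zl q.2
          unfold PairLT at *
          grind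
        have hx0 := hx.bot_lt
        rcases hj' with rfl | rfl | rfl
        · refine isLimInf_of_unpair (q₀ := (0, x)) ?_ (fun q h1 h2 => ?_) fun b hb => ?_
          · simpa using hq 0 hx0
          · rw [unpair_pair] at h2
            simpa [hst] using (hq' 0 hx0 q h1 h2).2.2.le
          · have hb' : b < x := by simpa [hst] using hb
            rw [unpair_pair]
            refine ⟨(b + 1, x), hq _ (sl _ _ hx hb'), fun q h1 h2 => ?_⟩
            simpa [hst] using hq' _ (sl _ _ hx hb') q h1 h2 |>.2.1
        · refine isLimInf_of_eventually_eq (η₀ := pair (0, x)) (pair_strictMono (hq 0 hx0)) ?_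
          intro σ h1 h2
          obtain ⟨q, rfl⟩ := pair_surjective σ
          obtain ⟨k1, k2, k3⟩ := hq' 0 hx0 q (fun h => h1.not_gt (pair_strictMono h))
            (pair_lt_iff.1 h2)
          simp [hst, k1, k3]
        · refine isLimInf_of_eventually_eq (η₀ := pair (0, x)) (pair_strictMono (hq 0 hx0)) ?_
          intro σ h1 h2
          obtain ⟨q, rfl⟩ := pair_surjective σ
          obtain ⟨k1, k2, k3⟩ := hq' 0 hx0 q (fun h => h1.not_gt (pair_strictMono h))
            (pair_lt_iff.1 h2)
          simp [hst, k1, k3.le]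
    · refine (hp (x, y) ?_).elim
      have := lt1 y
      simp only [nextPair, succ_eq_add_one] at *
      grind
    · have hq : ∀ y' < y, PairLT (x, y') (x, y) := fun y' h => by
        simp [PairLT, hxy, (h.trans_le hxy).le, h]
      have hq' : ∀ y' < y, ∀ q, ¬ PairLT q (x, y') → PairLT q (x, y) →
          q.1 = x ∧ y' ≤ q.2 ∧ q.2 < y := by
        intro y' h q h1 h2
        unfold PairLT at *
        grind
      have hy0 := hy.bot_lt
      rcases hj' with rfl | rfl | rfl
      · refine isLimInf_of_eventually_eq (η₀ := pair (x, 0)) (pair_strictMono (hq 0 hy0)) ?_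
        intro σ h1 h2
        obtain ⟨q, rfl⟩ := pair_surjective σ
        obtain ⟨k1, k2, k3⟩ := hq' 0 hy0 q (fun h => h1.not_gt (pair_strictMono h))
          (pair_lt_iff.1 h2)
        simp [hst, k1]
      · refine isLimInf_of_unpair (q₀ := (x, 0)) ?_ (fun q h1 h2 => ?_) fun b hb => ?_
        · simpa using hq 0 hy0
        · rw [unpair_pair] at h2
          obtain ⟨k1, k2, k3⟩ := hq' 0 hy0 q h1 h2
          simpa [hst, k1, hxy.not_gt, (k3.trans_le hxy).not_gt] using k3.le
        · have hb' : b < y := by simpa [hst, hxy.not_gt] using hb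
          rw [unpair_pair]
          refine ⟨(x, b + 1), hq _ (sl _ _ hy hb'), fun q h1 h2 => ?_⟩
          obtain ⟨k1, k2, k3⟩ := hq' _ (sl _ _ hy hb') q h1 h2
          simpa [hst, k1, (k3.trans_le hxy).not_gt] using k2
      · refine isLimInf_of_eventually_eq (η₀ := pair (x, 0)) (pair_strictMono (hq 0 hy0)) ?_
        intro σ h1 h2
        obtain ⟨q, rfl⟩ := pair_surjective σ
        obtain ⟨k1, k2, k3⟩ := hq' 0 hy0 q (fun h => h1.not_gt (pair_strictMono h))
          (pair_lt_iff.1 h2)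
        simp [hst, k1, hxy, (k3.trans_le hxy).le]

variable {α : Ordinal.{u}} {r : ℕ → Ordinal.{u}}

theorem exec_enumBody (hα : IsSuccLimit α) (hr : ∀ i, r i < α) {T : (ℕ → Ordinal.{u}) → Prop}
    {a b m : Ordinal.{u}}
    (hT : ∀ s, min (r 3) a ≤ s 3 → min (r 4) b ≤ s 4 → min (r 5) m ≤ s 5 → r 6 ≤ s 6 → T s)
    (h : (r 3 ≠ r 5 ∧ a = r 3 + 1 ∧ b = r 4 ∧ m = r 5) ∨
      (r 3 = r 5 ∧ r 4 ≠ r 5 ∧ a = r 3 ∧ b = r 4 + 1 ∧ m = r 5) ∨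
      (r 3 = r 5 ∧ r 4 = r 5 ∧ a = 0 ∧ b = 0 ∧ m = r 5 + 1)) :
    Exec α enumBody 0 r T (fun s => s 3 = a ∧ s 4 = b ∧ s 5 = m ∧ s 6 = r 6 + 1) := by
  refine exec_seq hα hr (Q := fun s => s 3 = a ∧ s 4 = b ∧ s 5 = m ∧ s 6 = r 6) ?_ ?_
  · have hTr : T r := hT r (min_le_left _ _) (min_le_left _ _) (min_le_left _ _) le_rfl
    have hQT : ∀ s, s 3 = a ∧ s 4 = b ∧ s 5 = m ∧ s 6 = r 6 → T s := by
      rintro s ⟨rfl, rfl, rfl, h6⟩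
      exact hT s (min_le_right _ _) (min_le_right _ _) (min_le_right _ _) h6.ge
    refine exec_ite hTr (fun hφ => ?_) (fun hφ => exec_ite hTr (fun hψ => ?_) (fun hψ => ?_) hQT) hQT
    · simp only [Cond.Holds] at hφ
      obtain ⟨-, rfl, rfl, rfl⟩ := h.resolve_right (by tauto)
      exact exec_inc hTr (by simp)
    · simp only [Cond.Holds, not_not] at hφ hψ
      obtain ⟨-, -, rfl, rfl, rfl⟩ : _ ∧ _ ∧ _ ∧ _ := (h.resolve_left (by tauto)).resolve_right (by tauto)
      exact exec_inc hTr (by simp)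
    · simp only [Cond.Holds, not_not] at hφ hψ
      obtain ⟨-, -, rfl, rfl, rfl⟩ := (h.resolve_left (by tauto)).resolve_left (by tauto)
      refine exec_seq hα hr (Q := fun s => s = Function.update r 5 (r 5 + 1))
        (exec_inc hTr rfl) ?_
      rintro s1 rfl hs1 -
      refine exec_seq hα hs1 (exec_zero (hT _ ?_ ?_ ?_ ?_) (Q := fun s => s = Function.update
        (Function.update r 5 (r 5 + 1)) 3 0) rfl) ?_
      any_goals simp
      intro _ _
      refine exec_zero (hT _ ?_ ?_ ?_ ?_) ?_
      all_goals simp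
  · rintro s ⟨h3, h4, h5, h6⟩ - -
    refine exec_inc (hT s ?_ ?_ ?_ ?_) ?_ <;> simp [h3, h4, h5, h6]

theorem exec_enumCmd (hα : IsSuccLimit α) (hr : ∀ i, r i < α) {φ : Cond} {o : Ordinal.{u}}
    (ho : o < α) (hφ : ∀ s, (∀ i, i < 3 ∨ 6 < i → s i = r i) → ∀ θ ≤ o,
      (∀ j : Fin 4, s (j + 3) = enumState θ j) → (φ.Holds s ↔ θ = o)) :
    Exec α (enumCmd φ) 0 r (fun _ => True) (fun s => ∀ j : Fin 4, s (j + 3) = enumState o j) := by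
  unfold enumCmd
  refine exec_seq_frame hα hr (exec_zero trivial (Q := fun s => s 3 = 0) (by simp))
    (fun _ _ => trivial) fun r1 h1 hr1 f1 => ?_
  refine exec_seq_frame hα hr1 (exec_zero trivial (Q := fun s => s 4 = 0) (by simp))
    (fun _ _ => trivial) fun r2 h2 hr2 f2 => ?_
  refine exec_seq_frame hα hr2 (exec_zero trivial (Q := fun s => s 5 = 0) (by simp))
    (fun _ _ => trivial) fun r3 h3 hr3 f3 => ?_
  refine exec_seq_frame hα hr3 (exec_zero trivial (Q := fun s => s 6 = 0) (by simp))
    (fun _ _ => trivial) fun r4 h4 hr4 f4 => ?_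
  simp only [Cmd.Writes] at f1 f2 f3 f4
  have g4 : ∀ i, i < 3 ∨ 6 < i → r4 i = r i := fun i hi => by
    rw [f4 i (by omega), f3 i (by omega), f2 i (by omega), f1 i (by omega)]
  have hw : ∀ i, i < 3 ∨ 6 < i → ¬ enumBody.Writes i := fun i hi => by
    simp only [enumBody, Cmd.Writes]; omega
  refine exec_loop hα hr4 (fun j : Fin 4 => (j : ℕ) + 3) enumState o
    (fun lam hle hlam j => ⟨_, enumState_limit hlam j, (reset_of_lt ?_).symm⟩) ?_ ?_ ?_
  · have h1 := unpair_fst_le lam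
    have h2 := unpair_snd_le lam
    have h3 := hle.trans_lt ho
    fin_cases j <;> simp [enumState]
    · exact h1.trans_lt h3
    · split_ifs
      · exact hα.bot_lt
      · exact h2.trans_lt h3
    · exact ⟨h1.trans_lt h3, h2.trans_lt h3⟩
    · exact h3
  · have e3 : r4 3 = 0 := by rw [f4 3 (by omega), f3 3 (by omega), f2 3 (by omega), h1]
    have e4 : r4 4 = 0 := by rw [f4 4 (by omega), f3 4 (by omega), h2]
    have e5 : r4 5 = 0 := by rw [f4 5 (by omega), h3]
    intro j
    fin_cases j <;> simp [enumState, e3, e4, e5, h4]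
  · intro θ hθ s hs hf hv
    have hf' : ∀ i, i < 3 ∨ 6 < i → s i = r i := fun i hi => (hf i (hw i hi)).trans (g4 i hi)
    refine ⟨fun h => hθ.ne ((hφ s hf' θ hθ.le hv).1 h), ?_⟩
    have e3 := hv 0
    have e4 := hv 1
    have e5 := hv 2
    have e6 := hv 3
    have n := unpair_add_one θ
    simp [enumState] at e3 e4 e5 e6
    refine (exec_enumBody hα hs (a := enumState (θ + 1) 0) (b := enumState (θ + 1) 1)
      (m := enumState (θ + 1) 2) ?_ ?_).imp ?_
    · intro s' k3 k4 k5 k6 j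
      rw [show s 3 = _ from hv 0] at k3; rw [show s 4 = _ from hv 1] at k4
      rw [show s 5 = _ from hv 2] at k5; rw [show s 6 = _ from hv 3] at k6
      fin_cases j
      · exact k3
      · exact k4
      · exact k5
      · exact (min_le_left _ _).trans k6
    · simp only [enumState, n, Matrix.cons_val]
      rw [e3, e4, e5]
      generalize unpair θ = p
      obtain ⟨x, y⟩ := p
      have l1 : ∀ b : Ordinal.{u}, b < b + 1 := lt_add_one
      have l2 : x < y → x + 1 ≤ y := Order.add_one_le_of_lt
      have l3 : y < x → y + 1 ≤ x := Order.add_one_le_of_lt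
      have l4 : ∀ b : Ordinal.{u}, 0 ≤ b := fun _ => zero_le
      have l5 := l1 x
      have l6 := l4 x
      have l7 := l4 y
      unfold nextPair
      dsimp only
      split_ifs <;> grind
    · rintro s' ⟨k3, k4, k5, k6⟩ j
      fin_cases j
      · exact k3
      · exact k4
      · exact k5
      · rw [show s 6 = _ from hv 3] at k6; exact k6
  · intro s hf hv h
    exact h ((hφ s (fun i hi => (hf i (hw i hi)).trans (g4 i hi)) o le_rfl hv).2 rfl)

end PairCmd

/-! ### Closure properties -/

theorem ExponentiallyClosed.mul_lt {α : Ordinal.{u}} (h : ExponentiallyClosed α) {a b : Ordinal.{u}}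
    (ha : a < α) (hb : b < α) : a * b < α := by
  have h2 : (2 : Ordinal.{u}) < α := (Ordinal.natCast_lt_omega0 2).trans_le h.1
  have h3 : (max a b) ^ (2 : Ordinal.{u}) < α := h.2 (max_lt ha hb) h2
  refine lt_of_le_of_lt ?_ h3
  rw [show (2 : Ordinal.{u}) = 1 + 1 by norm_num, Ordinal.opow_add, Ordinal.opow_one]
  exact mul_le_mul' (le_max_left _ _) (le_max_right _ _)

theorem ExponentiallyClosed.add_lt {α : Ordinal.{u}} (h : ExponentiallyClosed α) {a b : Ordinal.{u}}
    (ha : a < α) (hb : b < α) : a + b < α := by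
  have h2 : (2 : Ordinal.{u}) < α := (Ordinal.natCast_lt_omega0 2).trans_le h.1
  refine lt_of_le_of_lt ?_ (h.mul_lt (max_lt ha hb) h2)
  rw [show (2 : Ordinal.{u}) = 1 + 1 by norm_num, mul_add, mul_one]
  exact add_le_add (le_max_left _ _) (le_max_right _ _)

theorem ExponentiallyClosed.isSuccLimit {α : Ordinal.{u}} (h : ExponentiallyClosed α) :
    IsSuccLimit α := by
  have h1 : (1 : Ordinal.{u}) < α := (Ordinal.one_lt_omega0).trans_le h.1
  refine Ordinal.isSuccLimit_iff.2 ⟨?_, isSuccPrelimit_iff_succ_lt.2 fun a ha => h.add_lt ha h1⟩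
  exact (zero_lt_one.trans h1).ne'

theorem pair_lt {α : Ordinal.{u}} (h : ExponentiallyClosed α) {a b : Ordinal.{u}} (ha : a < α)
    (hb : b < α) : pair (a, b) < α := by
  set M := max a b + 1 with hM
  have hα := h.isSuccLimit
  have hMα : M < α := hα.succ_lt (max_lt ha hb)
  -- Reading maximum, first and second component as digits in base `M` is monotone on the pairs
  -- below `M`, so it bounds the codes, and the bound is built from sums and products below `α`.
  have key : ∀ q : Ordinal.{u} × Ordinal.{u}, max q.1 q.2 < M →
      pair q ≤ M * (M * max q.1 q.2 + q.1) + q.2 := by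
    intro q
    induction q using wellFounded_pairLT.induction with
    | _ q ih =>
      intro hq
      refine pair_le fun p hp => (ih p hp (hp.max_le.trans_lt hq)).trans_lt ?_
      have h1 : ∀ x y : Ordinal.{u}, x < y → ∀ z < M, M * x + z < M * y := by
        intro x y hxy z hz
        calc M * x + z < M * x + M := by gcongr
          _ = M * (x + 1) := by rw [mul_add, mul_one]
          _ ≤ M * y := by gcongr; exact Order.add_one_le_of_lt hxy
      have hpM := hp.max_le.trans_lt hq
      have hp1 := (le_max_left _ _).trans_lt hpM
      have hp2 := (le_max_right _ _).trans_lt hpM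
      rcases hp with hp | ⟨h2, hp | ⟨h3, hp⟩⟩
      · refine (h1 _ _ ?_ _ hp2).trans_le le_self_add
        exact (h1 _ _ hp _ hp1).trans_le le_self_add
      · refine (h1 _ _ ?_ _ hp2).trans_le le_self_add
        rw [h2]; gcongr
      · rw [h2, h3]; gcongr
  have hmax : max a b < α := max_lt ha hb
  exact (key (a, b) (lt_add_one _)).trans_lt
    (h.add_lt (h.mul_lt hMα (h.add_lt (h.mul_lt hMα hmax) ha)) hb)

/-! ### Arithmetic programs -/

section Arith

variable {α : Ordinal.{u}} {r : ℕ → Ordinal.{u}}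

/-- Put the code of the pair of the contents of `x` and `y` into register `z`. -/
def pairCmd (x y z : ℕ) : Cmd :=
  .seq (enumCmd (.or (.and (.eq 3 5) (.and (.eq x 5) (.eq y 4)))
    (.and (.not (.eq 3 5)) (.and (.eq x 3) (.eq y 5))))) (.copy 6 z)

/-- Decode the content of register `z` into the registers `x` and `y`. -/
def unpairCmd (z x y : ℕ) : Cmd :=
  .seq (enumCmd (.eq 6 z)) (.ite (.eq 3 5) (.seq (.copy 5 x) (.copy 4 y))
    (.seq (.copy 3 x) (.copy 5 y)))

theorem enumCmd_writes {φ : Cond} {k : ℕ} : (enumCmd φ).Writes k ↔ 3 ≤ k ∧ k ≤ 6 := by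
  simp only [enumCmd, enumBody, Cmd.Writes]; omega

@[simp] theorem pairCmd_writes {x y z k : ℕ} :
    (pairCmd x y z).Writes k ↔ (3 ≤ k ∧ k ≤ 6) ∨ k = z := by
  simp only [pairCmd, Cmd.Writes, enumCmd_writes]

@[simp] theorem unpairCmd_writes {x y z k : ℕ} :
    (unpairCmd z x y).Writes k ↔ (3 ≤ k ∧ k ≤ 6) ∨ k = x ∨ k = y := by
  simp only [unpairCmd, Cmd.Writes, enumCmd_writes]; omega

/-- The enumeration runs until it meets the wanted pair; the counter then shows its code. The stop
condition has two cases because the enumeration registers represent pairs in two ways. -/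
theorem exec_pairCmd (h : ExponentiallyClosed α) (hr : ∀ i, r i < α) {x y z : ℕ}
    (hx : x < 3 ∨ 6 < x) (hy : y < 3 ∨ 6 < y) :
    Exec α (pairCmd x y z) 0 r (fun _ => True) (fun s => s z = pair (r x, r y)) := by
  have hα := h.isSuccLimit
  refine exec_seq hα hr (exec_enumCmd hα hr (o := pair (r x, r y)) (pair_lt h (hr x) (hr y)) ?_) ?_
  · intro s hf θ hθ hv
    have e3 : s 3 = (unpair θ).1 := hv 0
    have e4 : s 4 = if (unpair θ).1 < (unpair θ).2 then 0 else (unpair θ).2 := hv 1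
    have e5 : s 5 = max (unpair θ).1 (unpair θ).2 := hv 2
    rw [← unpair_eq_iff]
    simp only [Cond.Holds, e3, e4, e5, hf x hx, hf y hy]
    generalize unpair θ = p
    obtain ⟨a, b⟩ := p
    simp only [Prod.mk.injEq]
    grind
  · intro s hv hs hf
    have e6 : s 6 = pair (r x, r y) := hv 3
    exact exec_copy trivial (by simpa using e6)

theorem exec_unpairCmd (h : ExponentiallyClosed α) (hr : ∀ i, r i < α) {x y z : ℕ}
    (hz : z < 3 ∨ 6 < z) (hx : x < 3 ∨ 6 < x) (hxy : x ≠ y) :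
    Exec α (unpairCmd z x y) 0 r (fun _ => True)
      (fun s => s x = (unpair (r z)).1 ∧ s y = (unpair (r z)).2) := by
  have hα := h.isSuccLimit
  refine exec_seq hα hr (exec_enumCmd hα hr (o := r z) (hr z) ?_) ?_
  · intro s hf θ hθ hv
    have e6 : s 6 = θ := hv 3
    simp only [Cond.Holds, e6, hf z hz]
  · intro s hv hs hf
    have e3 : s 3 = (unpair (r z)).1 := hv 0
    have e4 : s 4 = if (unpair (r z)).1 < (unpair (r z)).2 then 0 else (unpair (r z)).2 := hv 1
    have e5 : s 5 = max (unpair (r z)).1 (unpair (r z)).2 := hv 2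
    refine exec_ite trivial (fun hφ => ?_) (fun hφ => ?_) (fun _ _ => trivial) <;>
      simp only [Cond.Holds, e3, e5] at hφ
    · refine exec_seq hα hs (exec_copy trivial (Q := fun s' => s' = Function.update s x (s 5)) rfl) ?_
      rintro s' rfl - -
      refine exec_copy trivial ?_
      have hx4 : 4 ≠ x := by omega
      have : ¬ (unpair (r z)).1 < (unpair (r z)).2 := by
        rw [hφ]; exact not_lt.2 (le_max_right _ _)
      simp [hxy, hx4, e5, e4, ← hφ, this]
    · refine exec_seq hα hs (exec_copy trivial (Q := fun s' => s' = Function.update s x (s 3)) rfl) ?_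
      rintro s' rfl - -
      refine exec_copy trivial ?_
      have hx5 : 5 ≠ x := by omega
      have : (unpair (r z)).1 ≤ (unpair (r z)).2 := by
        by_contra hlt
        exact hφ (max_eq_left (not_le.1 hlt).le).symm
      simp [hxy, hx5, e3, e5, this]

/-- Put the difference of the contents of `y` and `x` into register `z`. -/
def subCmd (x y z : ℕ) : Cmd :=
  .seq (.copy x 3) (.seq (.zero z) (.loop (.not (.eq 3 y)) (.seq (.inc 3) (.inc z))))

@[simp] theorem subCmd_writes {x y z k : ℕ} : (subCmd x y z).Writes k ↔ k = 3 ∨ k = z := by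
  simp only [subCmd, Cmd.Writes]; omega

theorem isLimInf_add (a : Ordinal.{u}) {lam : Ordinal.{u}} (hlam : IsSuccLimit lam) :
    IsLimInf (a + ·) lam (a + lam) := by
  refine isLimInf_of_monotone (fun η σ h _ => by gcongr) (fun σ h => by gcongr) fun b hb => ?_
  exact ((Ordinal.isNormal_add_right a).lt_iff_exists_lt hlam).1 hb

/-- Register 3 climbs from the smaller content to the larger one while `z` counts the steps. -/
theorem exec_subCmd (hα : IsSuccLimit α) (hr : ∀ i, r i < α) {x y z : ℕ}
    (hy : y ≠ 3) (hz : z ≠ 3) (hyz : y ≠ z) (hle : r x ≤ r y) :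
    Exec α (subCmd x y z) 0 r (fun _ => True) (fun s => s z = r y - r x) := by
  refine exec_seq hα hr (exec_copy trivial (Q := fun s => s 3 = r x) (by simp)) ?_
  intro r1 h1 hr1 f1
  refine exec_seq hα hr1 (exec_zero trivial (Q := fun s => s z = 0) (by simp)) ?_
  intro r2 h2 hr2 f2
  simp only [Cmd.Writes] at f1 f2
  have hlt : ∀ θ ≤ r y - r x, r x + θ ≤ r y := fun θ hθ => by
    rw [← Ordinal.add_sub_cancel_of_le hle]; gcongr
  refine (exec_loop hα hr2 ![3, z] (fun θ => ![r x + θ, θ]) (r y - r x) ?_ ?_ ?_ ?_).imp ?_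
  · intro lam hlam1 hlam j
    fin_cases j
    · refine ⟨_, isLimInf_add (r x) hlam, (reset_of_lt ((hlt _ hlam1).trans_lt (hr y))).symm⟩
    · refine ⟨_, by simpa using isLimInf_add 0 hlam, (reset_of_lt ?_).symm⟩
      exact hlam1.trans_lt ((Ordinal.sub_le_self _ _).trans_lt (hr y))
  · intro j
    fin_cases j
    · simp [f2 3 hz.symm, h1]
    · simp [h2]
  · intro θ hθ s hs hf hv
    simp only [Cmd.Writes, not_or] at hf
    have e3 : s 3 = r x + θ := hv 0
    have ez : s z = θ := hv 1
    have ey : s y = r y := by rw [hf y ⟨hy, hyz⟩, f2 y hyz, f1 y hy]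
    refine ⟨?_, ?_⟩
    · simp only [Cond.Holds, e3, ey]
      intro h
      rw [← h, Ordinal.add_sub_cancel] at hθ
      exact lt_irrefl _ hθ
    · have hle' : r x + θ ≤ r x + (θ + 1) := by gcongr; exact (lt_add_one θ).le
      have hle'' : θ ≤ θ + 1 := (lt_add_one θ).le
      simp only [Fin.forall_fin_two, Matrix.cons_val_zero, Matrix.cons_val_one]
      refine exec_seq hα hs (exec_inc (Q := fun s' => s' = Function.update s 3 (s 3 + 1)) ?_ rfl) ?_
      · simp [e3, ez]
      · rintro s' rfl - -
        refine exec_inc ?_ ?_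
        · simp [hz, e3, ez, add_assoc]
        · simp [hz.symm, hz, e3, ez, add_assoc]
  · intro s hf hv
    simp only [Cmd.Writes, not_or] at hf
    have e3 : s 3 = r x + (r y - r x) := hv 0
    have ey : s y = r y := by rw [hf y ⟨hy, hyz⟩, f2 y hyz, f1 y hy]
    simp [Cond.Holds, e3, ey, Ordinal.add_sub_cancel_of_le hle]
  · intro s hs
    exact hs 1

end Arith

/-! ### Simulation of programs -/

/-- Only registers below `m` occur in the condition. -/
def Cond.RegsLt (m : ℕ) : Cond → Prop
  | .eq i j => i < m ∧ j < m
  | .not φ => φ.RegsLt m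
  | .and φ ψ => φ.RegsLt m ∧ ψ.RegsLt m
  | .or φ ψ => φ.RegsLt m ∧ ψ.RegsLt m

/-- Only registers below `m` occur in the instruction. -/
def Instr.RegsLt (m : ℕ) : Instr → Prop
  | .zero i => i < m
  | .inc i => i < m
  | .copy i j => i < m ∧ j < m
  | .jump φ _ => φ.RegsLt m

theorem Cond.RegsLt.mono {m n : ℕ} (h : m ≤ n) {φ : Cond} (hφ : φ.RegsLt m) : φ.RegsLt n := by
  induction φ with
  | eq i j => exact ⟨hφ.1.trans_le h, hφ.2.trans_le h⟩
  | not φ ih => exact ih hφ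
  | and φ ψ ih ih' => exact ⟨ih hφ.1, ih' hφ.2⟩
  | or φ ψ ih ih' => exact ⟨ih hφ.1, ih' hφ.2⟩

theorem Cond.exists_regsLt (φ : Cond) : ∃ m, φ.RegsLt m := by
  induction φ with
  | eq i j => exact ⟨max i j + 1, by simp [RegsLt]⟩
  | not φ ih => exact ih
  | and φ ψ ih ih' =>
    obtain ⟨m, hm⟩ := ih
    obtain ⟨n, hn⟩ := ih'
    exact ⟨max m n, hm.mono (le_max_left _ _), hn.mono (le_max_right _ _)⟩
  | or φ ψ ih ih' =>
    obtain ⟨m, hm⟩ := ih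
    obtain ⟨n, hn⟩ := ih'
    exact ⟨max m n, hm.mono (le_max_left _ _), hn.mono (le_max_right _ _)⟩

theorem Instr.RegsLt.mono {m n : ℕ} (h : m ≤ n) {I : Instr} (hI : I.RegsLt m) : I.RegsLt n := by
  cases I with
  | zero i => exact hI.trans_le h
  | inc i => exact hI.trans_le h
  | copy i j => exact ⟨hI.1.trans_le h, hI.2.trans_le h⟩
  | jump φ l => exact Cond.RegsLt.mono h hI

theorem Instr.exists_regsLt (I : Instr) : ∃ m, I.RegsLt m := by
  cases I with
  | zero i => exact ⟨i + 1, lt_add_one i⟩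
  | inc i => exact ⟨i + 1, lt_add_one i⟩
  | copy i j => exact ⟨max i j + 1, by simp [RegsLt]⟩
  | jump φ l => exact φ.exists_regsLt

theorem Program.exists_regsLt (P : Program) (k : ℕ) : ∃ m ≥ k, ∀ I ∈ P.code, I.RegsLt m := by
  have : ∀ L : List Instr, ∃ m ≥ k, ∀ I ∈ L, I.RegsLt m := by
    intro L
    induction L with
    | nil => exact ⟨k, le_rfl, by simp⟩
    | cons I L ih =>
      obtain ⟨m, hk, hm⟩ := ih
      obtain ⟨n, hn⟩ := I.exists_regsLt
      refine ⟨max m n, hk.trans (le_max_left _ _), ?_⟩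
      simp only [List.mem_cons, forall_eq_or_imp]
      exact ⟨hn.mono (le_max_right _ _), fun J hJ => (hm J hJ).mono (le_max_left _ _)⟩
  exact this _

/-- Rename the registers in a condition. -/
def Cond.map (f : ℕ → ℕ) : Cond → Cond
  | .eq i j => .eq (f i) (f j)
  | .not φ => .not (φ.map f)
  | .and φ ψ => .and (φ.map f) (ψ.map f)
  | .or φ ψ => .or (φ.map f) (ψ.map f)

theorem Cond.map_holds {f : ℕ → ℕ} {m : ℕ} {r s : ℕ → Ordinal.{u}} (h : ∀ i < m, s (f i) = r i)
    {φ : Cond} (hφ : φ.RegsLt m) : (φ.map f).Holds s ↔ φ.Holds r := by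
  induction φ with
  | eq i j => simp only [map, Holds, h i hφ.1, h j hφ.2]
  | not φ ih => exact not_congr (ih hφ)
  | and φ ψ ih ih' => exact and_congr (ih hφ.1) (ih' hφ.2)
  | or φ ψ ih ih' => exact or_congr (ih hφ.1) (ih' hφ.2)

/-- In a simulation that uses the registers from `b` on, register `b` holds the active line, the
following registers hold the constants `0, …, P.code.length`, and register `i` is represented by
the following register. -/
def simReg (P : Program) (b i : ℕ) : ℕ := b + 2 + P.code.length + i

/-- Simulation of an instruction in line `l`. -/
def Instr.simulate (P : Program) (b l : ℕ) : Instr → Cmd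
  | .zero i => .seq (.zero (simReg P b i)) (.copy (b + 1 + (l + 1)) b)
  | .inc i => .seq (.inc (simReg P b i)) (.copy (b + 1 + (l + 1)) b)
  | .copy i j => .seq (.copy (simReg P b i) (simReg P b j)) (.copy (b + 1 + (l + 1)) b)
  | .jump φ l' => .ite (φ.map (simReg P b)) (.copy (b + 1 + min l' P.code.length) b)
      (.copy (b + 1 + (l + 1)) b)

/-- Simulation of the active instruction among those of the list `L`, which starts at line `l`. -/
def simulateFrom (P : Program) (b : ℕ) : List Instr → ℕ → Cmd
  | [], _ => .skip
  | I :: L, l => .ite (.eq b (b + 1 + l)) (I.simulate P b l) (simulateFrom P b L (l + 1))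

/-- Simulation of one step. -/
def simStep (P : Program) (b : ℕ) : Cmd := simulateFrom P b P.code 0

/-- The register contents `r` represent the configuration `C`. -/
def Represents (P : Program) (b m : ℕ) (C : Config.{u}) (r : ℕ → Ordinal.{u}) : Prop :=
  r b = (min C.line P.code.length : ℕ) ∧ ∀ i < m, r (simReg P b i) = C.reg i

/-- The register contents `r` represent a lower bound for the configurations `C` and `D`. -/
def RepresentsGE (P : Program) (b m : ℕ) (C D : Config.{u}) (r : ℕ → Ordinal.{u}) : Prop :=
  min ((min C.line P.code.length : ℕ) : Ordinal.{u}) (min D.line P.code.length : ℕ) ≤ r b ∧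
    ∀ i < m, min (C.reg i) (D.reg i) ≤ r (simReg P b i)

/-- The constants needed for a simulation. -/
def HasConsts (P : Program) (b : ℕ) (r : ℕ → Ordinal.{u}) : Prop :=
  ∀ l ≤ P.code.length, r (b + 1 + l) = l

section Sim

variable {P : Program} {α : Ordinal.{u}} {b m : ℕ} {C : Config.{u}} {r : ℕ → Ordinal.{u}}

theorem simulate_writes {I : Instr} (hI : I.RegsLt m) {l k : ℕ}
    (h : (I.simulate P b l).Writes k) : k = b ∨ ∃ i < m, k = simReg P b i := by
  cases I with
  | zero i => exact h.symm.imp_right fun h => ⟨i, hI, h⟩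
  | inc i => exact h.symm.imp_right fun h => ⟨i, hI, h⟩
  | copy i j => exact h.symm.imp_right fun h => ⟨j, hI.2, h⟩
  | jump φ l => exact .inl (h.elim id id)

theorem simStep_writes (hm : ∀ I ∈ P.code, I.RegsLt m) {k : ℕ} (h : (simStep P b).Writes k) :
    k = b ∨ ∃ i < m, k = simReg P b i := by
  have : ∀ (L : List Instr) (l : ℕ), (∀ I ∈ L, I.RegsLt m) → (simulateFrom P b L l).Writes k →
      k = b ∨ ∃ i < m, k = simReg P b i := by
    intro L
    induction L with
    | nil => intro _ _ h; exact h.elim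
    | cons I L ih =>
      intro l hL h
      simp only [List.mem_cons, forall_eq_or_imp] at hL
      rcases h with h | h
      · exact simulate_writes hL.1 h
      · exact ih _ hL.2 h
  exact this _ _ hm h

theorem Represents.ge_left {D : Config.{u}} (h : Represents P b m C r) :
    RepresentsGE P b m C D r :=
  ⟨by rw [h.1]; exact min_le_left _ _, fun i hi => by rw [h.2 i hi]; exact min_le_left _ _⟩

theorem Represents.ge_right {D : Config.{u}} (h : Represents P b m D r) :
    RepresentsGE P b m C D r :=
  ⟨by rw [h.1]; exact min_le_right _ _, fun i hi => by rw [h.2 i hi]; exact min_le_right _ _⟩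

/-- The simulated register is updated before the line register, and each goes from its old to its
new value in one step, which gives `RepresentsGE` throughout. All lines beyond the program are
represented by its length, so that one comparison with a constant detects halting. -/
theorem exec_simulate (hα : IsSuccLimit α) (hr : ∀ i, r i < α) {I : Instr}
    (hI : P.code[C.line]? = some I) (hm : I.RegsLt m) (h : Represents P b m C r)
    (hc : HasConsts P b r) :
    Exec α (I.simulate P b C.line) 0 r (RepresentsGE P b m C (P.step C))
      (Represents P b m (P.step C)) := by
  have hlt : C.line < P.code.length := (List.getElem?_eq_some_iff.1 hI).1
  have hstep : P.step C = I.exec C := by simp [Program.step, hI]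
  have hk : r (b + 1 + (C.line + 1)) = ((C.line + 1 : ℕ) : Ordinal.{u}) := hc _ hlt
  have hreg : ∀ i, simReg P b i ≠ b := fun i => by unfold simReg; omega
  have hreg' : ∀ i, b + 1 + (C.line + 1) ≠ simReg P b i := fun i => by unfold simReg; omega
  have hinj : ∀ i j, simReg P b i = simReg P b j ↔ i = j := fun i j => by
    unfold simReg; omega
  have hmin : min (C.line + 1) P.code.length = C.line + 1 := min_eq_left hlt
  have hmin' : min C.line P.code.length = C.line := min_eq_left hlt.le
  obtain ⟨h1, h2⟩ := h
  -- the three instructions that change a register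
  have main : ∀ (c : Cmd) (j : ℕ) (v : Ordinal.{u}), j < m →
      I.exec C = ⟨C.line + 1, Function.update C.reg j v⟩ →
      (∀ T Q : (ℕ → Ordinal.{u}) → Prop, T r → Q (Function.update r (simReg P b j) v) →
        Exec α c 0 r T Q) →
      Exec α (.seq c (.copy (b + 1 + (C.line + 1)) b)) 0 r (RepresentsGE P b m C (P.step C))
        (Represents P b m (P.step C)) := by
    intro c j v hj he hc'
    rw [hstep, he]
    refine exec_seq hα hr (hc' _ (fun s => s = Function.update r (simReg P b j) v)
      (Represents.ge_left ⟨h1, h2⟩) rfl) ?_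
    rintro s rfl - -
    refine exec_copy ⟨?_, fun i hi => ?_⟩ ⟨?_, fun i hi => ?_⟩
    · simp [(hreg j).symm, h1]
    · by_cases hij : i = j
      · subst hij; simp
      · simp [hij, hinj, h2 i hi]
    · simp only [Function.update_self, ne_eq, hreg', not_false_eq_true, Function.update_of_ne, hk,
        hmin]
    · by_cases hij : i = j
      · subst hij; simp [hreg]
      · simp [hij, hinj, h2 i hi, hreg]
  cases I with
  | zero i => exact main _ i 0 hm rfl fun T Q hT hQ => exec_zero hT hQ
  | inc i =>
    refine main _ i (C.reg i + 1) hm rfl fun T Q hT hQ => exec_inc hT ?_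
    rwa [h2 i hm]
  | copy i j =>
    refine main _ j (C.reg i) hm.2 rfl fun T Q hT hQ => exec_copy hT ?_
    rwa [h2 i hm.1]
  | jump φ l =>
    have hge : RepresentsGE P b m C (P.step C) r := Represents.ge_left ⟨h1, h2⟩
    have hiff := Cond.map_holds (s := r) (f := simReg P b) (r := C.reg) h2 (φ := φ) hm
    refine exec_ite hge (fun hφ => exec_copy hge ?_) (fun hφ => exec_copy hge ?_)
      (fun s hs => hs.ge_right) <;> rw [hiff] at hφ <;> rw [hstep]
    · refine ⟨?_, fun i hi => ?_⟩
      · simp [Instr.exec, hφ, hc _ (min_le_right l _)]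
      · simp [Instr.exec, hreg, h2 i hi]
    · refine ⟨?_, fun i hi => ?_⟩
      · simp only [Instr.exec, hφ, if_false, Function.update_self, hk, hmin]
      · simp [Instr.exec, hreg, h2 i hi]

theorem exec_simStep (hα : IsSuccLimit α) (hr : ∀ i, r i < α) (hm : ∀ I ∈ P.code, I.RegsLt m)
    (hline : C.line < P.code.length) (h : Represents P b m C r) (hc : HasConsts P b r) :
    Exec α (simStep P b) 0 r (RepresentsGE P b m C (P.step C)) (Represents P b m (P.step C)) := by
  have : ∀ (L : List Instr) (l : ℕ), P.code.drop l = L → l ≤ C.line →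
      Exec α (simulateFrom P b L l) 0 r (RepresentsGE P b m C (P.step C))
        (Represents P b m (P.step C)) := by
    intro L
    induction L with
    | nil =>
      intro l hl hle
      have := List.drop_eq_nil_iff.1 hl
      omega
    | cons I L ih =>
      intro l hl hle
      have hlen : l < P.code.length := by
        by_contra hge
        rw [List.drop_eq_nil_of_le (not_lt.1 hge)] at hl
        cases hl
      have hI : P.code[l]? = some I := by
        have := congrArg (·[0]?) hl
        simpa using this
      have hb : Cond.Holds r (.eq b (b + 1 + l)) ↔ C.line = l := by
        simp only [Cond.Holds, h.1, hc l hlen.le, min_eq_left hline.le, Nat.cast_inj]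
      refine exec_ite h.ge_left (fun hφ => ?_) (fun hφ => ?_) (fun s hs => hs.ge_right)
      · obtain rfl := hb.1 hφ
        exact exec_simulate hα hr hI (hm I (List.mem_of_getElem? hI)) h hc
      · refine ih (l + 1) ?_ (lt_of_le_of_ne hle fun h => hφ (hb.2 h.symm))
        rw [← List.drop_drop, hl]; rfl
  exact this _ 0 rfl (Nat.zero_le _)

theorem Program.HaltsIn.line_lt {v : List Ordinal.{u}} {γ σ : Ordinal.{u}}
    (h : P.HaltsIn α v γ) (hσ : σ ≤ γ) : (P.config α v σ).line < P.code.length :=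
  not_le.1 (h.2 σ hσ)

theorem config_add_one (v : List Ordinal.{u}) (σ : Ordinal.{u}) :
    P.config α v (σ + 1) = P.step (P.config α v σ) := run_add_one ..

/-- A loop that simulates a halting computation; the registers `reg j` are used for additional
bookkeeping. -/
theorem exec_simLoop (hα : IsSuccLimit α) (hr : ∀ i, r i < α) {v : List Ordinal.{u}}
    {γ : Ordinal.{u}} (hP : P.HaltsIn α v γ) {body : Cmd}
    (hw : ∀ l ≤ P.code.length, ¬ body.Writes (b + 1 + l))
    {ι : Type*} (reg : ι → ℕ) (g : Ordinal.{u} → ι → Ordinal.{u})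
    (lim : ∀ lam ≤ γ, IsSuccLimit lam → ∀ j, ∃ l, IsLimInf (g · j) lam l ∧ g lam j = reset α l)
    (h0 : Represents P b m (initial v) r) (hc : HasConsts P b r) (h0' : ∀ j, r (reg j) = g 0 j)
    (step : ∀ θ ≤ γ, ∀ s, (∀ i, s i < α) → (∀ i, ¬ body.Writes i → s i = r i) →
      HasConsts P b s → Represents P b m (P.config α v θ) s → (∀ j, s (reg j) = g θ j) →
      Exec α body 0 s (fun s' => RepresentsGE P b m (P.config α v θ) (P.config α v (θ + 1)) s' ∧
        ∀ j, min (g θ j) (g (θ + 1) j) ≤ s' (reg j))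
        (fun s' => Represents P b m (P.config α v (θ + 1)) s' ∧ ∀ j, s' (reg j) = g (θ + 1) j)) :
    Exec α (.loop (.not (.eq b (b + 1 + P.code.length))) body) 0 r (fun _ => True)
      (fun s => Represents P b m (P.config α v (γ + 1)) s ∧ ∀ j, s (reg j) = g (γ + 1) j) := by
  -- The loop state consists of the simulated line (`none`), the simulated registers and the
  -- bookkeeping registers.
  let G : Ordinal.{u} → Option (Fin m) ⊕ ι → Ordinal.{u} := fun θ => Sum.elim
    (fun j => j.elim ((min (P.config α v θ).line P.code.length : ℕ) : Ordinal.{u})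
      fun i => (P.config α v θ).reg i) (g θ)
  let R : Option (Fin m) ⊕ ι → ℕ := Sum.elim (fun j => j.elim b fun i => simReg P b i) reg
  have hiff : ∀ θ s, (∀ j, s (R j) = G θ j) ↔
      Represents P b m (P.config α v θ) s ∧ ∀ j, s (reg j) = g θ j := by
    intro θ s
    simp only [Sum.forall, Option.forall, G, R, Sum.elim_inl, Sum.elim_inr, Option.elim_none,
      Option.elim_some, Represents, Fin.forall_iff]
  have hconst : ∀ s, (∀ i, ¬ body.Writes i → s i = r i) → HasConsts P b s := fun s hs l hl => by
    rw [hs _ (hw l hl), hc l hl]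
  refine (exec_loop hα hr R G (γ + 1) ?_ ((hiff 0 r).2 ⟨?_, h0'⟩) ?_ ?_).imp
    fun s hs => (hiff _ s).1 hs
  · intro lam hle hlam j
    -- There are `γ + 1` iterations, and `γ + 1` is not a limit.
    have hle' : lam ≤ γ := by
      rcases hle.lt_or_eq with h | h
      · exact Order.lt_add_one_iff.1 h
      · exact (hlam.isSuccPrelimit.succ_ne γ h.symm).elim
    rcases j with _ | j
    · rename_i j
      cases j with
      | none =>
        obtain ⟨l, -, hl⟩ := exists_isLimInf (f := fun σ => (P.config α v σ).line) (lam := lam)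
          (b := P.code.length) fun η hη =>
            ⟨η, le_rfl, hη, (hP.line_lt (hη.le.trans hle')).le⟩
        have hll := run_limit_line P α (initial v) hlam hl
        rw [← config_eq_run] at hll
        refine ⟨l, ?_, ?_⟩
        · refine hl.natCast.congr_of_eventually hlam.bot_lt fun σ _ hσ => ?_
          simp only [G, Sum.elim_inl, Option.elim_none]
          rw [min_eq_left (hP.line_lt (hσ.le.trans hle')).le]
        · have : ((P.config α v lam).line : Ordinal.{u}) < α := 
            (Ordinal.natCast_lt_omega0 _).trans_le (Ordinal.omega0_le_of_isSuccLimit hα)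
          simp only [G, Sum.elim_inl, Option.elim_none]
          rw [min_eq_left (hP.line_lt hle').le, ← hll, reset_of_lt this]
      | some i => exact exists_run_limit_reg P α (initial v) hlam i
    · exact lim lam hle' hlam j
  · simpa [config_eq_run] using h0
  · intro θ hθ s hs hf hv
    obtain ⟨h1, h2⟩ := (hiff θ s).1 hv
    have hθ' := Order.lt_add_one_iff.1 hθ
    refine ⟨?_, (step θ hθ' s hs hf (hconst s hf) h1 h2).mono le_rfl ?_ fun s' hs' =>
      (hiff _ s').2 hs'⟩
    · have := hP.line_lt hθ'
      simp only [Cond.Holds, h1.1, hconst s hf _ le_rfl, min_eq_left this.le, Nat.cast_inj]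
      exact this.ne
    · rintro s' ⟨⟨k1, k2⟩, k3⟩
      simp only [Sum.forall, Option.forall, G, R, Sum.elim_inl, Sum.elim_inr, Option.elim_none,
        Option.elim_some, Fin.forall_iff]
      exact ⟨⟨k1, k2⟩, k3⟩
  · intro s hf hv
    have h1 := ((hiff _ s).1 hv).1.1
    have : P.code.length ≤ (P.config α v (γ + 1)).line := hP.1
    simp only [Cond.Holds, h1, hconst s hf _ le_rfl, min_eq_right this, not_not]

end Sim

/-! ### Subroutine calls -/

section Call

variable {P : Program} {α : Ordinal.{u}} {b m : ℕ} {r : ℕ → Ordinal.{u}}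

/-- Put the constants `0, …, n` into the registers from `b` on. -/
def constCmd (b : ℕ) : ℕ → Cmd
  | 0 => .zero b
  | n + 1 => .seq (constCmd b n) (.seq (.copy (b + n) (b + (n + 1))) (.inc (b + (n + 1))))

theorem constCmd_writes {n k : ℕ} (h : (constCmd b n).Writes k) : b ≤ k ∧ k ≤ b + n := by
  induction n with
  | zero => simp only [constCmd, Cmd.Writes] at h; omega
  | succ n ih =>
    simp only [constCmd, Cmd.Writes] at h
    rcases h with h | h | h
    · have := ih h; omega
    · omega
    · omega

theorem exec_constCmd (hα : IsSuccLimit α) (hr : ∀ i, r i < α) (n : ℕ) :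
    Exec α (constCmd b n) 0 r (fun _ => True) (fun s => ∀ l ≤ n, s (b + l) = l) := by
  induction n with
  | zero => exact exec_zero trivial (by simp)
  | succ n ih =>
    refine exec_seq hα hr ih fun s h hs _ => exec_seq hα hs (exec_copy trivial
      (Q := fun s' => s' = Function.update s (b + (n + 1)) n) (by rw [h n le_rfl])) ?_
    rintro s' rfl - -
    refine exec_inc trivial fun l hl => ?_
    by_cases h' : l = n + 1
    · subst h'; simp
    · simp [h', h l (by omega)]

/-- Clear the registers `b, …, b + n - 1`. -/
def clearCmd (b : ℕ) : ℕ → Cmd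
  | 0 => .skip
  | n + 1 => .seq (clearCmd b n) (.zero (b + n))

theorem clearCmd_writes {n k : ℕ} (h : (clearCmd b n).Writes k) : b ≤ k := by
  induction n with
  | zero => exact h.elim
  | succ n ih =>
    rcases h with h | h
    · exact ih h
    · simp only [Cmd.Writes] at h; omega

theorem exec_clearCmd (hα : IsSuccLimit α) (hr : ∀ i, r i < α) (n : ℕ) :
    Exec α (clearCmd b n) 0 r (fun _ => True) (fun s => ∀ i < n, s (b + i) = 0) := by
  induction n with
  | zero => exact exec_skip (by simp)
  | succ n ih =>
    refine exec_seq hα hr ih fun s h hs _ => exec_zero trivial fun i hi => ?_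
    by_cases h' : i = n
    · subst h'; simp
    · simp [h', h i (by omega)]

/-- Prepare a simulation of `P` with empty input. -/
def simSetup (P : Program) (b m : ℕ) : Cmd :=
  .seq (constCmd (b + 1) P.code.length) (.seq (clearCmd (simReg P b 0) m) (.zero b))

theorem simSetup_writes {k : ℕ} (h : (simSetup P b m).Writes k) : b ≤ k := by
  rcases h with h | h | h
  · have := constCmd_writes h; omega
  · have := clearCmd_writes h; unfold simReg at this; omega
  · simp only [Cmd.Writes] at h; omega

theorem exec_simSetup (hα : IsSuccLimit α) (hr : ∀ i, r i < α) :
    Exec α (simSetup P b m) 0 r (fun _ => True)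
      (fun s => HasConsts P b s ∧ Represents P b m (initial []) s) := by
  refine exec_seq hα hr (exec_constCmd hα hr _) fun s1 h1 hs1 _ => ?_
  refine exec_seq hα hs1 (exec_clearCmd hα hs1 m) fun s2 h2 hs2 f2 => ?_
  have hc : HasConsts P b s2 := fun l hl => by
    rw [f2 _ fun h => ?_, h1 l hl]
    have := clearCmd_writes h
    unfold simReg at this; omega
  refine exec_zero trivial ⟨fun l hl => ?_, ?_, fun i hi => ?_⟩
  · rw [Function.update_of_ne (by omega), hc l hl]
  · simp [initial]
  · rw [Function.update_of_ne (by unfold simReg; omega)]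
    simpa [initial, simReg] using h2 i hi

/-- Run the program `P` on the contents of `x` and `y` and put its output into register `z`. -/
def callCmd (P : Program) (b m x y z : ℕ) : Cmd :=
  .seq (simSetup P b m) (.seq (.copy x (simReg P b 0)) (.seq (.copy y (simReg P b 1))
    (.seq (.loop (.not (.eq b (b + 1 + P.code.length))) (simStep P b)) (.copy (simReg P b 0) z))))

theorem callCmd_writes (hm : ∀ I ∈ P.code, I.RegsLt m) {x y z k : ℕ}
    (h : (callCmd P b m x y z).Writes k) : b ≤ k ∨ k = z := by
  rcases h with h | h | h | h | h
  · exact .inl (simSetup_writes h)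
  · simp only [Cmd.Writes, simReg] at h; omega
  · simp only [Cmd.Writes, simReg] at h; omega
  · rcases simStep_writes hm h with rfl | ⟨i, -, rfl⟩
    · exact .inl le_rfl
    · unfold simReg; omega
  · exact .inr h

theorem not_simStep_writes_const (hm : ∀ I ∈ P.code, I.RegsLt m) {l : ℕ} (hl : l ≤ P.code.length) :
    ¬ (simStep P b).Writes (b + 1 + l) := fun h => by
  rcases simStep_writes hm h with h | ⟨i, -, h⟩
  · omega
  · unfold simReg at h; omega

theorem exec_callCmd (hα : IsSuccLimit α) (hr : ∀ i, r i < α) (hm : ∀ I ∈ P.code, I.RegsLt m)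
    (hm2 : 2 ≤ m) {x y z : ℕ} (hx : x < b) (hy : y < b) {ρ : Ordinal.{u}}
    (h : P.Outputs α [r x, r y] ρ) :
    Exec α (callCmd P b m x y z) 0 r (fun _ => True) (fun s => s z = ρ) := by
  obtain ⟨γ, hγ, hρ⟩ := h
  refine exec_seq hα hr (exec_simSetup hα hr) fun s1 h1 hs1 f1 => ?_
  have hlt : ∀ k < b, s1 k = r k := fun k hk => f1 k fun h => by
    have := simSetup_writes h; omega
  refine exec_seq hα hs1 (exec_copy trivial
    (Q := fun s => s = Function.update s1 (simReg P b 0) (r x)) (by rw [hlt x hx])) ?_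
  rintro s2 rfl hs2 -
  refine exec_seq hα hs2 (exec_copy trivial (Q := fun s => s = Function.update
    (Function.update s1 (simReg P b 0) (r x)) (simReg P b 1) (r y)) ?_) ?_
  · rw [Function.update_of_ne (by unfold simReg; omega), hlt y hy]
  rintro s3 rfl hs3 -
  obtain ⟨hc, h1, h2⟩ := h1
  refine exec_seq hα hs3 (exec_simLoop hα hs3 hγ (m := m)
    (fun l hl => not_simStep_writes_const hm hl)
    Empty.elim (fun _ => Empty.elim) (fun _ _ _ => Empty.rec) ⟨?_, fun i hi => ?_⟩
    (fun l hl => ?_) Empty.rec ?_) ?_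
  · rw [Function.update_of_ne (by unfold simReg; omega),
      Function.update_of_ne (by unfold simReg; omega), h1]
    rfl
  · match i with
    | 0 =>
      rw [Function.update_of_ne (by unfold simReg; omega), Function.update_self]
      rfl
    | 1 => rw [Function.update_self]; rfl
    | i + 2 =>
      rw [Function.update_of_ne (by unfold simReg; omega),
        Function.update_of_ne (by unfold simReg; omega), h2 _ hi]
      rfl
  · rw [Function.update_of_ne (by unfold simReg; omega),
      Function.update_of_ne (by unfold simReg; omega), hc l hl]
  · intro θ hθ s hs _ hcs hrs _
    rw [config_add_one]
    exact (exec_simStep hα hs hm (hγ.line_lt hθ) hrs hcs).mono le_rfl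
      (fun s' h => ⟨h, Empty.rec⟩) (fun s' h => ⟨h, Empty.rec⟩)
  · rintro s ⟨h, -⟩ hs -
    refine exec_copy trivial ?_
    rw [Function.update_self, h.2 0 (by omega), hρ]

end Call

/-! ### Counting occurrences -/

open Classical in
/-- The order type of the set of ordinals below `τ` that satisfy `p`. -/
noncomputable def count (p : Ordinal.{u} → Prop) (τ : Ordinal.{u}) : Ordinal.{u} :=
  Ordinal.limitRecOn τ 0 (fun σ x => if p σ then x + 1 else x)
    (fun lam _ f => ⨆ η : Iio lam, f η.1 η.2)

section Count

variable {p : Ordinal.{u} → Prop} {σ τ lam x : Ordinal.{u}}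

@[simp] theorem count_zero : count p 0 = 0 := Ordinal.limitRecOn_zero ..

theorem count_add_one_of_pos (h : p σ) : count p (σ + 1) = count p σ + 1 := by
  simp [count, h]

theorem count_add_one_of_neg (h : ¬ p σ) : count p (σ + 1) = count p σ := by
  simp [count, h]

theorem count_limit (h : IsSuccLimit lam) : count p lam = ⨆ η : Iio lam, count p η.1 :=
  Ordinal.limitRecOn_limit _ _ _ _ h

theorem count_limit_le_iff (h : IsSuccLimit lam) :
    count p lam ≤ x ↔ ∀ η < lam, count p η ≤ x := by
  rw [count_limit h, Ordinal.iSup_le_iff]; simp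

theorem count_mono (h : σ ≤ τ) : count p σ ≤ count p τ := by
  induction τ using Ordinal.limitRecOn with
  | zero => rw [le_bot_iff.1 h]; rfl
  | add_one τ ih =>
    rcases h.lt_or_eq with h | rfl
    · refine (ih (Order.lt_add_one_iff.1 h)).trans ?_
      by_cases hp : p τ
      · rw [count_add_one_of_pos hp]; exact le_self_add
      · rw [count_add_one_of_neg hp]
    · rfl
  | limit lam hlam ih =>
    rcases h.lt_or_eq with h | rfl
    · exact (count_limit_le_iff hlam).1 le_rfl σ h
    · rfl

theorem count_lt (h : σ < τ) (hp : p σ) : count p σ + 1 ≤ count p τ := by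
  rw [← count_add_one_of_pos hp]
  exact count_mono (Order.add_one_le_of_lt h)

/-- Together with `count_lt` this characterises the count as the least ordinal above the counts at
all earlier occurrences. -/
theorem count_le (h : ∀ σ < τ, p σ → count p σ + 1 ≤ x) : count p τ ≤ x := by
  induction τ using Ordinal.limitRecOn with
  | zero => simp
  | add_one τ ih =>
    by_cases hp : p τ
    · rw [count_add_one_of_pos hp]; exact h τ (lt_add_one τ) hp
    · rw [count_add_one_of_neg hp]; exact ih fun σ hσ => h σ (hσ.trans (lt_add_one τ))
  | limit lam hlam ih =>
    exact (count_limit_le_iff hlam).2 fun η hη => ih η hη fun σ hσ => h σ (hσ.trans hη)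

theorem isLimInf_count (h : IsSuccLimit lam) : IsLimInf (count p) lam (count p lam) := by
  refine isLimInf_of_monotone (fun η σ h _ => count_mono h) (fun σ h => count_mono h.le)
    fun b hb => ?_
  by_contra hne
  simp only [not_exists, not_and, not_lt] at hne
  exact hb.not_ge ((count_limit_le_iff h).2 hne)

theorem count_congr {q : Ordinal.{u} → Prop} (h : ∀ σ < τ, p σ ↔ q σ) : count p τ = count q τ := by
  induction τ using Ordinal.limitRecOn with
  | zero => simp
  | add_one τ ih =>
    have h1 := ih fun σ hσ => h σ (hσ.trans (lt_add_one τ))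
    by_cases hp : p τ
    · rw [count_add_one_of_pos hp, count_add_one_of_pos ((h τ (lt_add_one τ)).1 hp), h1]
    · rw [count_add_one_of_neg hp, count_add_one_of_neg (mt (h τ (lt_add_one τ)).2 hp), h1]
  | limit lam hlam ih =>
    rw [count_limit hlam, count_limit hlam]
    exact congrArg _ (funext fun η => ih η.1 η.2 fun σ hσ => h σ (hσ.trans η.2))

end Count

/-! ### Repetitions in halting computations -/

section Repeat

variable {P : Program} {α : Ordinal.{u}} {C : Config.{u}} {δ γ : Ordinal.{u}}
  {v : List Ordinal.{u}}

theorem run_of_halted (hC : P.Halted C) (hr : ∀ i, C.reg i < α) (τ : Ordinal.{u}) :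
    P.run α C τ = C := by
  induction τ using Ordinal.limitRecOn with
  | zero => simp
  | add_one τ ih =>
    rw [run_add_one, ih]
    unfold Program.step
    rw [List.getElem?_eq_none hC]
  | limit lam hlam ih =>
    ext1
    · exact run_limit_line P α C hlam
        (isLimInf_of_eventually_eq hlam.bot_lt fun σ _ h => by rw [ih σ h])
    · funext i
      rw [run_limit_reg P α C hlam (l := C.reg i)
        (isLimInf_of_eventually_eq hlam.bot_lt fun σ _ h => by rw [ih σ h]), reset_of_lt (hr i)]

theorem Program.HaltsIn.halted_iff (h : P.HaltsIn α v γ) (hα : IsSuccLimit α)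
    (hv : ∀ x ∈ v, x < α) {τ : Ordinal.{u}} : P.Halted (P.config α v τ) ↔ γ < τ := by
  refine ⟨fun hh => not_le.1 fun hle => h.2 τ hle hh, fun hlt => ?_⟩
  have := Order.add_one_le_of_lt hlt
  obtain ⟨ε, rfl⟩ := exists_add_of_le this
  rw [config_eq_run, run_add, run_of_halted (by simpa [config_eq_run] using h.1)]
  · exact h.1
  · exact run_lt hα (initial_reg_lt hα.bot_lt hv) _

theorem run_mul_natCast (h : P.run α C δ = C) (n : ℕ) : P.run α C (δ * n) = C := by
  induction n with
  | zero => simp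
  | succ n ih => rw [Nat.cast_succ, mul_add, mul_one, run_add, ih, h]

theorem exists_natCast_of_lt_mul_omega0 {σ : Ordinal.{u}} (h : σ < δ * Ordinal.omega0) :
    ∃ n : ℕ, σ < δ * n := by
  obtain ⟨c, hc, h⟩ := (Ordinal.lt_mul_iff_of_isSuccLimit Ordinal.isSuccLimit_omega0).1 h
  obtain ⟨n, rfl⟩ := Ordinal.lt_omega0.1 hc
  exact ⟨n, h⟩

/-- `C` recurs cofinally, so the inferior limit is at most `f C`. Every value taken in one cycle is
also taken cofinally, so equality means that `f C` is minimal in the cycle. -/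
theorem isLimInf_mul_omega0 {X : Type*} [LinearOrder X] [WellFoundedLT X] (f : Config.{u} → X)
    (hδ : 0 < δ) (h : P.run α C δ = C) :
    ∃ l ≤ f C, IsLimInf (fun σ => f (P.run α C σ)) (δ * Ordinal.omega0) l ∧
      (l = f C → ∀ σ < δ, f C ≤ f (P.run α C σ)) := by
  have hlt : ∀ n : ℕ, δ * n < δ * Ordinal.omega0 := fun n =>
    (mul_lt_mul_iff_right₀ hδ).2 (Ordinal.natCast_lt_omega0 n)
  obtain ⟨l, h1, h2⟩ := exists_isLimInf (f := fun σ => f (P.run α C σ))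
    (lam := δ * Ordinal.omega0) (b := f C) fun η hη => by
      obtain ⟨n, hn⟩ := exists_natCast_of_lt_mul_omega0 hη
      exact ⟨_, hn.le, hlt n, by rw [run_mul_natCast h]⟩
  refine ⟨l, h1, h2, fun hl σ hσ => le_of_forall_lt fun b hb => ?_⟩
  obtain ⟨η, hη, H⟩ := h2.1 b (hl ▸ hb)
  obtain ⟨n, hn⟩ := exists_natCast_of_lt_mul_omega0 hη
  have := H (δ * n + σ) (hn.le.trans le_self_add) ?_
  · simpa only [run_add, run_mul_natCast h] using this
  · refine lt_of_lt_of_le ?_ (hlt (n + 1)).le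
    rw [Nat.cast_succ, mul_add, mul_one]; gcongr

/-- If `C` is minimal in its cycle, in the line and in each register, then the inferior limit of
repeated cycles is again `C`, and the cycle goes on forever. -/
theorem run_mul_of_le (hα : ∀ i, C.reg i < α) (hδ : 0 < δ) (h : P.run α C δ = C)
    (hl : ∀ σ < δ, C.line ≤ (P.run α C σ).line)
    (hr : ∀ i, ∀ σ < δ, C.reg i ≤ (P.run α C σ).reg i) (θ : Ordinal.{u}) :
    P.run α C (δ * θ) = C := by
  induction θ using Ordinal.limitRecOn with
  | zero => simp
  | add_one θ ih => rw [mul_add, mul_one, run_add, ih, h]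
  | limit lam hlam ih =>
    have hn := Ordinal.isNormal_mul_right hδ
    have hmod : ∀ σ < δ * lam, ∃ ρ < δ, P.run α C σ = P.run α C ρ := fun σ hσ => by
      refine ⟨σ % δ, Ordinal.mod_lt _ hδ.ne', ?_⟩
      conv_lhs => rw [← Ordinal.div_add_mod σ δ, run_add]
      rw [ih]
      exact (Ordinal.lt_mul_iff_div_lt hδ.ne').1 hσ
    have hcof : ∀ η < δ * lam, ∃ σ, η ≤ σ ∧ σ < δ * lam ∧ P.run α C σ = C := fun η hη => by
      obtain ⟨ξ, h1, h2⟩ := (hn.lt_iff_exists_lt hlam).1 hη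
      exact ⟨_, h2.le, hn.strictMono h1, ih ξ h1⟩
    ext1
    · refine run_limit_line P α C (hn.map_isSuccLimit hlam) ⟨fun b hb => ⟨0, ?_, fun σ _ h => ?_⟩,
        fun η hη => ?_⟩
      · exact (hn.map_isSuccLimit hlam).bot_lt
      · obtain ⟨ρ, h1, h2⟩ := hmod σ h
        simpa only [h2] using hb.trans_le (hl ρ h1)
      · obtain ⟨σ, h1, h2, h3⟩ := hcof η hη
        exact ⟨σ, h1, h2, by simp only [h3, le_refl]⟩
    · funext i
      rw [run_limit_reg P α C (hn.map_isSuccLimit hlam) (l := C.reg i), reset_of_lt (hα i)]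
      refine ⟨fun b hb => ⟨0, (hn.map_isSuccLimit hlam).bot_lt, fun σ _ h => ?_⟩, fun η hη => ?_⟩
      · obtain ⟨ρ, h1, h2⟩ := hmod σ h
        simpa only [h2] using hb.trans_le (hr i ρ h1)
      · obtain ⟨σ, h1, h2, h3⟩ := hcof η hη
        exact ⟨σ, h1, h2, by simp only [h3, le_refl]⟩

/-- If a configuration of a halting computation is repeated, then its `ω` repetitions lead to a
strictly smaller configuration. -/
theorem Program.HaltsIn.run_mul_omega0 (h : P.HaltsIn α v γ) (hα : IsSuccLimit α)
    (hv : ∀ x ∈ v, x < α) {σ : Ordinal.{u}} (hσ : σ ≤ γ) (hC : P.config α v σ = C) (hδ : 0 < δ)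
    (hδC : P.run α C δ = C) :
    (P.run α C (δ * Ordinal.omega0)).line ≤ C.line ∧
      (∀ i, (P.run α C (δ * Ordinal.omega0)).reg i ≤ C.reg i) ∧
      P.run α C (δ * Ordinal.omega0) ≠ C := by
  have hlim : IsSuccLimit (δ * Ordinal.omega0) :=
    (Ordinal.isNormal_mul_right hδ).map_isSuccLimit Ordinal.isSuccLimit_omega0
  have hr : ∀ i, C.reg i < α := fun i => hC ▸ run_lt hα (initial_reg_lt hα.bot_lt hv) σ i
  obtain ⟨l, h1, h2, h3⟩ := isLimInf_mul_omega0 (P := P) (α := α) Config.line hδ hδC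
  have hline := run_limit_line P α C hlim h2
  have hreg : ∀ i, ∃ l ≤ C.reg i, (P.run α C (δ * Ordinal.omega0)).reg i = l ∧
      (l = C.reg i → ∀ σ < δ, C.reg i ≤ (P.run α C σ).reg i) := fun i => by
    obtain ⟨l, h1, h2, h3⟩ := isLimInf_mul_omega0 (P := P) (α := α) (fun C => C.reg i) hδ hδC
    refine ⟨l, h1, ?_, h3⟩
    rw [run_limit_reg P α C hlim h2, reset_of_lt (h1.trans_lt (hr i))]
  refine ⟨hline.trans_le h1, fun i => ?_, fun heq => ?_⟩
  · obtain ⟨l, k1, k2, -⟩ := hreg i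
    exact k2.trans_le k1
  · rw [heq] at hline
    have key := run_mul_of_le hr hδ hδC (h3 hline.symm) (fun i => by
      obtain ⟨l, -, k2, k3⟩ := hreg i
      rw [heq] at k2
      exact k3 k2.symm) (γ + 1)
    have h4 : P.config α v (σ + δ * (γ + 1)) = C := by
      rw [config_eq_run, run_add, ← config_eq_run, hC, key]
    have h5 : γ < σ + δ * (γ + 1) := by
      refine (lt_add_one γ).trans_le (le_trans ?_ le_add_self)
      exact Ordinal.le_mul_right _ hδ
    have h6 := (h.halted_iff hα hv).2 h5
    rw [h4, ← hC, h.halted_iff hα hv] at h6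
    exact h6.not_ge hσ

theorem Program.noWrite_of_regsLt {m : ℕ} (hm : ∀ I ∈ P.code, I.RegsLt m) {i : ℕ} (hi : m ≤ i)
    (lo hi' : ℕ) : P.NoWrite lo hi' i := by
  intro l _ _ I hI hw
  have := hm I (List.mem_of_getElem? hI)
  cases I with
  | zero j => simp only [Instr.Writes, Instr.RegsLt] at *; omega
  | inc j => simp only [Instr.Writes, Instr.RegsLt] at *; omega
  | copy j k => simp only [Instr.Writes, Instr.RegsLt] at *; omega
  | jump φ l => exact hw

theorem Program.HaltsIn.config_reg_of_le (h : P.HaltsIn α v γ) (hα : IsSuccLimit α)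
    (hv : ∀ x ∈ v, x < α) {m : ℕ} (hm : ∀ I ∈ P.code, I.RegsLt m) {i : ℕ} (hi : m ≤ i)
    {σ : Ordinal.{u}} (hσ : σ ≤ γ) : (P.config α v σ).reg i = (initial v).reg i :=
  run_reg_of_noWrite (P.noWrite_of_regsLt hm hi 0 P.code.length)
    (initial_reg_lt hα.bot_lt hv i)
    (fun _ hτ => ⟨Nat.zero_le _, h.line_lt hτ.le⟩) hσ

/-- Let `δ` be the least return time of `C` and `D` the configuration after `ω` cycles. After each
occurrence `C` recurs `δ` steps later and never sooner, so its occurrences form runs of length `ω`,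
and each run is followed by an occurrence of `D`. Hence `C` is counted at most `ω` times (the count
of `D` plus one), where `D` is pointwise below `C` and different from it by
`Program.HaltsIn.run_mul_omega0`. Induction applies, as `ω ^ ω` is closed under sums and products.
-/
theorem count_config_lt (h : P.HaltsIn α v γ) (hα : IsSuccLimit α) (hv : ∀ x ∈ v, x < α)
    {σ₀ : Ordinal.{u}} (hσ₀ : σ₀ ≤ γ) (τ : Ordinal.{u}) :
    count (fun σ => P.config α v σ = P.config α v σ₀) τ <
      Ordinal.omega0 ^ (Ordinal.omega0 : Ordinal.{u}) := by
  obtain ⟨m, -, hm⟩ := P.exists_regsLt 0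
  have hωω : Ordinal.omega0 < Ordinal.omega0 ^ (Ordinal.omega0 : Ordinal.{u}) := by
    conv_lhs => rw [← Ordinal.opow_one Ordinal.omega0]
    exact (Ordinal.opow_lt_opow_iff_right Ordinal.one_lt_omega0).2 Ordinal.one_lt_omega0
  -- Only the registers below `m` can change; with a finite index set the pointwise order is
  -- well-founded.
  let key : Config.{u} → Option (Fin m) → Ordinal.{u} := fun C j =>
    j.elim (C.line : Ordinal.{u}) fun i => C.reg i
  induction hk : key (P.config α v σ₀) using WellFoundedLT.induction generalizing σ₀ τ with
  | _ k ih =>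
  subst hk
  set C := P.config α v σ₀ with hC
  set K := count (fun σ => P.config α v σ = C) with hK
  have hocc : ∀ σ, P.config α v σ = C → σ ≤ γ := fun σ hσ => by
    by_contra hlt
    have := (h.halted_iff hα hv).2 (not_le.1 hlt)
    rw [hσ, hC, h.halted_iff hα hv] at this
    exact this.not_ge hσ₀
  have hdiff : ∀ σ σ', σ < σ' → P.config α v σ = C → P.config α v σ' = C →
      ∃ ε, 0 < ε ∧ σ' = σ + ε ∧ P.run α C ε = C := by
    intro σ σ' hlt h1 h2
    obtain ⟨ε, rfl⟩ := exists_add_of_le hlt.le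
    refine ⟨ε, ?_, rfl, ?_⟩
    · by_contra h0
      have : ε = 0 := by simpa using h0
      simp [this] at hlt
    · rwa [config_eq_run, run_add, ← config_eq_run, h1] at h2
  by_cases hex : ∃ δ, 0 < δ ∧ P.run α C δ = C
  · let S := {δ | 0 < δ ∧ P.run α C δ = C}
    set δ := sInf S with hδ
    obtain ⟨hδ0, hδC⟩ : δ ∈ S := csInf_mem hex
    have hmin : ∀ ε, 0 < ε → P.run α C ε = C → δ ≤ ε := fun ε h1 h2 => csInf_le' ⟨h1, h2⟩
    obtain ⟨m1, m2, m3⟩ := h.run_mul_omega0 hα hv hσ₀ hC.symm hδ0 hδC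
    have hnext : ∀ σ, P.config α v σ = C → ∀ n : ℕ, P.config α v (σ + δ * n) = C :=
      fun σ hσ n => by rw [config_eq_run, run_add, ← config_eq_run, hσ, run_mul_natCast hδC]
    have hω : ∀ σ x, (∀ n : ℕ, σ + δ * n ≤ x) → σ + δ * Ordinal.omega0 ≤ x := fun σ x hx => by
      refine le_of_forall_lt fun c hc => ?_
      rcases lt_or_ge c σ with h1 | h1
      · exact h1.trans_le (by simpa using hx 0)
      · obtain ⟨n, hn⟩ := exists_natCast_of_lt_mul_omega0 ((Ordinal.sub_lt_of_le h1).2 hc)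
        exact ((Ordinal.sub_lt_of_le h1).1 hn).trans_le (hx n)
    have hC' : ∀ σ, P.config α v σ = C →
        P.config α v (σ + δ * Ordinal.omega0) = P.run α C (δ * Ordinal.omega0) := fun σ hσ => by
      rw [config_eq_run, run_add, ← config_eq_run, hσ]
    have hσω : σ₀ + δ * Ordinal.omega0 ≤ γ := hω _ _ fun n => hocc _ (hnext _ hC.symm n)
    have hkey : key (P.run α C (δ * Ordinal.omega0)) < key C := by
      refine lt_of_le_of_ne (fun j => ?_) fun heq => m3 ?_
      · cases j with
        | none => exact Nat.cast_le.2 m1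
        | some i => exact m2 i
      · ext1
        · exact Nat.cast_injective (congrFun heq none)
        · funext i
          by_cases hi : i < m
          · exact congrFun heq (some ⟨i, hi⟩)
          · rw [← hC' σ₀ hC.symm, hC, h.config_reg_of_le hα hv hm (not_lt.1 hi) hσω,
              h.config_reg_of_le hα hv hm (not_lt.1 hi) hσ₀]
    have hκ := fun τ => ih _ hkey (τ := τ) hσω (by rw [hC' σ₀ hC.symm])
    rw [hC' σ₀ hC.symm] at hκ
    set κ := count (fun σ => P.config α v σ = P.run α C (δ * Ordinal.omega0)) with hκdef
    have main : ∀ τ, P.config α v τ = C → ∃ n : ℕ, K τ ≤ Ordinal.omega0 * κ τ + n := by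
      intro τ
      induction τ using WellFoundedLT.induction with
      | _ τ ih' =>
      intro hτ
      -- Either `τ` continues a run, which adds one to the count, or each earlier occurrence has the
      -- rest of its run, and the limit configuration after it, before `τ`.
      by_cases hpred : ∃ σ, P.config α v σ = C ∧ τ = σ + δ
      · obtain ⟨σ, h1, rfl⟩ := hpred
        have hlt : σ < σ + δ := lt_add_of_pos_right σ hδ0
        obtain ⟨n, hn⟩ := ih' σ hlt h1
        have hle : K (σ + δ) ≤ K σ + 1 := count_le fun σ' h2 h3 => by
          have hle' : σ' ≤ σ := by
            by_contra hlt'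
            obtain ⟨ε, e1, rfl, e2⟩ := hdiff σ σ' (not_le.1 hlt') h1 h3
            exact ((add_lt_add_iff_left σ).1 h2).not_ge (hmin ε e1 e2)
          exact add_le_add_left (count_mono hle') 1
        refine ⟨n + 1, hle.trans ?_⟩
        rw [Nat.cast_succ, ← add_assoc]
        refine add_le_add_left (hn.trans ?_) 1
        gcongr
        exact count_mono hlt.le
      · refine ⟨0, ?_⟩
        rw [Nat.cast_zero, add_zero]
        refine count_le fun σ h1 h2 => ?_
        obtain ⟨n, hn⟩ := ih' σ h1 h2
        have hlt : ∀ n : ℕ, σ + δ * n < τ := by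
          intro n
          induction n with
          | zero => simpa using h1
          | succ n ihn =>
            obtain ⟨ε, e1, e2, e3⟩ := hdiff _ τ ihn (hnext σ h2 n) hτ
            rw [Nat.cast_succ, mul_add, mul_one, ← add_assoc]
            refine lt_of_le_of_ne ?_ fun heq => hpred ⟨_, hnext σ h2 n, heq.symm⟩
            rw [e2]
            gcongr
            exact hmin ε e1 e3
        have hlt' : σ + δ * Ordinal.omega0 < τ := by
          refine lt_of_le_of_ne (hω σ τ fun n => (hlt n).le) fun heq => m3 ?_
          rw [← hC' σ h2, heq, hτ]
        have hκ1 : κ σ + 1 ≤ κ τ :=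
          (add_le_add_left (count_mono le_self_add) 1).trans (count_lt hlt' (hC' σ h2))
        calc K σ + 1 ≤ Ordinal.omega0 * κ σ + n + 1 := add_le_add_left hn 1
          _ ≤ Ordinal.omega0 * κ σ + Ordinal.omega0 := by
            rw [add_assoc]
            gcongr
            exact_mod_cast (Ordinal.natCast_lt_omega0 (n + 1)).le
          _ = Ordinal.omega0 * (κ σ + 1) := by rw [mul_add, mul_one]
          _ ≤ Ordinal.omega0 * κ τ := by gcongr
    have hbound : K τ ≤ Ordinal.omega0 * (κ τ + 1) := count_le fun σ h1 h2 => by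
      obtain ⟨n, hn⟩ := main σ h2
      calc K σ + 1 ≤ Ordinal.omega0 * κ σ + n + 1 := add_le_add_left hn 1
        _ ≤ Ordinal.omega0 * κ τ + Ordinal.omega0 := by
          rw [add_assoc]
          refine add_le_add (mul_le_mul_right (count_mono h1.le) _) ?_
          exact_mod_cast (Ordinal.natCast_lt_omega0 (n + 1)).le
        _ = Ordinal.omega0 * (κ τ + 1) := by rw [mul_add, mul_one]
    refine hbound.trans_lt ?_
    have hmul := Ordinal.isPrincipal_mul_omega0_opow_opow (1 : Ordinal.{u})
    rw [Ordinal.opow_one] at hmul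
    refine hmul hωω ?_
    exact (Ordinal.isPrincipal_add_omega0_opow Ordinal.omega0) (hκ τ)
      (Ordinal.one_lt_omega0.trans hωω)
  · have : K τ ≤ 1 := count_le fun σ h1 h2 => by
      have h0 : K σ ≤ 0 := count_le fun σ' h3 h4 => by
        obtain ⟨ε, e1, -, e2⟩ := hdiff σ' σ h3 h4 h2
        exact (hex ⟨ε, e1, e2⟩).elim
      have : K σ = 0 := le_bot_iff.1 h0
      rw [← hK, this, zero_add]
    exact this.trans_lt (Ordinal.one_lt_omega0.trans hωω)

end Repeat

/-! ### Codes of finite sequences -/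

/-- The entry number `j` of the sequence coded by `e`. -/
noncomputable def entry (e : Ordinal.{u}) (j : ℕ) : Ordinal.{u} :=
  (unpair ((fun x => (unpair x).2)^[j] e)).1

theorem entry_zero (e : Ordinal.{u}) : entry e 0 = (unpair e).1 := rfl

theorem entry_succ (e : Ordinal.{u}) (j : ℕ) : entry e (j + 1) = entry (unpair e).2 j := rfl

theorem exists_entry_eq {α : Ordinal.{u}} (h : ExponentiallyClosed α) (n : ℕ)
    (x : ℕ → Ordinal.{u}) (hx : ∀ j < n, x j < α) : ∃ e < α, ∀ j < n, entry e j = x j := by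
  induction n generalizing x with
  | zero => exact ⟨0, h.isSuccLimit.bot_lt, by simp⟩
  | succ n ih =>
    obtain ⟨e, he, H⟩ := ih (fun j => x (j + 1)) fun j hj => hx _ (by omega)
    refine ⟨pair (x 0, e), pair_lt h (hx 0 (by omega)) he, fun j hj => ?_⟩
    cases j with
    | zero => simp [entry_zero]
    | succ j => simpa [entry_succ] using H j (by omega)

/-- Decode the first `n` entries of the sequence coded in register `z` into the registers from `b`
on. -/
def decodeCmd (z b : ℕ) : ℕ → Cmd
  | 0 => .skip
  | n + 1 => .seq (decodeCmd z b n) (unpairCmd z (b + n) z)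

theorem decodeCmd_writes {z b n k : ℕ} (h : (decodeCmd z b n).Writes k) :
    (3 ≤ k ∧ k ≤ 6) ∨ k = z ∨ (b ≤ k ∧ k < b + n) := by
  induction n with
  | zero => exact h.elim
  | succ n ih =>
    rcases h with h | h
    · have := ih h; omega
    · rw [unpairCmd_writes] at h; omega

theorem exec_decodeCmd {α : Ordinal.{u}} (h : ExponentiallyClosed α) {r : ℕ → Ordinal.{u}}
    (hr : ∀ i, r i < α) {z b : ℕ} (hz : z < 3 ∨ 6 < z) (hzb : z < b) (hb : 6 < b) (n : ℕ) :
    Exec α (decodeCmd z b n) 0 r (fun _ => True)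
      (fun s => ∀ j < n, s (b + j) = entry (r z) j) := by
  -- The induction also has to know that register `z` holds the tail not yet decoded.
  suffices H : Exec α (decodeCmd z b n) 0 r (fun _ => True)
      (fun s => (∀ j < n, s (b + j) = entry (r z) j) ∧
        s z = (fun x => (unpair x).2)^[n] (r z)) from H.imp fun _ h => h.1
  induction n with
  | zero => exact exec_skip (by simp)
  | succ n ih =>
    refine exec_seq h.isSuccLimit hr ih fun s hs hs' _ => ?_
    refine ((exec_unpairCmd h hs' hz (by omega) (by omega)).frame h.isSuccLimit hs').mono le_rfl
      (fun _ _ => trivial) ?_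
    rintro s' ⟨⟨h1, h2⟩, -, f⟩
    refine ⟨fun j hj => ?_, ?_⟩
    · rcases Nat.lt_succ_iff_lt_or_eq.1 hj with hj | rfl
      · rw [f _ (by rw [unpairCmd_writes]; omega), hs.1 j hj]
      · rw [h1, hs.2]; rfl
    · rw [h2, hs.2, Function.iterate_succ_apply']

/-! ### Clockable ordinals are computable -/

section Clock

/-- Registers `simReg P b i` and `t + 2 + i` agree for `i < n`. -/
def matchRegs (P : Program) (b t : ℕ) : ℕ → Cond
  | 0 => .eq 0 0
  | n + 1 => .and (matchRegs P b t n) (.eq (simReg P b n) (t + 2 + n))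

theorem matchRegs_holds {P : Program} {b t n : ℕ} {r : ℕ → Ordinal.{u}} :
    (matchRegs P b t n).Holds r ↔ ∀ i < n, r (simReg P b i) = r (t + 2 + i) := by
  induction n with
  | zero => simp [matchRegs, Cond.Holds]
  | succ n ih =>
    simp only [matchRegs, Cond.Holds, ih, Nat.lt_succ_iff_lt_or_eq, or_imp, forall_and, forall_eq]

/-- The simulated configuration is the one described by the registers from `t` on. -/
def matchCond (P : Program) (b t m : ℕ) : Cond := .and (.eq b t) (matchRegs P b t m)

/-- If the simulated configuration is described by the registers from `t` on, then increase the
counter in register `k`, after performing `act` if the counter has the described value. -/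
def hook (P : Program) (b m t k : ℕ) (act : Cmd) : Cmd :=
  .ite (matchCond P b t m) (.seq (.ite (.eq k (t + 1)) act .skip) (.inc k)) .skip

open Classical in
-- Before the increment the counter shows the number of strictly earlier occurrences, so testing it
-- at that moment singles out the described time.
theorem exec_hook {P : Program} {b m t k : ℕ} {act : Cmd} {α : Ordinal.{u}} (hα : IsSuccLimit α)
    {r : ℕ → Ordinal.{u}} (hr : ∀ i, r i < α) {T : (ℕ → Ordinal.{u}) → Prop} {w : Ordinal.{u}}
    (hk : k ≠ 14)
    (hact : ∀ (T Q : (ℕ → Ordinal.{u}) → Prop), T r → Q (Function.update r 14 w) →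
      Exec α act 0 r T Q)
    (hT : ∀ s : ℕ → Ordinal.{u}, (∀ i, i ≠ 14 → i ≠ k → s i = r i) → (s k = r k ∨
      s k = if (matchCond P b t m).Holds r then r k + 1 else r k) → T s) :
    Exec α (hook P b m t k act) 0 r T (fun s => (∀ i, i ≠ 14 → i ≠ k → s i = r i) ∧
      s 14 = (if (matchCond P b t m).Holds r ∧ r k = r (t + 1) then w else r 14) ∧
      s k = if (matchCond P b t m).Holds r then r k + 1 else r k) := by
  have hTr : T r := hT r (fun _ _ _ => rfl) (.inl rfl)
  refine exec_ite hTr (fun hφ => ?_) (fun hφ => exec_skip (by simp [hφ]))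
    fun s hs => hT s hs.1 (.inr hs.2.2)
  have hT' : ∀ x, T (Function.update r 14 x) := fun x => hT _
    (fun i hi _ => by simp [hi]) (.inl (by simp [hk]))
  have hTu : T (Function.update r 14 (if r k = r (t + 1) then w else r 14)) := hT' _
  refine exec_seq hα hr (Q := fun s => s = Function.update r 14
    (if r k = r (t + 1) then w else r 14)) (exec_ite hTr (fun hψ => ?_) (fun hψ => ?_) ?_) ?_
  · exact hact _ _ hTr (by rw [if_pos (by simpa [Cond.Holds] using hψ)])
  · refine exec_skip ?_
    rw [if_neg (by simpa [Cond.Holds] using hψ), Function.update_eq_self]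
  · rintro s rfl; exact hTu
  · rintro s rfl - -
    refine exec_inc hTu ⟨fun i h1 h2 => by simp [h1, h2], ?_, ?_⟩
    · simp [hk.symm, hφ]
    · simp [hk, hφ]

variable (P : Program) (α : Ordinal.{u}) (v : List Ordinal.{u}) (m : ℕ)

/-- The configuration at time `σ` is described by `e`. -/
def Matches (e σ : Ordinal.{u}) : Prop :=
  ((P.config α v σ).line : Ordinal.{u}) = entry e 0 ∧
    ∀ i < m, (P.config α v σ).reg i = entry e (i + 2)

/-- The time described by `e` is `σ`. -/
def MatchesAt (e σ : Ordinal.{u}) : Prop :=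
  Matches P α v m e σ ∧ count (Matches P α v m e) σ = entry e 1

open Classical in
/-- Whether the time described by `b` has been reached before `θ`, but not the time described by
`a` since then. Times from `γ` on and time `0` are disregarded. -/
noncomputable def answer (γ a b θ : Ordinal.{u}) : Ordinal.{u} :=
  if ∃ τ < θ, τ < γ ∧ 0 < τ ∧ MatchesAt P α v m b τ ∧
    ∀ τ' < θ, τ' < γ → MatchesAt P α v m a τ' → τ' < τ then 1 else 0

variable {P α v m} {γ a b e θ σ τ : Ordinal.{u}}

/-- A later match has a strictly larger count. -/
theorem MatchesAt.unique (h : MatchesAt P α v m e σ) (h' : MatchesAt P α v m e τ) : σ = τ := by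
  by_contra hne
  rcases lt_or_gt_of_ne hne with hlt | hlt
  · have := count_lt hlt h.1
    rw [h.2, h'.2] at this
    exact (lt_add_one _).not_ge this
  · have := count_lt hlt h'.1
    rw [h.2, h'.2] at this
    exact (lt_add_one _).not_ge this

theorem answer_zero : answer P α v m γ a b 0 = 0 := by
  simp [answer]

open Classical in
-- This is the recursion carried out by the program. The test for `a` takes precedence: if `a` and
-- `b` describe the same time, then neither time is earlier and the answer is 0.
theorem answer_add_one (hθ : θ < γ) : answer P α v m γ a b (θ + 1) =
    if MatchesAt P α v m a θ then 0 else if MatchesAt P α v m b θ then (if θ = 0 then 0 else 1)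
    else answer P α v m γ a b θ := by
  have hlt : ∀ τ, τ < θ + 1 ↔ τ < θ ∨ τ = θ := fun τ => by
    rw [Order.lt_add_one_iff, le_iff_lt_or_eq]
  by_cases ha : MatchesAt P α v m a θ
  · rw [if_pos ha, answer, if_neg]
    rintro ⟨τ, h1, h2, h3, h4, h5⟩
    exact (h5 θ (lt_add_one θ) hθ ha).not_ge (Order.lt_add_one_iff.1 h1)
  · rw [if_neg ha]
    by_cases hb : MatchesAt P α v m b θ
    · rw [if_pos hb]
      by_cases h0 : θ = 0
      · rw [if_pos h0, answer, if_neg]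
        rintro ⟨τ, h1, h2, h3, h4, h5⟩
        exact h3.ne' ((h4.unique hb).trans h0)
      · rw [if_neg h0, answer, if_pos]
        refine ⟨θ, lt_add_one θ, hθ, pos_iff_ne_zero.2 h0, hb, fun τ' h1 h2 h3 => ?_⟩
        rcases (hlt τ').1 h1 with h | rfl
        · exact h
        · exact (ha h3).elim
    · rw [if_neg hb, answer, answer]
      congr 1
      simp only [hlt, eq_iff_iff]
      constructor
      · rintro ⟨τ, h1 | rfl, h2, h3, h4, h5⟩
        · exact ⟨τ, h1, h2, h3, h4, fun τ' h => h5 τ' (.inl h)⟩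
        · exact (hb h4).elim
      · rintro ⟨τ, h1, h2, h3, h4, h5⟩
        refine ⟨τ, .inl h1, h2, h3, h4, ?_⟩
        rintro τ' (h | rfl) h6 h7
        · exact h5 τ' h h6 h7
        · exact (ha h7).elim

theorem answer_add_one_self : answer P α v m γ a b (γ + 1) = answer P α v m γ a b γ := by
  rw [answer, answer]
  congr 1
  simp only [eq_iff_iff]
  constructor
  · rintro ⟨τ, h1, h2, h3, h4, h5⟩
    exact ⟨τ, h2, h2, h3, h4, fun τ' h h' => h5 τ' (h.trans (lt_add_one γ)) h'⟩
  · rintro ⟨τ, h1, h2, h3, h4, h5⟩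
    exact ⟨τ, h1.trans (lt_add_one γ), h2, h3, h4, fun τ' h h' => h5 τ' h' h'⟩

/-- Described times are unique, so the answer changes at most twice and is eventually constant below
a limit. -/
theorem isLimInf_answer {lam : Ordinal.{u}} (hlam : IsSuccLimit lam) :
    IsLimInf (answer P α v m γ a b) lam (answer P α v m γ a b lam) := by
  by_cases hb : ∃ τ < lam, τ < γ ∧ 0 < τ ∧ MatchesAt P α v m b τ
  · obtain ⟨τ, h1, h2, h3, h4⟩ := hb
    by_cases ha : ∃ τ' < lam, τ' < γ ∧ MatchesAt P α v m a τ' ∧ τ ≤ τ'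
    · obtain ⟨τ', k1, k2, k3, k4⟩ := ha
      have key : ∀ σ, τ' + 1 ≤ σ → answer P α v m γ a b σ = 0 := fun σ hσ => by
        rw [answer, if_neg]
        rintro ⟨ρ, l1, l2, l3, l4, l5⟩
        obtain rfl := l4.unique h4
        exact (l5 τ' (Order.add_one_le_iff.1 hσ) k2 k3).not_ge k4
      rw [key lam (hlam.succ_lt k1).le]
      exact isLimInf_of_eventually_eq (hlam.succ_lt k1) fun σ h _ => key σ h
    · have key : ∀ σ, τ + 1 ≤ σ → σ ≤ lam → answer P α v m γ a b σ = 1 := fun σ hσ hσ' => by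
        rw [answer, if_pos]
        refine ⟨τ, Order.add_one_le_iff.1 hσ, h2, h3, h4, fun τ' l1 l2 l3 => ?_⟩
        by_contra hle
        exact ha ⟨τ', l1.trans_le hσ', l2, l3, not_lt.1 hle⟩
      rw [key lam (hlam.succ_lt h1).le le_rfl]
      exact isLimInf_of_eventually_eq (hlam.succ_lt h1) fun σ h h' => key σ h h'.le
  · have key : ∀ σ ≤ lam, answer P α v m γ a b σ = 0 := fun σ hσ => by
      rw [answer, if_neg]
      rintro ⟨ρ, l1, l2, l3, l4, l5⟩
      exact hb ⟨ρ, l1.trans_le hσ, l2, l3, l4⟩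
    rw [key lam le_rfl]
    exact isLimInf_of_eventually_eq hlam.bot_lt fun σ _ h => key σ h.le

theorem answer_le_one : answer P α v m γ a b θ ≤ 1 := by
  unfold answer; split_ifs <;> simp

/-- If the description fits some configuration of the computation, then matching it is equality with
that configuration, as registers from `m` on keep their initial contents. Otherwise nothing is
counted. -/
theorem count_matches_lt (h : P.HaltsIn α v γ) (hα : IsSuccLimit α) (hv : ∀ x ∈ v, x < α)
    (hm : ∀ I ∈ P.code, I.RegsLt m) (hτ : τ ≤ γ + 1) :
    count (Matches P α v m e) τ < Ordinal.omega0 ^ (Ordinal.omega0 : Ordinal.{u}) := by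
  by_cases hex : ∃ σ ≤ γ, Matches P α v m e σ
  · obtain ⟨σ₀, h1, h2, h3⟩ := hex
    refine lt_of_le_of_lt (le_of_eq (count_congr fun σ hσ => ?_))
      (count_config_lt h hα hv h1 τ)
    have hσ' : σ ≤ γ := Order.lt_add_one_iff.1 (hσ.trans_le hτ)
    constructor
    · rintro ⟨k1, k2⟩
      ext1
      · exact Nat.cast_injective (k1.trans h2.symm)
      · funext i
        by_cases hi : i < m
        · rw [k2 i hi, h3 i hi]
        · rw [h.config_reg_of_le hα hv hm (not_lt.1 hi) hσ',
            h.config_reg_of_le hα hv hm (not_lt.1 hi) h1]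
    · intro heq
      rw [Matches, heq]
      exact ⟨h2, h3⟩
  · have : count (Matches P α v m e) τ ≤ 0 := count_le fun σ h1 h2 =>
      (hex ⟨σ, Order.lt_add_one_iff.1 (h1.trans_le hτ), h2⟩).elim
    exact this.trans_lt (Ordinal.opow_pos _ Ordinal.omega0_pos)

end Clock

/-! ### Deciding which of two described times is earlier -/

section ClockProgram

/-- The body of a loop that simulates `P`, counts the occurrences of the configurations described by
the registers from `20` and from `22 + m` on in the registers `9` and `10`, and keeps track of
`answer` in register `11`. -/
def clockBody (P : Program) (m : ℕ) : Cmd :=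
  .seq (.copy 11 14) (.seq (hook P (24 + 2 * m) m (22 + m) 10 (.copy 12 14))
    (.seq (hook P (24 + 2 * m) m 20 9 (.zero 14)) (.seq (simStep P (24 + 2 * m))
      (.seq (.ite (.eq (24 + 2 * m) (24 + 2 * m + 1 + P.code.length)) .skip (.copy 14 11))
        (.copy 13 12)))))

/-- A program that compares the times described by the components of its first input in the
computation of `P` on its second input. -/
def clockCmd (P : Program) (m : ℕ) : Cmd :=
  .seq (unpairCmd 0 7 8) (.seq (decodeCmd 7 20 (m + 2)) (.seq (decodeCmd 8 (22 + m) (m + 2))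
    (.seq (.inc 13) (.seq (simSetup P (24 + 2 * m) m) (.seq (.copy 1 (simReg P (24 + 2 * m) 0))
      (.seq (.loop (.not (.eq (24 + 2 * m) (24 + 2 * m + 1 + P.code.length))) (clockBody P m))
        (.copy 11 0)))))))

variable {P : Program} {α : Ordinal.{u}} {v : List Ordinal.{u}} {m : ℕ} {γ a b θ : Ordinal.{u}}
  {r : ℕ → Ordinal.{u}}

open Classical in
/-- The contents of the registers `9`, …, `12` before the simulation of step `θ`. -/
noncomputable def clockState (P : Program) (α : Ordinal.{u}) (v : List Ordinal.{u}) (m : ℕ)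
    (γ a b θ : Ordinal.{u}) : Fin 4 → Ordinal.{u} :=
  ![count (Matches P α v m a) θ, count (Matches P α v m b) θ, answer P α v m γ a b θ,
    if θ = 0 then 0 else 1]

theorem matchCond_holds {t c : ℕ} {e : Ordinal.{u}}
    (hline : (P.config α v θ).line < P.code.length)
    (h : Represents P c m (P.config α v θ) r) (ht : ∀ j < m + 2, r (t + j) = entry e j) :
    (matchCond P c t m).Holds r ↔ Matches P α v m e θ := by
  simp only [matchCond, Cond.Holds, matchRegs_holds, Matches]
  rw [h.1, min_eq_left hline.le]
  refine and_congr ?_ (forall₂_congr fun i hi => ?_)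
  · rw [← ht 0 (by omega)]; rfl
  · rw [h.2 i hi, ← ht (i + 2) (by omega), add_assoc, add_comm 2 i]

theorem hook_writes {c t k i : ℕ} {act : Cmd} (h : (hook P c m t k act).Writes i) :
    act.Writes i ∨ i = k := by
  simp only [hook, Cmd.Writes] at h; tauto

theorem clockBody_writes (hm : ∀ I ∈ P.code, I.RegsLt m) {i : ℕ} (h : (clockBody P m).Writes i) :
    (9 ≤ i ∧ i ≤ 14 ∧ i ≠ 13) ∨ i = 24 + 2 * m ∨ ∃ j < m, i = simReg P (24 + 2 * m) j := by
  simp only [clockBody, Cmd.Writes] at h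
  rcases h with h | h | h | h | h | h
  · omega
  · have := hook_writes h
    simp only [Cmd.Writes] at this; omega
  · have := hook_writes h
    simp only [Cmd.Writes] at this; omega
  · exact .inr (simStep_writes hm h)
  · simp only [false_or] at h; omega
  · omega

/-- The new answer is prepared in register 14 and moved to register 11 only after the simulated
step, since only then can the halting step at time `γ`, which must be disregarded, be recognised.
Register 12 contains 0 at time 0 and 1 later, so copying it makes a match of `b` at time 0 yield the
answer 0. -/
theorem exec_clockBody (hα : IsSuccLimit α) (hr : ∀ i, r i < α) (h : P.HaltsIn α v γ)
    (hm : ∀ I ∈ P.code, I.RegsLt m) (hθ : θ ≤ γ) (hc : HasConsts P (24 + 2 * m) r)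
    (hR : Represents P (24 + 2 * m) m (P.config α v θ) r)
    (h9 : r 9 = count (Matches P α v m a) θ) (h10 : r 10 = count (Matches P α v m b) θ)
    (h11 : r 11 = answer P α v m γ a b θ) (h12 : r 12 = clockState P α v m γ a b θ 3)
    (h13 : r 13 = 1) (ha : ∀ j < m + 2, r (20 + j) = entry a j)
    (hb : ∀ j < m + 2, r (22 + m + j) = entry b j) :
    Exec α (clockBody P m) 0 r (fun s => RepresentsGE P (24 + 2 * m) m (P.config α v θ)
      (P.config α v (θ + 1)) s ∧ ∀ j : Fin 4, min (clockState P α v m γ a b θ j)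
        (clockState P α v m γ a b (θ + 1) j) ≤ s (j + 9))
      (fun s => Represents P (24 + 2 * m) m (P.config α v (θ + 1)) s ∧
        ∀ j : Fin 4, s (j + 9) = clockState P α v m γ a b (θ + 1) j) := by
  classical
  have hline := h.line_lt hθ
  set A := count (Matches P α v m a) with hA
  set B := count (Matches P α v m b) with hB
  set N := answer P α v m γ a b with hN
  set z := clockState P α v m γ a b θ 3 with hz
  have hz' : z = if θ = 0 then 0 else 1 := rfl
  -- A form of the intermediate condition that is easier to maintain: the registers 9, 10 and 11
  -- always have their old or their new content, and register 12 keeps its old one until the end.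
  set T : (ℕ → Ordinal.{u}) → Prop := fun s => RepresentsGE P (24 + 2 * m) m (P.config α v θ)
      (P.config α v (θ + 1)) s ∧ (s 9 = A θ ∨ s 9 = A (θ + 1)) ∧ (s 10 = B θ ∨ s 10 = B (θ + 1)) ∧
      (s 11 = N θ ∨ s 11 = N (θ + 1)) ∧ s 12 = z with hTdef
  suffices H : Exec α (clockBody P m) 0 r T (fun s =>
      Represents P (24 + 2 * m) m (P.config α v (θ + 1)) s ∧ s 9 = A (θ + 1) ∧ s 10 = B (θ + 1) ∧
      s 11 = N (θ + 1) ∧ s 12 = 1) by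
    refine H.mono le_rfl ?_ ?_
    · rintro s ⟨k1, k2, k3, k4, k5⟩
      refine ⟨k1, fun j => ?_⟩
      fin_cases j
      · change min (A θ) (A (θ + 1)) ≤ s 9
        rcases k2 with k | k <;> simp [k]
      · change min (B θ) (B (θ + 1)) ≤ s 10
        rcases k3 with k | k <;> simp [k]
      · change min (N θ) (N (θ + 1)) ≤ s 11
        rcases k4 with k | k <;> simp [k]
      · exact (min_le_left _ _).trans_eq k5.symm
    · rintro s ⟨k1, k2, k3, k4, k5⟩
      refine ⟨k1, fun j => ?_⟩
      fin_cases j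
      · exact k2
      · exact k3
      · exact k4
      · change s 12 = if θ + 1 = 0 then 0 else 1
        simp [k5]
  have hA1 : A (θ + 1) = if Matches P α v m a θ then A θ + 1 else A θ := by
    split_ifs with hM
    exacts [count_add_one_of_pos hM, count_add_one_of_neg hM]
  have hB1 : B (θ + 1) = if Matches P α v m b θ then B θ + 1 else B θ := by
    split_ifs with hM
    exacts [count_add_one_of_pos hM, count_add_one_of_neg hM]
  have hsim : ∀ i, 24 + 2 * m ≤ simReg P (24 + 2 * m) i := fun i => by unfold simReg; omega
  have hRep : ∀ s : ℕ → Ordinal.{u}, (∀ i, 24 + 2 * m ≤ i → s i = r i) →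
      Represents P (24 + 2 * m) m (P.config α v θ) s := fun s hs =>
    ⟨by rw [hs _ le_rfl, hR.1], fun i hi => by rw [hs _ (hsim i), hR.2 i hi]⟩
  refine exec_seq hα hr (exec_copy ⟨hR.ge_left, .inl h9, .inl h10, .inl h11, h12⟩
    (Q := fun s => s = Function.update r 14 (N θ)) (by rw [h11])) ?_
  rintro s1 rfl hs1 -
  set r1 := Function.update r 14 (N θ) with hr1
  have f1 : ∀ i, i ≠ 14 → r1 i = r i := fun i hi => by simp [r1, hi]
  have M1 := matchCond_holds (e := b) (t := 22 + m) hline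
    (hRep r1 fun i hi => f1 i (by omega)) fun j hj => by rw [f1 _ (by omega), hb j hj]
  refine exec_seq hα hs1 (exec_hook hα hs1 (w := z) (by norm_num) (fun T Q hT hQ => exec_copy hT
    (by rwa [f1 12 (by norm_num), h12])) fun s k1 k2 => ?_) ?_
  · have k3 : ∀ i, i ≠ 14 → i ≠ 10 → s i = r i := fun i h1 h2 => by rw [k1 i h1 h2, f1 i h1]
    refine ⟨(hRep s fun i hi => k3 i (by omega) (by omega)).ge_left, ?_, ?_, ?_, ?_⟩
    · left; rw [k3 9 (by norm_num) (by norm_num), h9]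
    · rw [f1 10 (by norm_num), h10] at k2
      rw [hB1]
      simpa only [M1] using k2
    · left; rw [k3 11 (by norm_num) (by norm_num), h11]
    · rw [k3 12 (by norm_num) (by norm_num), h12]
  rintro r2 ⟨k1, k2, k3⟩ hs2 -
  have f2 : ∀ i, i ≠ 14 → i ≠ 10 → r2 i = r i := fun i h1 h2 => by rw [k1 i h1 h2, f1 i h1]
  have M2 := matchCond_holds (e := a) (t := 20) hline
    (hRep r2 fun i hi => f2 i (by omega) (by omega)) fun j hj => by
      rw [f2 _ (by omega) (by omega), ha j hj]
  simp only [M1, f1 10 (by norm_num), f1 (22 + m + 1) (by omega), h10, hb 1 (by omega)] at k2 k3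
  rw [← hB1] at k3
  replace k2 : r2 14 = if MatchesAt P α v m b θ then z else N θ := by
    rw [k2, hr1, Function.update_self]
    by_cases hM : MatchesAt P α v m b θ
    · exact (if_pos hM).trans (if_pos hM).symm
    · exact (if_neg hM).trans (if_neg hM).symm
  refine exec_seq hα hs2 (exec_hook hα hs2 (w := 0) (by norm_num) (fun T Q hT hQ => exec_zero hT hQ)
    fun s l1 l2 => ?_) ?_
  · have l3 : ∀ i, i ≠ 14 → i ≠ 10 → i ≠ 9 → s i = r i := fun i h1 h2 h3 => by
      rw [l1 i h1 h3, f2 i h1 h2]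
    refine ⟨(hRep s fun i hi => l3 i (by omega) (by omega) (by omega)).ge_left, ?_, ?_, ?_, ?_⟩
    · rw [f2 9 (by norm_num) (by norm_num), h9] at l2
      rw [hA1]
      simpa only [M2] using l2
    · right; rw [l1 10 (by norm_num) (by norm_num), k3]
    · left; rw [l3 11 (by norm_num) (by norm_num) (by norm_num), h11]
    · rw [l3 12 (by norm_num) (by norm_num) (by norm_num), h12]
  rintro r3 ⟨l1, l2, l3⟩ hs3 -
  have f3 : ∀ i, i ≠ 14 → i ≠ 10 → i ≠ 9 → r3 i = r i := fun i h1 h2 h3 => by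
    rw [l1 i h1 h3, f2 i h1 h2]
  simp only [M2, f2 9 (by norm_num) (by norm_num), f2 21 (by norm_num) (by norm_num), h9,
    show r 21 = _ from ha 1 (by omega), Nat.reduceAdd] at l2 l3
  rw [← hA1] at l3
  replace l2 : r3 14 = if MatchesAt P α v m a θ then 0
      else if MatchesAt P α v m b θ then z else N θ := by
    rw [l2, k2]
    by_cases hM : MatchesAt P α v m a θ
    · exact (if_pos hM).trans (if_pos hM).symm
    · exact (if_neg hM).trans (if_neg hM).symm
  have e10 : r3 10 = B (θ + 1) := by rw [l1 10 (by norm_num) (by norm_num), k3]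
  have hnw : ∀ k < 24 + 2 * m, ¬ (simStep P (24 + 2 * m)).Writes k := fun k hk hw => by
    rcases simStep_writes hm hw with h | ⟨i, -, h⟩
    · omega
    · unfold simReg at h; omega
  have hstep := exec_simStep hα hs3 hm hline (hRep r3 fun i hi =>
    f3 i (by omega) (by omega) (by omega)) (fun l hl => by
      rw [f3 _ (by omega) (by omega) (by omega), hc l hl])
  rw [← config_add_one] at hstep
  have e11 : r3 11 = N θ := by rw [f3 11 (by norm_num) (by norm_num) (by norm_num), h11]
  have e12 : r3 12 = z := by rw [f3 12 (by norm_num) (by norm_num) (by norm_num), h12]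
  refine exec_seq hα hs3 ((hstep.frame hα hs3).mono le_rfl (fun s hs => ?_) fun _ hs => hs) ?_
  · obtain ⟨j1, -, j2⟩ := hs
    refine ⟨j1, .inr ?_, .inr ?_, .inl ?_, ?_⟩
    · rw [j2 9 (hnw 9 (by omega)), l3]
    · rw [j2 10 (hnw 10 (by omega)), e10]
    · rw [j2 11 (hnw 11 (by omega)), e11]
    · rw [j2 12 (hnw 12 (by omega)), e12]
  rintro r4 ⟨hR4, -, f4⟩ hs4 -
  have g4 : ∀ k < 24 + 2 * m, r4 k = r3 k := fun k hk => f4 k (hnw k hk)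
  have T4 : ∀ s : ℕ → Ordinal.{u}, (∀ i, i ≠ 11 → s i = r4 i) →
      (s 11 = N θ ∨ s 11 = N (θ + 1)) → T s := fun s h1 h2 => by
    refine ⟨?_, .inr ?_, .inr ?_, h2, ?_⟩
    · refine Represents.ge_right ⟨by rw [h1 _ (by omega), hR4.1], fun i hi => ?_⟩
      rw [h1 _ (by have := hsim i; omega), hR4.2 i hi]
    · rw [h1 9 (by norm_num), g4 9 (by omega), l3]
    · rw [h1 10 (by norm_num), g4 10 (by omega), e10]
    · rw [h1 12 (by norm_num), g4 12 (by omega), e12]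
  have T4r : T r4 := T4 r4 (fun _ _ => rfl) (.inl (by rw [g4 11 (by omega), e11]))
  have hconst : r4 (24 + 2 * m + 1 + P.code.length) = P.code.length := by
    rw [f4 _ (not_simStep_writes_const hm le_rfl), f3 _ (by omega) (by omega) (by omega),
      hc _ le_rfl]
  have hcond : Cond.Holds r4 (.eq (24 + 2 * m) (24 + 2 * m + 1 + P.code.length)) ↔ θ = γ := by
    simp only [Cond.Holds, hR4.1, hconst, Nat.cast_inj, min_eq_right_iff]
    constructor
    · intro hle
      by_contra hne
      have := h.2 (θ + 1) (Order.add_one_le_of_lt (lt_of_le_of_ne hθ hne))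
      exact this hle
    · rintro rfl; exact h.1
  refine exec_seq hα hs4 (Q := fun s => s = Function.update r4 11 (N (θ + 1)))
    (exec_ite T4r (fun hφ => exec_skip ?_) (fun hφ => exec_copy T4r ?_) ?_) ?_
  · obtain rfl := hcond.1 hφ
    rw [hN, answer_add_one_self, ← hN, ← e11, ← g4 11 (by omega), Function.update_eq_self]
  · have hlt := lt_of_le_of_ne hθ fun h => hφ (hcond.2 h)
    rw [hN, answer_add_one hlt, g4 14 (by omega), l2, hz']
  · rintro s rfl
    exact T4 _ (fun i hi => by simp [hi]) (.inr (by simp))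
  · rintro s rfl - -
    refine exec_copy (T4 _ (fun i hi => by simp [hi]) (.inr (by simp))) ⟨⟨?_, fun i hi => ?_⟩,
      ?_, ?_, ?_, ?_⟩
    · rw [Function.update_of_ne (by omega), Function.update_of_ne (by omega), hR4.1]
    · have := hsim i
      rw [Function.update_of_ne (by omega), Function.update_of_ne (by omega), hR4.2 i hi]
    · simp [g4 9 (by omega), l3]
    · simp [g4 10 (by omega), e10]
    · simp
    · simp [g4 13 (by omega), f3 13 (by norm_num) (by norm_num) (by norm_num), h13]

theorem exec_clockCmd (hexp : ExponentiallyClosed α) (hω : Ordinal.omega0 < α) {o ζ : Ordinal.{u}}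
    (ho : o < α) (hζ : ζ < α) (h : P.HaltsIn α [ζ] γ) (hm : ∀ I ∈ P.code, I.RegsLt m)
    (hm2 : 2 ≤ m) :
    Exec α (clockCmd P m) 0 (initial [o, ζ]).reg (fun _ => True)
      (fun s => s 0 = answer P α [ζ] m γ (unpair o).1 (unpair o).2 (γ + 1)) := by
  have hα := hexp.isSuccLimit
  have hr := initial_reg_lt hα.bot_lt (v := [o, ζ]) (by simp [ho, hζ])
  set r := (initial [o, ζ]).reg with hrdef
  have hr0 : ∀ i, 2 ≤ i → r i = 0 := fun i hi => by
    obtain ⟨j, rfl⟩ := Nat.exists_eq_add_of_le hi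
    rw [add_comm]; rfl
  have hζv : ∀ x ∈ [ζ], x < α := by simpa using hζ
  set a := (unpair o).1
  set b := (unpair o).2
  refine exec_seq hα hr (exec_unpairCmd hexp hr (by omega) (by omega) (by omega)) ?_
  rintro r1 ⟨e7, e8⟩ hr1 f1
  simp only [unpairCmd_writes] at f1
  refine exec_seq hα hr1 (exec_decodeCmd hexp hr1 (by omega) (by omega) (by omega) _) ?_
  intro r2 h2 hr2 f2
  replace f2 : ∀ i, ¬ ((3 ≤ i ∧ i ≤ 6) ∨ i = 7 ∨ (20 ≤ i ∧ i < 20 + (m + 2))) → r2 i = r1 i :=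
    fun i hi => f2 i fun h => hi (decodeCmd_writes h)
  refine exec_seq hα hr2 (exec_decodeCmd hexp hr2 (by omega) (by omega) (by omega) _) ?_
  intro r3 h3 hr3 f3
  replace f3 : ∀ i, ¬ ((3 ≤ i ∧ i ≤ 6) ∨ i = 8 ∨ (22 + m ≤ i ∧ i < 22 + m + (m + 2))) → r3 i = r2 i :=
    fun i hi => f3 i fun h => hi (decodeCmd_writes h)
  have g3 : ∀ i, i = 1 ∨ 9 ≤ i ∧ i < 20 → r3 i = r i := fun i hi => by
    rw [f3 i (by omega), f2 i (by omega), f1 i (by omega)]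
  refine exec_seq hα hr3 (exec_inc trivial (Q := fun s => s = Function.update r3 13 1) ?_) ?_
  · rw [g3 13 (by omega), hr0 13 (by omega), zero_add]
  rintro r4 rfl hr4 -
  refine exec_seq hα hr4 (exec_simSetup hα hr4) ?_
  rintro r5 ⟨hc5, hR5⟩ hr5 f5
  replace f5 : ∀ i < 24 + 2 * m, r5 i = Function.update r3 13 1 i := fun i hi => f5 i fun h => by
    have := simSetup_writes h; omega
  have e1 : r5 1 = ζ := by
    rw [f5 1 (by omega), Function.update_of_ne (by omega), g3 1 (by omega)]; rfl
  refine exec_seq hα hr5 (exec_copy trivial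
    (Q := fun s => s = Function.update r5 (simReg P (24 + 2 * m) 0) ζ) (by rw [e1])) ?_
  rintro r6 rfl hr6 -
  set r6 := Function.update r5 (simReg P (24 + 2 * m) 0) ζ with hr6def
  have f6 : ∀ i < 24 + 2 * m, i ≠ 13 → r6 i = r3 i := fun i hi hi' => by
    rw [hr6def, Function.update_of_ne (by unfold simReg; omega), f5 i hi,
      Function.update_of_ne hi']
  have e13 : r6 13 = 1 := by
    rw [hr6def, Function.update_of_ne (by unfold simReg; omega), f5 13 (by omega),
      Function.update_self]
  have hc6 : HasConsts P (24 + 2 * m) r6 := fun l hl => by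
    rw [hr6def, Function.update_of_ne (by unfold simReg; omega), hc5 l hl]
  have hR6 : Represents P (24 + 2 * m) m (initial [ζ]) r6 := by
    refine ⟨?_, fun i hi => ?_⟩
    · rw [hr6def, Function.update_of_ne (by unfold simReg; omega), hR5.1]; rfl
    · cases i with
      | zero => rw [hr6def, Function.update_self]; rfl
      | succ i =>
        rw [hr6def, Function.update_of_ne (by unfold simReg; omega), hR5.2 _ hi]; rfl
  have ha6 : ∀ j < m + 2, r6 (20 + j) = entry a j := fun j hj => by
    rw [f6 _ (by omega) (by omega), f3 _ (by omega), h2 j hj, e7]; rfl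
  have hb6 : ∀ j < m + 2, r6 (22 + m + j) = entry b j := fun j hj => by
    rw [f6 _ (by omega) (by omega), h3 j hj, f2 8 (by omega), e8]; rfl
  have hz6 : ∀ i, 9 ≤ i → i < 13 → r6 i = 0 := fun i h1 h2 => by
    rw [f6 i (by omega) (by omega), g3 i (by omega), hr0 i (by omega)]
  have hnw : ∀ i < 24 + 2 * m, 13 ≤ i → i ≠ 14 → ¬ (clockBody P m).Writes i := fun i h1 h2 h3 h => by
    rcases clockBody_writes hm h with h | h | ⟨j, -, h⟩
    · omega
    · omega
    · unfold simReg at h; omega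
  refine exec_seq hα hr6 (exec_simLoop hα hr6 h (m := m) (fun l hl hw => ?_)
    (fun j : Fin 4 => (j : ℕ) + 9) (clockState P α [ζ] m γ a b) ?_ hR6 hc6 ?_ ?_) ?_
  · rcases clockBody_writes hm hw with h | h | ⟨j, -, h⟩
    · omega
    · omega
    · unfold simReg at h; omega
  · intro lam hle hlam j
    have h1α : (1 : Ordinal.{u}) < α := Ordinal.one_lt_omega0.trans hω
    -- Here the bound on recurrences is used: the counters stay below `ω ^ ω < α`, so no limit
    -- resets them.
    have hcount : ∀ e, count (Matches P α [ζ] m e) lam < α := fun e =>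
      (count_matches_lt h hα hζv hm (hle.trans (lt_add_one γ).le)).trans (hexp.2 hω hω)
    fin_cases j
    · exact ⟨_, isLimInf_count hlam, (reset_of_lt (hcount a)).symm⟩
    · exact ⟨_, isLimInf_count hlam, (reset_of_lt (hcount b)).symm⟩
    · exact ⟨_, isLimInf_answer hlam, (reset_of_lt (answer_le_one.trans_lt h1α)).symm⟩
    · refine ⟨1, isLimInf_of_eventually_eq (hlam.succ_lt hlam.bot_lt) fun σ hσ _ => ?_, ?_⟩
      · have : σ ≠ 0 := (pos_iff_ne_zero.1 ((succ_le_iff.1 hσ)))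
        simp [clockState, this]
      · rw [reset_of_lt h1α]
        simp [clockState, (pos_iff_ne_zero.1 hlam.bot_lt)]
  · intro j
    fin_cases j <;> simp [clockState, answer_zero, hz6]
  · intro θ hθ s hs hf hcs hRs hv
    refine exec_clockBody hα hs h hm hθ hcs hRs (hv 0) (hv 1) (hv 2) (hv 3) ?_ ?_ ?_
    · rw [hf 13 (hnw 13 (by omega) (by omega) (by omega)), e13]
    · intro j hj
      rw [hf _ (hnw _ (by omega) (by omega) (by omega)), ha6 j hj]
    · intro j hj
      rw [hf _ (hnw _ (by omega) (by omega) (by omega)), hb6 j hj]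
  · rintro s ⟨-, hs⟩ hs' -
    refine exec_copy trivial ?_
    rw [Function.update_self]
    exact hs 2

end ClockProgram

/-! ### The code obtained from a halting computation -/

section Computable

variable {P : Program} {α : Ordinal.{u}} {v : List Ordinal.{u}} {m : ℕ} {γ a b e σ τ : Ordinal.{u}}

/-- A function from a finite ordinal to `ω` is bounded, so `ω` is not singular. -/
theorem Singular.omega0_lt (hexp : ExponentiallyClosed α) (h : Singular α) :
    Ordinal.omega0 < α := by
  refine lt_of_le_of_ne hexp.1 fun hω => ?_
  subst hω
  obtain ⟨β, hβ, f, hf, hcof, -⟩ := h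
  obtain ⟨n, rfl⟩ := Ordinal.lt_omega0.1 hβ
  have key : ∀ k : ℕ, k ≤ n → ∃ N : ℕ, ∀ ι < (k : Ordinal.{u}), f ι < N := by
    intro k
    induction k with
    | zero => exact fun _ => ⟨0, fun ι hι => by simp at hι⟩
    | succ k ih =>
      intro hk
      obtain ⟨N, hN⟩ := ih (by omega)
      obtain ⟨N', hN'⟩ := Ordinal.lt_omega0.1 (hf k (by exact_mod_cast hk))
      refine ⟨max N (N' + 1), fun ι hι => ?_⟩
      rw [Nat.cast_add_one, Order.lt_add_one_iff] at hι
      rcases hι.lt_or_eq with h | rfl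
      · exact (hN ι h).trans_le (by exact_mod_cast le_max_left _ _)
      · rw [hN']; exact_mod_cast lt_max_of_lt_right (Nat.lt_succ_self N')
  obtain ⟨N, hN⟩ := key n le_rfl
  obtain ⟨ι, h1, h2⟩ := hcof N (Ordinal.natCast_lt_omega0 N)
  exact (hN ι h1).not_ge h2

variable (P α v m γ) in
/-- The time below `γ` described by `e`, where time `0` is the default value. -/
noncomputable def timeOf (e : Ordinal.{u}) : Ordinal.{u} :=
  sInf {τ | τ < γ ∧ MatchesAt P α v m e τ}

theorem timeOf_eq (h : τ < γ) (hτ : MatchesAt P α v m e τ) : timeOf P α v m γ e = τ := by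
  have : {τ | τ < γ ∧ MatchesAt P α v m e τ} = {τ} := by
    ext σ
    exact ⟨fun hσ => hσ.2.unique hτ, fun hσ => by rw [mem_singleton_iff] at hσ; exact hσ ▸ ⟨h, hτ⟩⟩
  rw [timeOf, this, csInf_singleton]

theorem timeOf_mem (h : 0 < timeOf P α v m γ e) :
    timeOf P α v m γ e < γ ∧ MatchesAt P α v m e (timeOf P α v m γ e) := by
  refine csInf_mem (s := {τ | τ < γ ∧ MatchesAt P α v m e τ}) ?_
  by_contra hne
  rw [timeOf, not_nonempty_iff_eq_empty.1 hne, Ordinal.sInf_empty] at h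
  exact h.false

theorem timeOf_lt (hγ : 0 < γ) : timeOf P α v m γ e < γ := by
  rcases eq_zero_or_pos (timeOf P α v m γ e) with h | h
  · rwa [h]
  · exact (timeOf_mem h).1

theorem exists_timeOf_eq (hexp : ExponentiallyClosed α) (hω : Ordinal.omega0 < α)
    (h : P.HaltsIn α v γ) (hv : ∀ x ∈ v, x < α) (hm : ∀ I ∈ P.code, I.RegsLt m) (hτ : τ < γ) :
    ∃ e < α, timeOf P α v m γ e = τ := by
  have hα := hexp.isSuccLimit
  set C := P.config α v τ
  have hC : ∀ i, C.reg i < α := fun i => run_lt hα (initial_reg_lt hα.bot_lt hv) τ i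
  have hcount : ∀ e, count (Matches P α v m e) τ < α := fun e =>
    (count_matches_lt h hα hv hm (hτ.le.trans (lt_add_one γ).le)).trans (hexp.2 hω hω)
  let x : ℕ → Ordinal.{u} := fun j => match j with
    | 0 => C.line
    | 1 => count (fun σ => ((P.config α v σ).line : Ordinal.{u}) = C.line ∧
        ∀ i < m, (P.config α v σ).reg i = C.reg i) τ
    | i + 2 => C.reg i
  have hx : ∀ e, (∀ j < m + 2, entry e j = if j = 1 then 0 else x j) ∨
      (∀ j < m + 2, entry e j = x j) → Matches P α v m e = fun σ =>
      ((P.config α v σ).line : Ordinal.{u}) = C.line ∧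
        ∀ i < m, (P.config α v σ).reg i = C.reg i := by
    intro e he
    have h0 : entry e 0 = C.line := by rcases he with he | he <;> exact he 0 (by omega)
    have h2 : ∀ i < m, entry e (i + 2) = C.reg i := fun i hi => by
      rcases he with he | he
      · exact (he _ (by omega)).trans (if_neg (by omega))
      · exact he _ (by omega)
    funext σ
    simp only [Matches, h0, eq_iff_iff]
    exact and_congr_right fun _ => forall₂_congr fun i hi => by rw [h2 i hi]
  have hxα : ∀ j, j ≠ 1 → x j < α := fun j hj => match j with
    | 0 => (Ordinal.natCast_lt_omega0 _).trans hω
    | 1 => (hj rfl).elim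
    | i + 2 => hC i
  -- The count must be known to be below `α` before it can be an entry, but its bound is stated for
  -- codes. Matching ignores entry 1, so a preliminary code with 0 there provides the bound.
  obtain ⟨e₀, -, he₀⟩ := exists_entry_eq hexp (m + 2) (fun j => if j = 1 then 0 else x j)
    fun j _ => by
      split_ifs with hj
      exacts [hα.bot_lt, hxα j hj]
  obtain ⟨e, he, he'⟩ := exists_entry_eq hexp (m + 2) x fun j _ => by
    by_cases hj : j = 1
    · subst hj
      have := hcount e₀
      rwa [hx e₀ (.inl he₀)] at this
    · exact hxα j hj
  refine ⟨e, he, timeOf_eq hτ ?_⟩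
  unfold MatchesAt
  rw [hx e (.inr he'), he' 1 (by omega)]
  exact ⟨⟨rfl, fun _ _ => rfl⟩, rfl⟩

open Classical in
-- Codes that describe no time below `γ` get the default time 0. This agrees with `answer`: an `a`
-- that never matches does not hinder the answer 1, and a match of `b` at time 0 is ignored.
theorem answer_eq_timeOf : answer P α v m γ a b (γ + 1) =
    if timeOf P α v m γ a < timeOf P α v m γ b then 1 else 0 := by
  rw [answer]
  congr 1
  rw [eq_iff_iff]
  constructor
  · rintro ⟨τ, -, h1, h2, h3, h4⟩
    rw [timeOf_eq h1 h3]
    rcases eq_zero_or_pos (timeOf P α v m γ a) with h | h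
    · rwa [h]
    · obtain ⟨k1, k2⟩ := timeOf_mem h
      exact h4 _ (k1.trans (lt_add_one γ)) k1 k2
  · intro h
    obtain ⟨k1, k2⟩ := timeOf_mem (zero_le.trans_lt h)
    refine ⟨_, k1.trans (lt_add_one γ), k1, zero_le.trans_lt h, k2, fun τ' _ h1 h2 => ?_⟩
    rwa [timeOf_eq h1 h2] at h

theorem computableOrdinal_zero (hα : IsSuccLimit α) : ComputableOrdinal α 0 := by
  refine ⟨∅, .inl ⟨rfl, rfl⟩, empty_subset _, (Cmd.zero 0).toProgram one_pos, 0, hα.bot_lt,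
    fun ι _ => ⟨fun h => h.elim, fun _ => ?_⟩⟩
  obtain ⟨τ, h1, -, h2⟩ := Exec.haltsIn (α := α) (v := [ι, 0]) (T := fun _ => True)
    (Q := fun s => s 0 = 0) one_pos (exec_zero (i := 0) trivial (by simp))
  exact ⟨τ, h1, h2⟩

theorem Clockable.computableOrdinal (hexp : ExponentiallyClosed α) (hω : Ordinal.omega0 < α)
    (h : Clockable α γ) : ComputableOrdinal α γ := by
  classical
  obtain ⟨P, ζ, hζ, h⟩ := h
  have hα := hexp.isSuccLimit
  -- For `γ > 0` the default time 0 lies below `γ`, which makes the naming a total map from `α` to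
  -- `γ`.
  rcases eq_zero_or_pos γ with rfl | hγ
  · exact computableOrdinal_zero hα
  obtain ⟨m, hm2, hm⟩ := P.exists_regsLt 2
  have hζv : ∀ x ∈ [ζ], x < α := by simpa using hζ
  set F : Iio α → Iio γ := fun e => ⟨timeOf P α [ζ] m γ e.1, timeOf_lt hγ⟩ with hF
  refine ⟨_, .inr ⟨F, fun ⟨τ, hτ⟩ => ?_, rfl⟩, ?_, (clockCmd P m).toProgram ?_, ζ, hζ, ?_⟩
  · obtain ⟨e, he, he'⟩ := exists_timeOf_eq hexp hω h hζv hm hτ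
    exact ⟨⟨e, he⟩, Subtype.ext he'⟩
  · rintro _ ⟨ι, ξ, -, rfl⟩
    exact pair_lt hexp ι.2 ξ.2
  · simp only [clockCmd, Cmd.size]; omega
  · intro o ho
    obtain ⟨τ, h1, -, h2⟩ := Exec.haltsIn (by simp only [clockCmd, Cmd.size]; omega)
      (exec_clockCmd hexp hω ho hζ h hm hm2)
    rw [answer_eq_timeOf] at h2
    have ha : (unpair o).1 < α := (unpair_fst_le o).trans_lt ho
    have hb : (unpair o).2 < α := (unpair_snd_le o).trans_lt ho
    have hiff : (o ∈ {o | ∃ ι ξ : Iio α, F ι < F ξ ∧ o = pair (ι.1, ξ.1)}) ↔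
        timeOf P α [ζ] m γ (unpair o).1 < timeOf P α [ζ] m γ (unpair o).2 := by
      constructor
      · rintro ⟨ι, ξ, hlt, rfl⟩
        simpa using show timeOf P α [ζ] m γ ι.1 < timeOf P α [ζ] m γ ξ.1 from hlt
      · intro h
        exact ⟨⟨_, ha⟩, ⟨_, hb⟩, h, by simp⟩
    rw [hiff]
    exact ⟨fun h => ⟨τ, h1, by rw [h2, if_pos h]⟩, fun h => ⟨τ, h1, by rw [h2, if_neg h]⟩⟩

end Computable

/-! ### Depth-first search -/

section Search

variable {α : Ordinal.{u}} {Q R : Program} {n m : ℕ} {r : ℕ → Ordinal.{u}}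
  {a b a' b' x w y z σ l q ξ β κ : Ordinal.{u}}

/-- Decode the node in register `7` into its context, its label and the label's components; put the
number of the current child and the number of all children into the registers `9` and `14`. -/
def nodeCmd (R : Program) (n : ℕ) : Cmd :=
  .seq (unpairCmd 7 10 11) (.seq (unpairCmd 11 12 13) (.seq (subCmd 7 8 9)
    (.ite (.eq 13 23) (.copy 23 14) (callCmd R 40 n 13 22 14))))

/-- Return from a node to its context. -/
def popCmd : Cmd := .seq (unpairCmd 10 17 18) (.seq (.inc 18) (.seq (.copy 17 7) (.copy 18 8)))

/-- Enter a new node with the label in register `15`. -/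
def pushCmd : Cmd :=
  .seq (pairCmd 7 8 16) (.seq (pairCmd 16 15 16) (.seq (.copy 16 7) (.copy 16 8)))

/-- If the child is related to the label according to `Q`, enter it. -/
def childCmd (Q : Program) (m : ℕ) : Cmd :=
  .seq (pairCmd 9 12 15) (.seq (callCmd Q 40 m 15 21 19)
    (.ite (.eq 19 25) (.seq (pairCmd 9 23 15) pushCmd) (.inc 8)))

/-- One step of the search. -/
def searchBody (Q R : Program) (m n : ℕ) : Cmd :=
  .seq (nodeCmd R n) (.ite (.eq 9 14) popCmd
    (.ite (.eq 13 23) (.seq (pairCmd 12 9 15) pushCmd) (childCmd Q m)))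

theorem nodeCmd_writes (hn : ∀ I ∈ R.code, I.RegsLt n) {k : ℕ} (h : (nodeCmd R n).Writes k) :
    (3 ≤ k ∧ k ≤ 14 ∧ k ≠ 7 ∧ k ≠ 8) ∨ 40 ≤ k := by
  simp only [nodeCmd, Cmd.Writes, unpairCmd_writes, subCmd_writes] at h
  rcases h with h | h | h | h | h
  on_goal 5 => have := callCmd_writes hn h
  all_goals omega

theorem searchBody_writes (hm : ∀ I ∈ Q.code, I.RegsLt m) (hn : ∀ I ∈ R.code, I.RegsLt n) {k : ℕ}
    (h : (searchBody Q R m n).Writes k) : (3 ≤ k ∧ k ≤ 19) ∨ 40 ≤ k := by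
  simp only [searchBody, popCmd, childCmd, pushCmd, Cmd.Writes, unpairCmd_writes, pairCmd_writes]
    at h
  rcases h with h | h | h | h | h | h
  · have := nodeCmd_writes hn h; omega
  · omega
  · omega
  · omega
  · have := callCmd_writes hm h; omega
  · omega

/-- The registers `7` and `8` change at most from `a` to `a'` and from `b` to `b'`. -/
def Between (a b a' b' : Ordinal.{u}) (s : ℕ → Ordinal.{u}) : Prop :=
  (s 7 = a ∨ s 7 = a') ∧ (s 8 = b ∨ s 8 = b')

/-- The context is decoded into the auxiliary registers 17 and 18 and advanced there to the next
child, so that the registers 7 and 8 change in a single step each and take no values in between. -/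
theorem exec_popCmd (hexp : ExponentiallyClosed α) (hr : ∀ i, r i < α) (h7 : r 7 = a)
    (h8 : r 8 = b) (h10 : r 10 = pair (a', b')) :
    Exec α popCmd 0 r (Between a b a' (b' + 1)) (fun s => s 7 = a' ∧ s 8 = b' + 1) := by
  have hα := hexp.isSuccLimit
  refine exec_seq_frame hα hr (exec_unpairCmd hexp hr (by omega) (by omega) (by omega))
    (fun s hs => ⟨.inl ?_, .inl ?_⟩) fun r1 h1 hr1 f1 => ?_
  · rw [hs 7 (by simp), h7]
  · rw [hs 8 (by simp), h8]
  have e7 : r1 7 = a := by rw [f1 7 (by simp), h7]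
  have e8 : r1 8 = b := by rw [f1 8 (by simp), h8]
  rw [h10, unpair_pair] at h1
  refine exec_seq hα hr1 (exec_inc ⟨.inl e7, .inl e8⟩
    (Q := fun s => s = Function.update r1 18 (b' + 1)) (by rw [h1.2])) ?_
  rintro r2 rfl hr2 -
  refine exec_seq hα hr2 (exec_copy ⟨.inl (by simp [e7]), .inl (by simp [e8])⟩
    (Q := fun s => s = Function.update (Function.update r1 18 (b' + 1)) 7 a') (by simp [h1.1])) ?_
  rintro r3 rfl hr3 -
  exact exec_copy ⟨.inr (by simp), .inl (by simp [e8])⟩ (by simp)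

/-- Register 8 contains the code of the node plus the number of the current child; the scan of the
new node begins with child 0, so both registers receive its code. -/
theorem exec_pushCmd (hexp : ExponentiallyClosed α) (hr : ∀ i, r i < α) (h7 : r 7 = a)
    (h8 : r 8 = b) (h15 : r 15 = l) (ha' : a' = pair (pair (a, b), l)) :
    Exec α pushCmd 0 r (Between a b a' a') (fun s => s 7 = a' ∧ s 8 = a') := by
  have hα := hexp.isSuccLimit
  refine exec_seq_frame hα hr (exec_pairCmd hexp hr (by omega) (by omega))
    (fun s hs => ⟨.inl ?_, .inl ?_⟩) fun r1 h1 hr1 f1 => ?_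
  · rw [hs 7 (by simp), h7]
  · rw [hs 8 (by simp), h8]
  have e7 : r1 7 = a := by rw [f1 7 (by simp), h7]
  have e8 : r1 8 = b := by rw [f1 8 (by simp), h8]
  refine exec_seq_frame hα hr1 (exec_pairCmd hexp hr1 (by omega) (by omega))
    (fun s hs => ⟨.inl ?_, .inl ?_⟩) fun r2 h2 hr2 f2 => ?_
  · rw [hs 7 (by simp), e7]
  · rw [hs 8 (by simp), e8]
  rw [h1, f1 15 (by simp), h7, h8, h15, ← ha'] at h2
  refine exec_seq hα hr2 (exec_copy ⟨.inl (by rw [f2 7 (by simp), e7]),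
    .inl (by rw [f2 8 (by simp), e8])⟩ (Q := fun s => s = Function.update r2 7 a') (by rw [h2])) ?_
  rintro r3 rfl hr3 -
  exact exec_copy ⟨.inr (by simp), .inl (by simp [f2, e8])⟩ (by simp [h2])

/-- The number of children of a node with label `pair (x, w)`. -/
def NodeBound (R : Program) (α ξ β w κ : Ordinal.{u}) : Prop :=
  (w = β → κ = β) ∧ (w ≠ β → R.Outputs α [w, ξ] κ)

theorem exec_nodeCmd (hexp : ExponentiallyClosed α) (hr : ∀ i, r i < α)
    (hn : ∀ I ∈ R.code, I.RegsLt n) (hn2 : 2 ≤ n) (h7 : r 7 = pair (σ, pair (x, w)))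
    (h8 : r 8 = pair (σ, pair (x, w)) + y) (h22 : r 22 = ξ) (h23 : r 23 = β)
    (hκ : NodeBound R α ξ β w κ) :
    Exec α (nodeCmd R n) 0 r (fun _ => True)
      (fun s => s 9 = y ∧ s 10 = σ ∧ s 12 = x ∧ s 13 = w ∧ s 14 = κ) := by
  have hα := hexp.isSuccLimit
  refine exec_seq hα hr (exec_unpairCmd hexp hr (by omega) (by omega) (by omega)) ?_
  intro r1 h1 hr1 f1
  rw [h7, unpair_pair] at h1
  refine exec_seq hα hr1 (exec_unpairCmd hexp hr1 (by omega) (by omega) (by omega)) ?_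
  intro r2 h2 hr2 f2
  rw [h1.2, unpair_pair] at h2
  have e7 : r2 7 = r 7 := by rw [f2 7 (by simp), f1 7 (by simp)]
  have e8 : r2 8 = r 8 := by rw [f2 8 (by simp), f1 8 (by simp)]
  refine exec_seq hα hr2 (exec_subCmd hα hr2 (by omega) (by omega) (by omega) ?_) ?_
  · rw [e7, e8, h7, h8]; exact le_self_add
  intro r3 h3 hr3 f3
  rw [e7, e8, h7, h8, Ordinal.add_sub_cancel] at h3
  have e10 : r3 10 = σ := by rw [f3 10 (by simp), f2 10 (by simp), h1.1]
  have e12 : r3 12 = x := by rw [f3 12 (by simp), h2.1]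
  have e13 : r3 13 = w := by rw [f3 13 (by simp), h2.2]
  have e22 : r3 22 = ξ := by rw [f3 22 (by simp), f2 22 (by simp), f1 22 (by simp), h22]
  have e23 : r3 23 = β := by rw [f3 23 (by simp), f2 23 (by simp), f1 23 (by simp), h23]
  refine exec_ite trivial (fun hφ => exec_copy trivial ?_) (fun hφ => ?_) (fun _ _ => trivial) <;>
    simp only [Cond.Holds, e13, e23] at hφ
  · simp [h3, e10, e12, e13, e23, hκ.1 hφ]
  · refine ((exec_callCmd hα hr3 hn hn2 (by omega) (by omega)
      (by rw [e13, e22]; exact hκ.2 hφ)).frame hα hr3).mono le_rfl (fun _ _ => trivial) ?_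
    rintro s ⟨hs, -, f⟩
    have g : ∀ k < 14, s k = r3 k := fun k hk => f k fun h => by
      have := callCmd_writes hn h; omega
    exact ⟨(g 9 (by omega)).trans h3, (g 10 (by omega)).trans e10, (g 12 (by omega)).trans e12,
      (g 13 (by omega)).trans e13, hs⟩

theorem exec_childCmd (hexp : ExponentiallyClosed α) (hr : ∀ i, r i < α)
    (hm : ∀ I ∈ Q.code, I.RegsLt m) (hm2 : 2 ≤ m) (h7 : r 7 = a) (h8 : r 8 = b) (h9 : r 9 = y)
    (h12 : r 12 = x) (h21 : r 21 = q) (h23 : r 23 = β) (h25 : r 25 = 1)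
    (h : (Q.Outputs α [pair (y, x), q] 1 ∧ a' = pair (pair (a, b), pair (y, β)) ∧ b' = a') ∨
      (Q.Outputs α [pair (y, x), q] 0 ∧ a' = a ∧ b' = b + 1)) :
    Exec α (childCmd Q m) 0 r (Between a b a' b') (fun s => s 7 = a' ∧ s 8 = b') := by
  have hα := hexp.isSuccLimit
  refine exec_seq_frame hα hr (exec_pairCmd hexp hr (by omega) (by omega))
    (fun s hs => ⟨.inl ?_, .inl ?_⟩) fun r1 h1 hr1 f1 => ?_
  · rw [hs 7 (by simp), h7]
  · rw [hs 8 (by simp), h8]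
  rw [h9, h12] at h1
  obtain ⟨ρ, hρ, hρ'⟩ : ∃ ρ, Q.Outputs α [pair (y, x), q] ρ ∧
      ((ρ = 1 ∧ a' = pair (pair (a, b), pair (y, β)) ∧ b' = a') ∨
      (ρ = 0 ∧ a' = a ∧ b' = b + 1)) := by
    rcases h with h | h
    exacts [⟨1, h.1, .inl ⟨rfl, h.2⟩⟩, ⟨0, h.1, .inr ⟨rfl, h.2⟩⟩]
  have hw : ∀ {k}, (callCmd Q 40 m 15 21 19).Writes k → 19 ≤ k ∧ k < 20 ∨ 40 ≤ k := fun h => by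
    have := callCmd_writes hm h; omega
  have hf : ∀ {s : ℕ → Ordinal.{u}}, (∀ i, ¬ (callCmd Q 40 m 15 21 19).Writes i → s i = r1 i) →
      ∀ k, (k < 19 ∧ k ≠ 15 ∧ 6 < k) ∨ (20 ≤ k ∧ k < 40) → s k = r k := fun hs k hk => by
    rw [hs k fun h => by have := hw h; omega, f1 k (by rw [pairCmd_writes]; omega)]
  refine exec_seq_frame hα hr1 (exec_callCmd (ρ := ρ) hα hr1 hm hm2 (by omega) (by omega) ?_)
    (fun s hs => ⟨.inl ((hf hs 7 (by omega)).trans h7), .inl ((hf hs 8 (by omega)).trans h8)⟩) ?_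
  · rwa [h1, f1 21 (by simp), h21]
  intro r2 h2 hr2 f2
  have e7 := (hf f2 7 (by omega)).trans h7
  have e8 := (hf f2 8 (by omega)).trans h8
  have e9 := (hf f2 9 (by omega)).trans h9
  have e23 := (hf f2 23 (by omega)).trans h23
  have e25 := (hf f2 25 (by omega)).trans h25
  refine exec_ite ⟨.inl e7, .inl e8⟩ (fun hφ => ?_) (fun hφ => ?_)
    (fun s hs => ⟨.inr hs.1, .inr hs.2⟩) <;> simp only [Cond.Holds, h2, e25] at hφ
  · obtain ⟨-, ha', rfl⟩ : _ ∧ _ ∧ _ := hρ'.resolve_right fun h => by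
      rw [h.1] at hφ; exact zero_ne_one hφ
    refine exec_seq_frame hα hr2 (exec_pairCmd hexp hr2 (by omega) (by omega))
      (fun s hs => ⟨.inl ?_, .inl ?_⟩) fun r3 h3 hr3 f3 => ?_
    · rw [hs 7 (by simp), e7]
    · rw [hs 8 (by simp), e8]
    refine exec_pushCmd hexp hr3 (by rw [f3 7 (by simp), e7]) (by rw [f3 8 (by simp), e8]) h3 ?_
    rw [ha', e9, e23]
  · obtain ⟨-, rfl, rfl⟩ := hρ'.resolve_left fun h => hφ h.1
    exact exec_inc ⟨.inl e7, .inl e8⟩ (by simp [e7, e8])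

/-- A label with second component `β` belongs to an element `x`, whose children are the blocks. Any
other second component `w` denotes a block of `x`; its children are candidates, which are entered if
`Q` relates them to `x` and skipped otherwise. -/
theorem exec_searchBody (hexp : ExponentiallyClosed α) (hr : ∀ i, r i < α)
    (hm : ∀ I ∈ Q.code, I.RegsLt m) (hm2 : 2 ≤ m) (hn : ∀ I ∈ R.code, I.RegsLt n) (hn2 : 2 ≤ n)
    (h7 : r 7 = a) (h8 : r 8 = a + y) (ha : a = pair (σ, pair (x, w))) (h21 : r 21 = q)
    (h22 : r 22 = ξ) (h23 : r 23 = β) (h25 : r 25 = 1) (hκ : NodeBound R α ξ β w κ)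
    (h : (y = κ ∧ σ = pair (a', z) ∧ b' = z + 1) ∨
      (y ≠ κ ∧ w = β ∧ a' = pair (pair (a, a + y), pair (x, y)) ∧ b' = a') ∨
      (y ≠ κ ∧ w ≠ β ∧ ((Q.Outputs α [pair (y, x), q] 1 ∧
        a' = pair (pair (a, a + y), pair (y, β)) ∧ b' = a') ∨
      (Q.Outputs α [pair (y, x), q] 0 ∧ a' = a ∧ b' = a + y + 1)))) :
    Exec α (searchBody Q R m n) 0 r (Between a (a + y) a' b')
      (fun s => s 7 = a' ∧ s 8 = b') := by
  have hα := hexp.isSuccLimit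
  have hf : ∀ {s : ℕ → Ordinal.{u}}, (∀ i, ¬ (nodeCmd R n).Writes i → s i = r i) →
      ∀ k, k = 7 ∨ k = 8 ∨ (20 ≤ k ∧ k < 40) → s k = r k := fun hs k hk =>
    hs k fun h => by have := nodeCmd_writes hn h; omega
  refine exec_seq_frame hα hr (exec_nodeCmd (σ := σ) hexp hr hn hn2 (by rw [h7, ha])
    (by rw [h8, ha]) h22 h23 hκ) (fun s hs => ⟨.inl ((hf hs 7 (by omega)).trans h7),
      .inl ((hf hs 8 (by omega)).trans h8)⟩) ?_
  rintro r1 ⟨e9, e10, e12, e13, e14⟩ hr1 f1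
  have e7 := (hf f1 7 (by omega)).trans h7
  have e8 := (hf f1 8 (by omega)).trans h8
  have e23 := (hf f1 23 (by omega)).trans h23
  have hQT : ∀ s : ℕ → Ordinal.{u}, s 7 = a' ∧ s 8 = b' → Between a (a + y) a' b' s :=
    fun s hs => ⟨.inr hs.1, .inr hs.2⟩
  refine exec_ite ⟨.inl e7, .inl e8⟩ (fun hφ => ?_) (fun hφ => exec_ite ⟨.inl e7, .inl e8⟩
    (fun hψ => ?_) (fun hψ => ?_) hQT) hQT <;> simp only [Cond.Holds, e9, e14] at hφ
  · rcases h with h | h | h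
    · obtain ⟨-, rfl, rfl⟩ := h
      exact exec_popCmd hexp hr1 e7 e8 e10
    · exact (h.1 hφ).elim
    · exact (h.1 hφ).elim
  · simp only [Cond.Holds, e13, e23] at hψ
    obtain ⟨-, -, ha', rfl⟩ := (h.resolve_left fun h => hφ h.1).resolve_right fun h => h.2.1 hψ
    refine exec_seq_frame hα hr1 (exec_pairCmd hexp hr1 (by omega) (by omega))
      (fun s hs => ⟨.inl ?_, .inl ?_⟩) fun r2 h2 hr2 f2 => ?_
    · rw [hs 7 (by simp), e7]
    · rw [hs 8 (by simp), e8]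
    refine exec_pushCmd hexp hr2 (by rw [f2 7 (by simp), e7]) (by rw [f2 8 (by simp), e8]) h2 ?_
    rw [ha', e9, e12]
  · simp only [Cond.Holds, e13, e23] at hψ
    obtain ⟨-, -, h⟩ := (h.resolve_left fun h => hφ h.1).resolve_left fun h => hψ h.2.1
    exact exec_childCmd hexp hr1 hm hm2 e7 e8 e9 e12 ((hf f1 21 (by omega)).trans h21) e23
      ((hf f1 25 (by omega)).trans h25) h

end Search

/-- The loop that searches the tree of descending sequences. -/
def searchLoop (Q R : Program) (m n : ℕ) : Cmd := .loop (.not (.eq 7 24)) (searchBody Q R m n)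

/-- Search the tree of sequences that start with the first entry of the input and descend in the
relation computed by `Q`. The input also contains the parameters of `Q` and `R`, and the domain of
the cofinal function computed by `R`. -/
def searchCmd (Q R : Program) (m n : ℕ) : Cmd :=
  .seq (decodeCmd 0 20 4) (.seq (.inc 25) (.seq (pairCmd 20 23 15) (.seq (pairCmd 24 15 7)
    (.seq (.copy 7 8) (searchLoop Q R m n)))))

/-- `R` computes a cofinal function `f` from `β` to `α`, and `Q` computes the well-founded relation
on `α` with rank function `F`. -/
structure SearchData (α q ξ β : Ordinal.{u}) (Q R : Program) (m n : ℕ)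
    (f F : Ordinal.{u} → Ordinal.{u}) : Prop where
  closed : ExponentiallyClosed α
  regsLt_left : ∀ I ∈ Q.code, I.RegsLt m
  two_le_left : 2 ≤ m
  regsLt_right : ∀ I ∈ R.code, I.RegsLt n
  two_le_right : 2 ≤ n
  lt : β < α
  map_lt : ∀ w < β, f w < α
  cofinal : ∀ δ < α, ∃ w < β, δ ≤ f w
  outputs_right : ∀ w < β, R.Outputs α [w, ξ] (f w)
  surj : ∀ x < α, ∀ δ < F x, ∃ y < α, F y = δ
  outputs_one : ∀ y < α, ∀ x < α, F y < F x → Q.Outputs α [pair (y, x), q] 1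
  outputs_zero : ∀ y < α, ∀ x < α, ¬ F y < F x → Q.Outputs α [pair (y, x), q] 0

/-- The registers contain ordinals below `α`, and the expected constants. -/
def SearchReady (α q ξ β : Ordinal.{u}) (s : ℕ → Ordinal.{u}) : Prop :=
  (∀ i, s i < α) ∧ s 21 = q ∧ s 22 = ξ ∧ s 23 = β ∧ s 24 = 0 ∧ s 25 = 1

/-! ### Correctness and duration of the search -/

section Search

variable {P Q R : Program} {α q ξ β : Ordinal.{u}} {m n k ℓ : ℕ} {f F : Ordinal.{u} → Ordinal.{u}}
  {r : ℕ → Ordinal.{u}} {a b a' b' a₀ b₀ x w y z κ d : Ordinal.{u}}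
  {T S : (ℕ → Ordinal.{u}) → Prop}

namespace SearchData

/-- Makes the codes of all visited nodes positive, so that 0 can stand for the empty stack. -/
theorem pos (D : SearchData α q ξ β Q R m n f F) : 0 < β := by
  obtain ⟨w, hw, -⟩ := D.cofinal β D.lt
  exact zero_le.trans_lt hw

theorem ready (D : SearchData α q ξ β Q R m n f F)
    (hP : Located P ℓ ((searchLoop Q R m n).compile ℓ)) (hr : SearchReady α q ξ β r)
    {s : ℕ → Ordinal.{u}} (hs : ∀ i, s i < α)
    (h : ∀ i, P.NoWrite ℓ (ℓ + (searchLoop Q R m n).size) i → s i = r i) :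
    SearchReady α q ξ β s := by
  have hf : ∀ k, 20 ≤ k → k < 40 → s k = r k := fun k h1 h2 => h k (hP.noWrite fun hw => by
    have := searchBody_writes D.regsLt_left D.regsLt_right hw; omega)
  obtain ⟨-, h1, h2, h3, h4, h5⟩ := hr
  refine ⟨hs, ?_, ?_, ?_, ?_, ?_⟩ <;> rwa [hf _ (by omega) (by omega)]

theorem seg_ready (D : SearchData α q ξ β Q R m n f F)
    (hP : Located P ℓ ((searchLoop Q R m n).compile ℓ)) (hr : SearchReady α q ξ β r)
    (h : Seg P α ℓ (ℓ + (searchLoop Q R m n).size) ℓ r d T k S) :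
    Seg P α ℓ (ℓ + (searchLoop Q R m n).size) ℓ r d T k
      (fun s => S s ∧ SearchReady α q ξ β s) :=
  (h.frame D.closed.isSuccLimit hr.1).mono le_rfl le_rfl le_rfl (fun _ hs => hs.1)
    fun _ hs => ⟨hs.1, D.ready hP hr hs.2.1 hs.2.2⟩

theorem seg_step (D : SearchData α q ξ β Q R m n f F)
    (hP : Located P ℓ ((searchLoop Q R m n).compile ℓ)) (hr : SearchReady α q ξ β r)
    (h7 : r 7 = a) (h8 : r 8 = a + y) (ha : a = pair (pair (a₀, b₀), pair (x, w))) (hpos : 0 < a)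
    (hκ : NodeBound R α ξ β w κ)
    (h : (y = κ ∧ a' = a₀ ∧ b' = b₀ + 1) ∨
      (y ≠ κ ∧ w = β ∧ a' = pair (pair (a, a + y), pair (x, y)) ∧ b' = a') ∨
      (y ≠ κ ∧ w ≠ β ∧ ((Q.Outputs α [pair (y, x), q] 1 ∧
        a' = pair (pair (a, a + y), pair (y, β)) ∧ b' = a') ∨
      (Q.Outputs α [pair (y, x), q] 0 ∧ a' = a ∧ b' = a + y + 1)))) :
    Seg P α ℓ (ℓ + (searchLoop Q R m n).size) ℓ r 1 (Between a (a + y) a' b') ℓ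
      (fun s => (s 7 = a' ∧ s 8 = b') ∧ SearchReady α q ξ β s) := by
  refine D.seg_ready hP hr ?_
  obtain ⟨h1, h21, h22, h23, h24, h25⟩ := hr
  refine (seg_loop_step hP (T := Between a (a + y) a' b') ⟨.inl h7, .inl h8⟩ ?_
    (exec_searchBody (z := b₀) D.closed h1 D.regsLt_left D.two_le_left D.regsLt_right
      D.two_le_right h7 h8 ha h21 h22 h23 h25 hκ ?_) fun s hs => ⟨.inr hs.1, .inr hs.2⟩).mono
      le_rfl le_rfl (by simp) (fun _ => id) fun _ => id
  · simpa only [Cond.Holds, h7, h24] using hpos.ne'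
  · refine h.imp_left ?_
    rintro ⟨rfl, rfl, rfl⟩
    exact ⟨rfl, rfl, rfl⟩

/-- Visit all children of a node and return to its context. -/
theorem seg_node (D : SearchData α q ξ β Q R m n f F)
    (hP : Located P ℓ ((searchLoop Q R m n).compile ℓ)) (hr : SearchReady α q ξ β r)
    (h7 : r 7 = a) (h8 : r 8 = a) (ha : a = pair (pair (a₀, b₀), pair (x, w))) (hpos : 0 < a)
    (hκ : NodeBound R α ξ β w κ) (hκα : κ < α) (e : Ordinal.{u} → Ordinal.{u})
    (he : ∀ y < κ, 0 < e y) (hd : ∀ X, (∀ y < κ, e y ≤ X) → d ≤ X)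
    (step : ∀ y < κ, ∀ s, SearchReady α q ξ β s → s 7 = a → s 8 = a + y →
      Seg P α ℓ (ℓ + (searchLoop Q R m n).size) ℓ s (e y) (fun s' => a ≤ s' 7 ∧ a + y ≤ s' 8) ℓ
        (fun s' => s' 7 = a ∧ s' 8 = a + y + 1)) :
    Seg P α ℓ (ℓ + (searchLoop Q R m n).size) ℓ r (d + 1) (fun s => a₀ ≤ s 7 ∧ b₀ ≤ s 8) ℓ
      (fun s => s 7 = a₀ ∧ s 8 = b₀ + 1) := by
  have hα := D.closed.isSuccLimit
  -- Pairing dominates its components, so while this node is on the stack the registers 7 and 8 stay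
  -- above the context to which the search returns.
  have ha₀ : a₀ ≤ a := by rw [ha]; exact (fst_le _ _).trans (fst_le _ _)
  have hb₀ : b₀ ≤ a := by rw [ha]; exact (snd_le _ _).trans (fst_le _ _)
  have haα : a < α := h7 ▸ hr.1 7
  have scan := Seg.concat (P := P) (a := ℓ) (hi := ℓ + (searchLoop Q R m n).size) (d := d) hα
    ![7, 8] (fun θ => ![a, a + θ]) κ e he (T := fun s => a₀ ≤ s 7 ∧ b₀ ≤ s 8)
    (fun lam hle hlam j => ?_) hr.1 (fun j => ?_) (fun y hy s h1 h2 h3 => ?_) hd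
  · refine (D.seg_ready hP hr (scan.mono (T' := fun s => a₀ ≤ s 7 ∧ b₀ ≤ s 8) le_rfl le_rfl le_rfl
      (fun _ hs => hs) fun _ => id)).trans fun s hs => ?_
    refine (D.seg_step hP hs.2 (hs.1 0) (hs.1 1) ha hpos hκ (.inl ⟨rfl, rfl, rfl⟩)).mono le_rfl
      le_rfl le_rfl (fun s' hs' => ⟨?_, ?_⟩) fun s' hs' => hs'.1
    · rcases hs'.1 with h | h <;> rw [h]
      exact ha₀
    · rcases hs'.2 with h | h <;> rw [h]
      · exact hb₀.trans le_self_add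
      · exact le_self_add
  · fin_cases j
    · exact ⟨a, isLimInf_const hlam _, (reset_of_lt haα).symm⟩
    -- The scan has length `κ < α`, so `a + lam` stays below `α` by additive closure and no reset
    -- occurs.
    · exact ⟨_, isLimInf_add a hlam,
        (reset_of_lt (D.closed.add_lt haα (hle.trans_lt hκα))).symm⟩
  · fin_cases j
    · exact h7
    · simpa using h8
  · refine (step y hy s (D.ready hP hr h1 h2) (h3 0) (h3 1)).mono le_rfl le_rfl le_rfl
      (fun s' hs' => ?_) (fun s' hs' => ?_)
    · refine ⟨fun j => ?_, ha₀.trans hs'.1, hb₀.trans (le_self_add.trans hs'.2)⟩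
      fin_cases j
      · exact (min_le_left _ _).trans hs'.1
      · exact (min_le_left _ _).trans hs'.2
    · intro j
      fin_cases j
      · exact hs'.1
      · exact hs'.2.trans (add_assoc _ _ _)

/-- Visit a node with label `pair (x, β)`. -/
theorem seg_visit (D : SearchData α q ξ β Q R m n f F)
    (hP : Located P ℓ ((searchLoop Q R m n).compile ℓ)) (hx : x < α)
    (hr : SearchReady α q ξ β r) (h7 : r 7 = pair (pair (a₀, b₀), pair (x, β)))
    (h8 : r 8 = pair (pair (a₀, b₀), pair (x, β))) :
    Seg P α ℓ (ℓ + (searchLoop Q R m n).size) ℓ r (F x + 1) (fun s => a₀ ≤ s 7 ∧ b₀ ≤ s 8) ℓ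
      (fun s => s 7 = a₀ ∧ s 8 = b₀ + 1) := by
  classical
  induction hδ : F x using WellFoundedLT.induction generalizing x r a₀ b₀ with
  | _ δ ih =>
  subst hδ
  have hpos : ∀ c x : Ordinal.{u}, 0 < pair (c, pair (x, β)) := fun c x =>
    D.pos.trans_le ((snd_le _ _).trans (snd_le _ _))
  have hbetween : ∀ {c d l : Ordinal.{u}} {s : ℕ → Ordinal.{u}},
      Between c d (pair (pair (c, d), l)) (pair (pair (c, d), l)) s → c ≤ s 7 ∧ d ≤ s 8 := by
    rintro c d l s ⟨h1, h2⟩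
    refine ⟨?_, ?_⟩
    · rcases h1 with h | h <;> rw [h]
      exact (fst_le _ _).trans (fst_le _ _)
    · rcases h2 with h | h <;> rw [h]
      exact (snd_le _ _).trans (fst_le _ _)
  -- Block `y` contains the searches from all `z < f y` of smaller rank, so it lasts at least the
  -- supremum of their lower bounds `F z + 1`.
  let dur : Ordinal.{u} → Ordinal.{u} := fun y => sInf {X | ∀ z < f y, F z < F x → F z + 1 ≤ X}
  refine D.seg_node hP hr h7 h8 rfl (hpos _ _) ⟨fun _ => rfl, fun h => (h rfl).elim⟩ D.lt
    (fun y => dur y + 1) (fun _ _ => by simp) (fun X hX => ?_) fun y hy s hs s7 s8 => ?_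
  -- Every ordinal below `F x` is the rank of some `z`, and cofinality of `f` puts `z` into some
  -- block; thus the blocks together last at least `F x`.
  · by_contra! hlt
    obtain ⟨z, hz, rfl⟩ := D.surj x hx X hlt
    obtain ⟨w, hw, hw'⟩ := D.cofinal (z + 1) (D.closed.isSuccLimit.succ_lt hz)
    have h1 : F z + 1 ≤ dur w := le_csInf ⟨F x, fun z' _ h => Order.add_one_le_of_lt h⟩
      fun X hX => hX z (Order.add_one_le_iff.1 hw') hlt
    have h2 := (lt_add_one (dur w)).trans_le (hX w hw)
    exact (Order.add_one_le_iff.1 h1).not_gt h2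
  set a := pair (pair (a₀, b₀), pair (x, β)) with ha
  refine ((D.seg_step hP hs s7 s8 ha (hpos _ _) ⟨fun _ => rfl, fun h => (h rfl).elim⟩
    (.inr (.inl ⟨hy.ne, rfl, rfl, rfl⟩))).mono le_rfl le_rfl le_rfl (fun _ => hbetween)
    fun _ => id).trans (d' := dur y + 1) (fun s' hs' => ?_) |>.mono le_rfl le_rfl le_add_self
      (fun _ => id) fun _ => id
  obtain ⟨⟨s7', s8'⟩, hs'⟩ := hs'
  refine D.seg_node hP hs' s7' s8' rfl ((hpos _ _).trans_le ((fst_le _ _).trans (fst_le _ _)))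
    ⟨fun h => (hy.ne h).elim, fun _ => D.outputs_right y hy⟩ (D.map_lt y hy)
    (fun z => if F z < F x then F z + 1 else 1) (fun z _ => by split_ifs <;> simp)
    (fun X hX => csInf_le' fun z hz hlt => by simpa [hlt] using hX z hz) ?_
  intro z hz t ht t7 t8
  have hzα : z < α := hz.trans (D.map_lt y hy)
  set c := pair (pair (a, a + y), pair (x, y)) with hc
  have hcpos : 0 < c := (hpos _ _).trans_le ((fst_le _ _).trans (fst_le _ _))
  have hκ : NodeBound R α ξ β y (f y) := ⟨fun h => (hy.ne h).elim, fun _ => D.outputs_right y hy⟩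
  split_ifs with hlt
  · refine ((D.seg_step hP ht t7 t8 hc hcpos hκ (.inr (.inr ⟨hz.ne, hy.ne,
      .inl ⟨D.outputs_one z hzα x hx hlt, rfl, rfl⟩⟩))).mono le_rfl le_rfl le_rfl
      (fun _ => hbetween) fun _ => id).trans (d' := F z + 1) (fun s' hs' => ?_)
      |>.mono le_rfl le_rfl le_add_self (fun _ => id) fun _ => id
    exact ih _ hlt hzα hs'.2 hs'.1.1 hs'.1.2 rfl
  · refine (D.seg_step hP ht t7 t8 hc hcpos hκ (.inr (.inr ⟨hz.ne, hy.ne,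
      .inr ⟨D.outputs_zero z hzα x hx hlt, rfl, rfl⟩⟩))).mono le_rfl le_rfl le_rfl
      (fun s' hs' => ⟨?_, ?_⟩) fun _ hs => hs.1
    · rcases hs'.1 with h | h <;> rw [h]
    · rcases hs'.2 with h | h <;> rw [h]
      exact (lt_add_one _).le

/-- The context of the root is `pair (0, 0) = 0`, so returning from the root puts 0 into register 7
and ends the loop. The exit jump adds one step to the `F x + 1` of the visit. -/
theorem exec_searchCmd (D : SearchData α q ξ β Q R m n f F) {ζ : Ordinal.{u}} (hζ : ζ < α)
    (hx : x < α) (h : ∀ j < 4, entry ζ j = [x, q, ξ, β].getD j 0) :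
    Exec α (searchCmd Q R m n) (F x + 2) (initial [ζ]).reg (fun _ => True) (fun _ => True) := by
  have hα := D.closed.isSuccLimit
  have hr := initial_reg_lt hα.bot_lt (v := [ζ]) (by simp [hζ])
  have hr0 : ∀ i, 1 ≤ i → (initial [ζ]).reg i = 0 := fun i hi => by
    obtain ⟨j, rfl⟩ := Nat.exists_eq_add_of_le hi
    rw [add_comm]; rfl
  refine exec_seq hα hr (exec_decodeCmd D.closed hr (by omega) (by omega) (by omega) 4) ?_
  intro r1 h1 hr1 f1
  replace h1 : ∀ j < 4, r1 (20 + j) = [x, q, ξ, β].getD j 0 := fun j hj => (h1 j hj).trans (h j hj)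
  have g1 : ∀ k, k = 24 ∨ k = 25 → r1 k = 0 := fun k hk => by
    rw [f1 k fun hw => by have := decodeCmd_writes hw; omega, hr0 k (by omega)]
  refine exec_seq hα hr1 (exec_inc trivial (Q := fun s => s = Function.update r1 25 1)
    (by rw [g1 25 (by omega), zero_add])) ?_
  rintro r2 rfl hr2 -
  refine exec_seq hα hr2 (exec_pairCmd D.closed hr2 (by omega) (by omega)) fun r3 h3 hr3 f3 => ?_
  refine exec_seq hα hr3 (exec_pairCmd D.closed hr3 (by omega) (by omega)) fun r4 h4 hr4 f4 => ?_
  have g4 : ∀ k, 20 ≤ k → r4 k = Function.update r1 25 1 k := fun k hk => by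
    rw [f4 k (by rw [pairCmd_writes]; omega), f3 k (by rw [pairCmd_writes]; omega)]
  have e20 : Function.update r1 25 1 20 = x := (Function.update_of_ne (by omega) _ _).trans
    (h1 0 (by omega))
  have e23 : Function.update r1 25 1 23 = β := (Function.update_of_ne (by omega) _ _).trans
    (h1 3 (by omega))
  have e24 : r3 24 = 0 := by
    rw [f3 24 (by simp), Function.update_of_ne (by omega), g1 24 (by omega)]
  have e7 : r4 7 = pair (pair (0, 0), pair (x, β)) := by
    rw [h4, h3, e20, e23, e24, show pair (0, 0) = 0 by rw [← unpair_zero, pair_unpair]]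
  refine exec_seq hα hr4 (exec_copy trivial
    (Q := fun s => s = Function.update r4 8 (pair (pair (0, 0), pair (x, β)))) (by rw [e7])) ?_
  rintro r5 rfl hr5 -
  intro P ℓ hP
  have hready : SearchReady α q ξ β
      (Function.update r4 8 (pair (pair (0, 0), pair (x, β)))) := by
    refine ⟨hr5, ?_, ?_, ?_, ?_, ?_⟩ <;> rw [Function.update_of_ne (by omega), g4 _ (by omega)]
    · exact (Function.update_of_ne (by omega) _ _).trans (h1 1 (by omega))
    · exact (Function.update_of_ne (by omega) _ _).trans (h1 2 (by omega))
    · exact e23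
    · exact (Function.update_of_ne (by omega) _ _).trans (g1 24 (by omega))
    · simp
  have key := D.seg_ready hP hready (D.seg_visit hP hx hready (a₀ := 0) (b₀ := 0)
    (by rw [Function.update_of_ne (by omega), e7]) (Function.update_self _ _ _))
  refine ((key.mono le_rfl le_rfl le_rfl (fun _ _ => trivial) fun _ => id).trans (d' := 1)
    fun s hs => seg_loop_exit hP trivial ?_ trivial).mono le_rfl le_rfl ?_ (fun _ => id) fun _ => id
  · simp only [Cond.Holds, hs.1.1, hs.2.2.2.2.2.1, not_true_eq_false, not_false_eq_true]
  · rw [add_assoc, one_add_one_eq_two]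

theorem exists_clockable (D : SearchData α q ξ β Q R m n f F) (hq : q < α) (hξ : ξ < α)
    (hx : x < α) : ∃ τ, Clockable α τ ∧ F x < τ := by
  have hα := D.closed.isSuccLimit
  obtain ⟨ζ, hζ, h⟩ := exists_entry_eq D.closed 4 (fun j => [x, q, ξ, β].getD j 0)
    (fun j _ => by
      match j with
      | 0 => exact hx
      | 1 => exact hq
      | 2 => exact hξ
      | 3 => exact D.lt
      | j + 4 => exact hα.bot_lt)
  obtain ⟨τ, h1, h2, -⟩ := Exec.haltsIn (by simp only [searchCmd, Cmd.size]; omega)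
    (D.exec_searchCmd hζ hx h)
  refine ⟨τ, ⟨_, ζ, hζ, h1⟩, ?_⟩
  rw [← one_add_one_eq_two, ← add_assoc] at h2
  exact Order.add_one_le_iff.1 (Order.lt_add_one_iff.1 (Order.add_one_le_iff.1 h2))

end SearchData

/-- A code orders `α` by the values of a surjection onto `γ`. Surjectivity makes this map the rank
function of the relation, and the search from a preimage of `δ` lasts longer than `δ`. -/
theorem ComputableOrdinal.exists_clockable {α γ δ : Ordinal.{u}} (hexp : ExponentiallyClosed α)
    (hsing : Singular α) (h : ComputableOrdinal α γ) (hδ : δ < γ) :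
    ∃ τ, Clockable α τ ∧ δ < τ := by
  classical
  obtain ⟨c, ⟨rfl, -⟩ | ⟨F, hF, rfl⟩, -, Q, q, hq, hQ⟩ := h
  · exact (not_lt_zero hδ).elim
  obtain ⟨β, hβ, f, hf, hcof, R, ξ, hξ, hR⟩ := hsing
  obtain ⟨m, hm2, hm⟩ := Q.exists_regsLt 2
  obtain ⟨n, hn2, hn⟩ := R.exists_regsLt 2
  obtain ⟨G, hG⟩ : ∃ G : Ordinal.{u} → Ordinal.{u}, ∀ x : Iio α, G x.1 = (F x).1 :=
    ⟨fun x => if h : x < α then (F ⟨x, h⟩).1 else 0, fun x => dif_pos x.2⟩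
  have hmem : ∀ y < α, ∀ x < α, (pair (y, x) ∈ {o | ∃ ι ξ : Iio α, F ι < F ξ ∧
      o = pair (ι.1, ξ.1)} ↔ G y < G x) := by
    intro y hy x hx
    rw [hG ⟨y, hy⟩, hG ⟨x, hx⟩]
    constructor
    · rintro ⟨ι, ξ, h, he⟩
      obtain ⟨rfl, rfl⟩ := Prod.mk.inj (pair_injective he)
      exact h
    · exact fun h => ⟨⟨y, hy⟩, ⟨x, hx⟩, h, rfl⟩
  have D : SearchData α q ξ β Q R m n f G :=
    { closed := hexp, regsLt_left := hm, two_le_left := hm2, regsLt_right := hn,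
      two_le_right := hn2, lt := hβ, map_lt := hf, cofinal := hcof, outputs_right := hR
      surj := fun x hx δ hδ => by
        rw [hG ⟨x, hx⟩] at hδ
        obtain ⟨y, hy⟩ := hF ⟨δ, hδ.trans (F ⟨x, hx⟩).2⟩
        exact ⟨y.1, y.2, by rw [hG, hy]⟩
      outputs_one := fun y hy x hx h => (hQ _ (pair_lt hexp hy hx)).1 ((hmem y hy x hx).2 h)
      outputs_zero := fun y hy x hx h =>
        (hQ _ (pair_lt hexp hy hx)).2 fun h' => h ((hmem y hy x hx).1 h') }
  obtain ⟨x, hx⟩ := hF ⟨δ, hδ⟩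
  have := D.exists_clockable hq hξ x.2
  rwa [hG, hx] at this

/-- A surjection from `α` onto `γ` gives `|γ| ≤ |α|`, so `γ` is below the next cardinal. -/
theorem bddAbove_computableOrdinal (α : Ordinal.{u}) :
    BddAbove {γ : Ordinal.{u} | ComputableOrdinal α γ} := by
  refine ⟨(succ α.card).ord, fun γ hγ => ?_⟩
  obtain ⟨c, ⟨rfl, -⟩ | ⟨F, hF, -⟩, -⟩ := hγ
  · exact zero_le
  · have h := Cardinal.mk_le_of_surjective hF
    rw [Cardinal.mk_Iio_ordinal, Cardinal.mk_Iio_ordinal, Cardinal.lift_le] at h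
    exact (Cardinal.lt_ord.2 (lt_succ_iff.2 h)).le

end Search

end ITRM

theorem mainTheorem4 (α : Ordinal.{u}) (hexp : ITRM.ExponentiallyClosed α)
    (hsing : ITRM.Singular α) :
    (∀ β : Ordinal.{u}, ITRM.Clockable α β → ITRM.ComputableOrdinal α β) ∧
    ∃ σ : Ordinal.{u}, IsLUB {β : Ordinal.{u} | ITRM.Clockable α β} σ ∧
      IsLUB {β : Ordinal.{u} | ITRM.ComputableOrdinal α β} σ := by
  have hω := hsing.omega0_lt hexp
  have hcl : ∀ β : Ordinal.{u}, ITRM.Clockable α β → ITRM.ComputableOrdinal α β :=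
    fun β h => h.computableOrdinal hexp hω
  have hne : {β : Ordinal.{u} | ITRM.ComputableOrdinal α β}.Nonempty :=
    ⟨0, ITRM.computableOrdinal_zero hexp.isSuccLimit⟩
  have hlub := isLUB_csSup hne (ITRM.bddAbove_computableOrdinal α)
  refine ⟨hcl, _, ⟨fun β h => hlub.1 (hcl β h), fun σ hσ => hlub.2 fun γ hγ => ?_⟩, hlub⟩
  -- A computable `γ` above an upper bound `σ` of the clockable ordinals would yield a clockable
  -- ordinal above `σ`.
  by_contra! hlt
  obtain ⟨τ, h1, h2⟩ := hγ.exists_clockable hexp hsing hlt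
  exact (hσ h1).not_gt h2
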